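/- **Setting.** Let $\mathbb{T}^2=\mathbb{R}^2/\mathbb{Z}^2$ and let the time interval be $[0,1]$; $L^pL^q$ denotes $L^p([0,1];L^q(\mathbb{T}^2))$ and $C^0L^1$ denotes $C^0([0,1];L^1(\mathbb{T}^2))$; $\mathbb{N}=\{1,2,\dots\}$. For $u\in L^1([0,1];L^1(\mathbb{T}^2;\mathbb{R}^2))$ with $\nabla\cdot u=0$ in the distributional sense, a *weak solution along $u$ with initial data $f_0\in L^1(\mathbb{T}^2)$* is an $f\in L^1L^1$ with $uf\in L^1L^1$ and $\int_{\mathbb{T}^2\times[0,1)}f(\partial_t\phi+u\cdot\nabla\phi)\,dx\,dt=-\int_{\mathbb{T}^2}f_0\,\phi(\cdot,0)\,dx$ for all $\phi\in C_c^\infty(\mathbb{T}^2\times[0,1))$. It is *renormalised* if, for every bounded continuous $\beta:\mathbb{R}\to\mathbb{R}$, $\beta(f)$ is a weak solution along $u$ with initial data $\beta(f_0)$. A *Lagrangian flow along $u$* is a family of Lebesgue-measure preserving bijections $y_t:\mathbb{T}^2\to\mathbb{T}^2$, $t\in[0,1]$, such that for a.e. $x$ the curve $t\mapsto y_t(x)$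 is absolutely continuous with $\frac{d}{dt}y_t(x)=u(y_t(x),t)$ for a.e. $t$; $f\in L^1L^1$ is a *Lagrangian solution with initial data $f_0$* if $f(\cdot,t)=g\circ y_t^{-1}$ for all $t\in[0,1]$ and $f_0=g\circ y_0^{-1}$, for such a flow and some $g\in L^1(\mathbb{T}^2)$. For $i\in\{1,2\}$ let $\hat i$ be the other index. For $L\in\mathbb{N}$ let $u^{(i;L)}(x)=e_i$ if $x_{\hat i}\in[\frac{m}{2L},\frac{m+1}{2L})$ with $m$ even, and $u^{(i;L)}(x)=-e_i$ if $m$ is odd; put $y^{(i;L)}_t(x)=x+t\,u^{(i;L)}(x)$ for $t\in\mathbb{R}$. Let $\mathcal{D}=\{(k,m):k\in\mathbb{N},\,m\in\mathbb{Z},\,0\le m<2^k\}$ and $\mathcal{D}_K=\{(k,m)\in\mathcal{D}:k\le K\}$. Write $(k_1,m_1)<_{\mathrm{time}}(k_2,m_2)$ if $m_12^{-k_1}<m_22^{-k_2}$, or if $m_12^{-k_1}=m_22^{-k_2}$ and $k_1<k_2$. Put $t_{k,m}=\sum_{(k',m')<_{\mathrm{time}}(k,m)}2^{-2k'}$, the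 sum being over $(k',m')\in\mathcal{D}$. Let $i_k\in\{1,2\}$, $L_k\in\mathbb{N}$, $\tau_k>0$ $(k\in\mathbb{N})$ satisfy the *Finiteness Condition* $\tau_k<2^{-2k}$ for all $k\in\mathbb{N}$, so that the intervals $[t_{k,m},t_{k,m}+\tau_k]$, $(k,m)\in\mathcal{D}$, are disjoint subsets of $[0,1]$. Define $u_K(x,t)=u^{(i_k;L_k)}(x)$ if $t\in[t_{k,m},t_{k,m}+\tau_k]$ for some $(k,m)\in\mathcal{D}_K$, and $u_K(x,t)=0$ otherwise; define $u_\infty$ in the same way with $\mathcal{D}$ in place of $\mathcal{D}_K$. Let $f_0\in L^\infty(\mathbb{T}^2)$. **Proposition.** (1) For each $K\in\mathbb{N}$ there is a weak solution $f^K$ along $u_K$ with initial data $f_0$, unique in the class of all weak solutions. Moreover $f^K\in(C^0L^1)\cap(L^\infty L^\infty)$, and $f^K$ is a Lagrangian solution and a renormalised weak solution with initial data $f_0$. (2) Suppose in addition the *Cancellation Conditions*: for all $k\in\mathbb{N}$, $i_{k+1}\neq i_k$, $2\tau_{k+1}=\frac1{2L_k}$, and $2L_{k+1}\tau_k$ is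 an odd integer. Then there are $f^{\mathrm{even}},f^{\mathrm{odd}}\in L^\infty L^\infty$, weak-$*$ continuous as maps $[0,1]\to L^\infty(\mathbb{T}^2)$, such that $f^{2K}\to f^{\mathrm{even}}$ and $f^{2K+1}\to f^{\mathrm{odd}}$ as $K\to\infty$, both in weak-$*$ $L^\infty L^\infty$ and strongly in $L^pL^\infty$ for every $p\in[1,\infty)$. The sequences $f^{2K}$ and $f^{2K+1}$ are eventually constant (equal to $f^{\mathrm{even}}$, respectively $f^{\mathrm{odd}}$) on $\mathbb{T}^2\times[t_{k,m},t_{k,m}+2^{-2k}]$ for every $(k,m)\in\mathcal{D}$, and on $\mathbb{T}^2\times\{1\}$. Both $f^{\mathrm{even}}$ and $f^{\mathrm{odd}}$ are renormalised weak solutions along $u_\infty$ with initial data $f_0$, and $$f^{\mathrm{even}}(\cdot,1)=f_0,\qquad f^{\mathrm{odd}}(\cdot,1)=f_0\circ y^{(i_1;L_1)}_{-2\tau_1}.$$ If $f_0$ is not (a.e. equal to a) constant, then $f^{\mathrm{even}}\neq f^{\mathrm{odd}}$ as elements of $L^\infty L^\infty$. -/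

import Mathlib

open MeasureTheory Filter Topology Set
open scoped ContDiff ENNReal

noncomputable section

namespace FractalShear

/-! ### The torus, space-time, and test functions -/

/-- The two-dimensional unit torus `ℝ² / ℤ²`, with its normalised Lebesgue measure `volume`.
The coordinates `1, 2` of the text are the elements `0, 1` of `Fin 2`. -/
abbrev T2 : Type := Fin 2 → UnitAddCircle

/-- The quotient map `ℝ² → ℝ² / ℤ²`. -/
def toT2 (x : Fin 2 → ℝ) : T2 := fun j => (x j : UnitAddCircle)

/-- Lebesgue measure on `[0,1] × 𝕋²` (time comes first). -/
def spaceTime : Measure (ℝ × T2) :=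
  ((volume : Measure ℝ).restrict (Icc 0 1)).prod (volume : Measure T2)

/-- Test functions in `C_c^∞(𝕋² × [0,1))`: functions that are smooth (as periodic functions, up to
and including `t = 0`) and vanish for times close to `1`. -/
structure IsTestFunction (φ : ℝ → T2 → ℝ) : Prop where
  smooth : ContDiff ℝ ∞ (fun p : ℝ × (Fin 2 → ℝ) => φ p.1 (toT2 p.2))
  vanish : ∃ s < (1 : ℝ), ∀ t, s ≤ t → ∀ x, φ t x = 0

/-- The time derivative. -/
def timeDeriv (φ : ℝ → T2 → ℝ) (t : ℝ) (x : T2) : ℝ := deriv (fun s => φ s x) t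

/-- The spatial partial derivative in the direction of the `j`-th coordinate. -/
def partialDeriv (j : Fin 2) (φ : ℝ → T2 → ℝ) (t : ℝ) (x : T2) : ℝ :=
  deriv (fun h : ℝ => φ t (x + Pi.single j (h : UnitAddCircle))) 0

/-- `(u · ∇φ)(x, t)`. -/
def advect (u : ℝ → T2 → (Fin 2 → ℝ)) (φ : ℝ → T2 → ℝ) (t : ℝ) (x : T2) : ℝ :=
  ∑ j, u t x j * partialDeriv j φ t x

/-! ### Weak, renormalised and Lagrangian solutions on the time interval `[0,1]` -/

/-- `u ∈ L¹([0,1]; L¹(𝕋²; ℝ²))` with `∇ · u = 0` in the sense of distributions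
on `𝕋² × (0,1)`. -/
structure IsDivFree (u : ℝ → T2 → (Fin 2 → ℝ)) : Prop where
  integrable : Integrable (fun p : ℝ × T2 => u p.1 p.2) spaceTime
  div_free : ∀ φ : ℝ → T2 → ℝ, IsTestFunction φ → (∃ r > (0 : ℝ), ∀ t ≤ r, ∀ x, φ t x = 0) →
    ∫ p, advect u φ p.1 p.2 ∂spaceTime = 0

/-- `f` is a weak solution of `∂ₜ f + ∇ · (u f) = 0` on `𝕋² × [0,1]` with initial data `f₀`. -/
structure IsWeakSolution (u : ℝ → T2 → (Fin 2 → ℝ)) (f₀ : T2 → ℝ) (f : ℝ → T2 → ℝ) : Prop where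
  velocity : IsDivFree u
  data : Integrable f₀ volume
  integrable : Integrable (fun p : ℝ × T2 => f p.1 p.2) spaceTime
  flux : Integrable (fun p : ℝ × T2 => f p.1 p.2 • u p.1 p.2) spaceTime
  weak : ∀ φ : ℝ → T2 → ℝ, IsTestFunction φ →
    ∫ p, f p.1 p.2 * (timeDeriv φ p.1 p.2 + advect u φ p.1 p.2) ∂spaceTime
      = - ∫ x, f₀ x * φ 0 x

/-- Renormalised weak solutions. -/
structure IsRenormalised (u : ℝ → T2 → (Fin 2 → ℝ)) (f₀ : T2 → ℝ) (f : ℝ → T2 → ℝ) : Prop where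
  weak : IsWeakSolution u f₀ f
  renorm : ∀ β : ℝ → ℝ, Continuous β → (∃ C, ∀ s, |β s| ≤ C) →
    IsWeakSolution u (fun x => β (f₀ x)) (fun t x => β (f t x))

/-- A Lagrangian flow along `u`: measure preserving bijections `y t`, `t ∈ [0,1]`, such that
for a.e. `x` the curve `t ↦ y t x` is absolutely continuous with derivative `u (y t x, t)` for
a.e. `t`. Absolute continuity and derivative of a curve in `ℝ² / ℤ²` are those of a
lift `γ` of the curve to `ℝ²`. -/
structure IsLagrangianFlow (u : ℝ → T2 → (Fin 2 → ℝ)) (y : ℝ → T2 ≃ᵐ T2) : Prop where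
  velocity : IsDivFree u
  measurePreserving : ∀ t ∈ Icc (0 : ℝ) 1, MeasurePreserving (y t) volume volume
  curve : ∀ᵐ x : T2, ∃ γ : ℝ → (Fin 2 → ℝ),
    AbsolutelyContinuousOnInterval γ 0 1 ∧
    (∀ t ∈ Icc (0 : ℝ) 1, toT2 (γ t) = y t x) ∧
    (∀ᵐ t ∂(volume : Measure ℝ).restrict (Icc 0 1), HasDerivAt γ (u t (y t x)) t)

/-- `f` is a Lagrangian solution along `u` with initial data `f₀`:
`f(·,t) = g ∘ y_t⁻¹` for a Lagrangian flow `y` and some `g ∈ L¹` with `f₀ = g ∘ y_0⁻¹`. -/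
def IsLagrangianSolution (u : ℝ → T2 → (Fin 2 → ℝ)) (f₀ : T2 → ℝ) (f : ℝ → T2 → ℝ) : Prop :=
  Integrable (fun p : ℝ × T2 => f p.1 p.2) spaceTime ∧
  ∃ (g : T2 → ℝ) (y : ℝ → T2 ≃ᵐ T2), Integrable g volume ∧ IsLagrangianFlow u y ∧
    f₀ =ᵐ[volume] (fun x => g ((y 0).symm x)) ∧
    ∀ t ∈ Icc (0 : ℝ) 1, f t =ᵐ[volume] (fun x => g ((y t).symm x))

/-! ### Function spaces -/

/-- `f ∈ C⁰([0,1]; L¹(𝕋²))`. -/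
def IsC0L1 (f : ℝ → T2 → ℝ) : Prop :=
  (∀ t ∈ Icc (0 : ℝ) 1, MemLp (f t) 1 volume) ∧
  ∀ t ∈ Icc (0 : ℝ) 1,
    Tendsto (fun s => eLpNorm (fun x => f s x - f t x) 1 volume) (𝓝[Icc 0 1] t) (𝓝 0)

/-- `f ∈ L^∞([0,1]; L^∞(𝕋²))`. -/
def IsLinftyLinfty (f : ℝ → T2 → ℝ) : Prop :=
  MemLp (fun p : ℝ × T2 => f p.1 p.2) ⊤ spaceTime

/-- `f : [0,1] → L^∞(𝕋²)` is continuous for the weak-* topology of `L^∞ = (L¹)*`. -/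
def IsC0WeakStarLinfty (f : ℝ → T2 → ℝ) : Prop :=
  (∀ t ∈ Icc (0 : ℝ) 1, MemLp (f t) ⊤ volume) ∧
  ∀ g : T2 → ℝ, Integrable g volume →
    ContinuousOn (fun t => ∫ x, f t x * g x) (Icc 0 1)

/-- Weak-* convergence in `L^∞([0,1]; L^∞(𝕋²))`, the dual of `L¹([0,1]; L¹(𝕋²))`. -/
def TendstoWeakStar (F : ℕ → ℝ → T2 → ℝ) (f : ℝ → T2 → ℝ) : Prop :=
  ∀ g : ℝ × T2 → ℝ, Integrable g spaceTime →
    Tendsto (fun K => ∫ p, F K p.1 p.2 * g p ∂spaceTime) atTop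
      (𝓝 (∫ p, f p.1 p.2 * g p ∂spaceTime))

/-- The norm of `L^p([0,1]; L^∞(𝕋²))`. -/
def normLpLinfty (p : ℝ) (f : ℝ → T2 → ℝ) : ℝ≥0∞ :=
  (∫⁻ t in Icc (0 : ℝ) 1, (eLpNorm (f t) ⊤ volume) ^ p) ^ (1 / p)

/-! ### Lagrangian shears -/

/-- `1` if `z ∈ [m/(2L), (m+1)/(2L))` modulo `1` for an even `m`, and `-1` if this holds for
an odd `m`. -/
def shearSign (L : ℕ) (z : UnitAddCircle) : ℝ :=
  if Even ⌊2 * (L : ℝ) * (AddCircle.equivIco (1 : ℝ) 0 z : ℝ)⌋ then 1 else -1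

/-- The shear `u^{(i;L)}`; the other index is `1 - i`. -/
def shearField (i : Fin 2) (L : ℕ) (x : T2) : Fin 2 → ℝ :=
  Pi.single i (shearSign L (x (1 - i)))

/-- The flow `y_t^{(i;L)}` of the shear. -/
def shearFlow (i : Fin 2) (L : ℕ) (t : ℝ) (x : T2) : T2 :=
  x + Pi.single i ((t * shearSign L (x (1 - i)) : ℝ) : UnitAddCircle)

/-! ### The dyadic ordering and fractal shear flows -/

/-- The set `𝒟` of pairs `(k, m)` with `k ≥ 1` and `0 ≤ m < 2 ^ k`. -/
def dyadic : Set (ℕ × ℕ) := {p | 1 ≤ p.1 ∧ p.2 < 2 ^ p.1}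

/-- The set `𝒟_K` of pairs `(k, m) ∈ 𝒟` with `k ≤ K`. -/
def dyadicUpTo (K : ℕ) : Set (ℕ × ℕ) := {p | p ∈ dyadic ∧ p.1 ≤ K}

/-- The order `<_time`. -/
def timeLT (p q : ℕ × ℕ) : Prop :=
  (p.2 : ℝ) / 2 ^ p.1 < (q.2 : ℝ) / 2 ^ q.1 ∨
    ((p.2 : ℝ) / 2 ^ p.1 = (q.2 : ℝ) / 2 ^ q.1 ∧ p.1 < q.1)

/-- The times `t_{k,m}`. -/
def startTime (q : ℕ × ℕ) : ℝ :=
  ∑' p : {p : ℕ × ℕ // p ∈ dyadic ∧ timeLT p q}, ((2 : ℝ) ^ (2 * p.1.1))⁻¹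

/-- `τ_k < 2^{-2k}` for all `k ≥ 1`. -/
def FinitenessCondition (τ : ℕ → ℝ) : Prop :=
  ∀ k, 1 ≤ k → τ k < ((2 : ℝ) ^ (2 * k))⁻¹

/-- The cancellation conditions, for all `k ≥ 1`. -/
def CancellationConditions (i : ℕ → Fin 2) (L : ℕ → ℕ) (τ : ℕ → ℝ) : Prop :=
  ∀ k, 1 ≤ k → i (k + 1) ≠ i k ∧ 2 * τ (k + 1) = 1 / (2 * (L k : ℝ)) ∧
    ∃ n : ℤ, Odd n ∧ 2 * (L (k + 1) : ℝ) * τ k = n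

open Classical in
/-- The field equal to `u^{(i_k;L_k)}` at the times `t ∈ [t_{k,m}, t_{k,m} + τ_k]`, `(k,m) ∈ S`,
and `0` at all other times. Under the finiteness condition these intervals are disjoint for
distinct `(k,m) ∈ 𝒟`, so that `(k,m)` is determined by `t`. -/
def fractalField (i : ℕ → Fin 2) (L : ℕ → ℕ) (τ : ℕ → ℝ) (S : Set (ℕ × ℕ))
    (t : ℝ) (x : T2) : Fin 2 → ℝ :=
  if h : ∃ p ∈ S, t ∈ Icc (startTime p) (startTime p + τ p.1) then
    shearField (i h.choose.1) (L h.choose.1) x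
  else 0

/-- The truncated fractal shear flow `u_K`. -/
def truncatedField (i : ℕ → Fin 2) (L : ℕ → ℕ) (τ : ℕ → ℝ) (K : ℕ) : ℝ → T2 → (Fin 2 → ℝ) :=
  fractalField i L τ (dyadicUpTo K)

/-- The fractal shear flow `u_∞`. -/
def limitField (i : ℕ → Fin 2) (L : ℕ → ℕ) (τ : ℕ → ℝ) : ℝ → T2 → (Fin 2 → ℝ) :=
  fractalField i L τ dyadic

/-- The mode of convergence of a subsequence of solutions `F K` to its limit `f`: weak-* in
`L^∞ L^∞`, strongly in `L^p L^∞` for `1 ≤ p < ∞`, and the sequence is eventually constant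
(equal to `f`) on `𝕋² × [t_{k,m}, t_{k,m} + 2^{-2k}]` for each `(k,m) ∈ 𝒟` and on `𝕋² × {1}`. -/
structure FractalConvergence (F : ℕ → ℝ → T2 → ℝ) (f : ℝ → T2 → ℝ) : Prop where
  weakStar : TendstoWeakStar F f
  strong : ∀ p : ℝ, 1 ≤ p →
    Tendsto (fun K => normLpLinfty p (fun t x => F K t x - f t x)) atTop (𝓝 0)
  eventuallyConst : ∀ q ∈ dyadic, ∀ᶠ K in atTop,
    ∀ t ∈ Icc (startTime q) (startTime q + ((2 : ℝ) ^ (2 * q.1))⁻¹), F K t =ᵐ[volume] f t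
  eventuallyConst_one : ∀ᶠ K in atTop, F K 1 =ᵐ[volume] f 1

end FractalShear

end

/-!
The flow of a truncated field is a composition of measure preserving shears, and it can be written
recursively: in a block of level `k`, of length `2^{-2k}`, one runs the shear of level `k + 1`, a
block of level `k + 1`, the same shear again and a second block of level `k + 1`. Transporting the
initial data by this flow gives a solution. It is the only one: a weak solution that vanishes
initially can be tested, while a single shear acts, with functions transported by that shear and cut
off near the boundaries of its stripes, and so keeps vanishing slot by slot.

Under the cancellation conditions the shears of levels `n + 1` and `n + 2` inside a block of level
`n` compose to the square of an involution, so the flows of `u_n` and `u_{n+2}` agree at all times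
outside the blocks of level `n`, whose total length is `2^{-n}`. Since orbits move with speed at
most one, the flows of a fixed parity converge uniformly; the limit solution is the density of the
image of the initial data under the limit flow.

If the limits of the two parities agreed, the initial data would be invariant under every shear of
level `k` for the time `2 τ_k`, hence under translation by `2 τ_k` in the direction `i_k`. As
`τ_k → 0` and the directions alternate, these translations generate a dense subgroup of the torus,
and the initial data would be constant.
-/

noncomputable section

namespace FractalShear

/-! ### Measure preserving shears -/

instance isProbabilityMeasure_volume_unitAddCircle :
    IsProbabilityMeasure (volume : Measure UnitAddCircle) :=
  ⟨UnitAddCircle.measure_univ⟩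

instance isProbabilityMeasure_volume_T2 : IsProbabilityMeasure (volume : Measure T2) := by
  rw [volume_pi]
  infer_instance

instance isProbabilityMeasure_restrict_Icc :
    IsProbabilityMeasure ((volume : Measure ℝ).restrict (Icc 0 1)) :=
  ⟨by simp⟩

instance isProbabilityMeasure_spaceTime : IsProbabilityMeasure spaceTime := by
  unfold spaceTime
  infer_instance

lemma one_sub_ne (i : Fin 2) : 1 - i ≠ i := by
  revert i; decide

lemma eq_one_sub_of_ne {i j : Fin 2} (h : i ≠ j) : i = 1 - j := by
  revert i j; decide

lemma eq_or_eq_one_sub (i j : Fin 2) : j = i ∨ j = 1 - i := by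
  revert i j; decide

lemma shearSign_coe (L : ℕ) (r : ℝ) :
    shearSign L (r : UnitAddCircle) = if Even ⌊2 * (L : ℝ) * r⌋ then 1 else -1 := by
  have floor_fract : ⌊2 * (L : ℝ) * Int.fract r⌋ = ⌊2 * (L : ℝ) * r⌋ - 2 * (L * ⌊r⌋) := by
    rw [← Int.floor_sub_intCast, Int.fract]
    push_cast
    ring_nf
  have parity : Even ⌊2 * (L : ℝ) * Int.fract r⌋ ↔ Even ⌊2 * (L : ℝ) * r⌋ := by
    rw [floor_fract, Int.even_sub]
    simp only [even_two_mul, iff_true]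
  rw [shearSign, AddCircle.coe_equivIco_mk_apply]
  simp only [div_one, mul_one, parity]

lemma shearSign_eq_one_or_neg_one (L : ℕ) (z : UnitAddCircle) :
    shearSign L z = 1 ∨ shearSign L z = -1 :=
  ite_eq_or_eq _ _ _

lemma measurable_shearSign (L : ℕ) : Measurable (shearSign L) := by
  have measurable_stripe : Measurable fun z : UnitAddCircle =>
      ⌊2 * (L : ℝ) * (AddCircle.equivIco (1 : ℝ) 0 z : ℝ)⌋ :=
    Int.measurable_floor.comp (measurable_const.mul
      (measurable_subtype_coe.comp (AddCircle.measurableEquivIco (1 : ℝ) 0).measurable))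
  exact Measurable.ite (measurable_stripe (MeasurableSpace.measurableSet_top (s := {n | Even n})))
    measurable_const measurable_const

lemma shearSign_add_of_odd {L : ℕ} {c : ℝ} {n : ℤ} (hn : Odd n) (hc : 2 * (L : ℝ) * c = n)
    (z : UnitAddCircle) : shearSign L (z + (c : UnitAddCircle)) = - shearSign L z := by
  obtain ⟨r, rfl⟩ := QuotientAddGroup.mk_surjective z
  have parity : Even (⌊2 * (L : ℝ) * r⌋ + n) ↔ ¬ Even ⌊2 * (L : ℝ) * r⌋ := by
    rw [Int.even_add, ← Int.not_odd_iff_even (n := n)]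
    simp only [hn, not_true_eq_false, iff_false]
  change shearSign L ((r + c : ℝ) : UnitAddCircle) = -shearSign L (r : UnitAddCircle)
  rw [shearSign_coe, shearSign_coe, mul_add, hc, Int.floor_add_intCast]
  simp only [parity]
  split_ifs <;> simp

lemma shearFlow_apply_self (i : Fin 2) (L : ℕ) (t : ℝ) (x : T2) :
    shearFlow i L t x i = x i + ((t * shearSign L (x (1 - i)) : ℝ) : UnitAddCircle) := by
  simp [shearFlow]

lemma shearFlow_apply_one_sub (i : Fin 2) (L : ℕ) (t : ℝ) (x : T2) :
    shearFlow i L t x (1 - i) = x (1 - i) := by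
  simp [shearFlow, Pi.single_eq_of_ne (one_sub_ne i)]

lemma shearFlow_shearFlow (i : Fin 2) (L : ℕ) (s t : ℝ) (x : T2) :
    shearFlow i L s (shearFlow i L t x) = shearFlow i L (t + s) x := by
  conv_lhs => rw [shearFlow, shearFlow_apply_one_sub]
  rw [shearFlow, shearFlow, add_assoc, ← Pi.single_add, add_mul]
  rfl

@[simp] lemma shearFlow_zero (i : Fin 2) (L : ℕ) (x : T2) : shearFlow i L 0 x = x := by
  simp [shearFlow]

lemma continuous_shearFlow_time (i : Fin 2) (L : ℕ) (x : T2) :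
    Continuous fun t => shearFlow i L t x :=
  continuous_const.add ((continuous_single i).comp
    ((AddCircle.continuous_mk' (1 : ℝ)).comp (continuous_id.mul continuous_const)))

lemma measurable_shearFlow_uncurry (i : Fin 2) (L : ℕ) :
    Measurable fun p : ℝ × T2 => shearFlow i L p.1 p.2 := by
  have measurable_shift : Measurable fun p : ℝ × T2 =>
      ((p.1 * shearSign L (p.2 (1 - i)) : ℝ) : UnitAddCircle) :=
    (AddCircle.measurable_mk' (a := (1 : ℝ))).comp (measurable_fst.mul
      ((measurable_shearSign L).comp ((measurable_pi_apply (1 - i)).comp measurable_snd)))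
  exact measurable_snd.add ((continuous_single i).measurable.comp measurable_shift)

lemma measurable_shearFlow (i : Fin 2) (L : ℕ) (t : ℝ) : Measurable (shearFlow i L t) :=
  (measurable_shearFlow_uncurry i L).comp measurable_prodMk_left

/-- The time-`t` flow map of the shear as a measurable equivalence. -/
def shearEquiv (i : Fin 2) (L : ℕ) (t : ℝ) : T2 ≃ᵐ T2 where
  toFun := shearFlow i L t
  invFun := shearFlow i L (-t)
  left_inv x := by simp [shearFlow_shearFlow]
  right_inv x := by simp [shearFlow_shearFlow]
  measurable_toFun := measurable_shearFlow i L t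
  measurable_invFun := measurable_shearFlow i L (-t)

@[simp] lemma shearEquiv_apply (i : Fin 2) (L : ℕ) (t : ℝ) (x : T2) :
    shearEquiv i L t x = shearFlow i L t x := rfl

@[simp] lemma shearEquiv_zero (i : Fin 2) (L : ℕ) :
    shearEquiv i L 0 = MeasurableEquiv.refl T2 := by
  ext x : 2; simp

open Classical in
lemma measurePreserving_piecewise {X : Type*} [MeasurableSpace X] {μ : Measure X} {s : Set X}
    (hs : MeasurableSet s) {f g : X → X} (hf : MeasurePreserving f μ μ)
    (hg : MeasurePreserving g μ μ) (hfs : f ⁻¹' s = s) (hgs : g ⁻¹' s = s) :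
    MeasurePreserving (s.piecewise f g) μ μ := by
  refine ⟨hf.measurable.piecewise hs hg.measurable, Measure.ext fun B hB => ?_⟩
  rw [Measure.map_apply (hf.measurable.piecewise hs hg.measurable) hB,
    ← measure_inter_add_sdiff (s.piecewise f g ⁻¹' B) hs, ← measure_inter_add_sdiff B hs]
  have preimage_inter : s.piecewise f g ⁻¹' B ∩ s = f ⁻¹' (B ∩ s) := by
    rw [preimage_inter, hfs]
    ext x
    by_cases hx : x ∈ s <;> simp [hx]
  have preimage_sdiff : s.piecewise f g ⁻¹' B \ s = g ⁻¹' (B \ s) := by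
    rw [preimage_sdiff, hgs]
    ext x
    by_cases hx : x ∈ s <;> simp [hx]
  rw [preimage_inter, preimage_sdiff, hf.measure_preimage (hB.inter hs).nullMeasurableSet,
    hg.measure_preimage (hB.diff hs).nullMeasurableSet]

lemma measurePreserving_shearFlow (i : Fin 2) (L : ℕ) (t : ℝ) :
    MeasurePreserving (shearFlow i L t) volume volume := by
  classical
  let right : Set T2 := {x | shearSign L (x (1 - i)) = 1}
  have preimage_right (c : T2) (hc : c (1 - i) = 0) : (· + c) ⁻¹' right = right := by
    ext x
    simp [right, hc]
  have eq_piecewise : shearFlow i L t = right.piecewise (· + Pi.single i (t : UnitAddCircle))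
      (· + Pi.single i ((-t : ℝ) : UnitAddCircle)) := by
    funext x
    by_cases hx : x ∈ right
    · rw [piecewise_eq_of_mem _ _ _ hx, shearFlow, hx, mul_one]
    · rw [piecewise_eq_of_notMem _ _ _ hx, shearFlow,
        (shearSign_eq_one_or_neg_one L _).resolve_left hx, mul_neg_one]
  have measurableSet_right : MeasurableSet right :=
    ((measurable_shearSign L).comp (measurable_pi_apply (1 - i))) (measurableSet_singleton 1)
  rw [eq_piecewise]
  exact measurePreserving_piecewise measurableSet_right (measurePreserving_add_right volume _)
    (measurePreserving_add_right volume _)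
    (preimage_right _ (Pi.single_eq_of_ne (one_sub_ne i) _))
    (preimage_right _ (Pi.single_eq_of_ne (one_sub_ne i) _))

lemma measurePreserving_shearEquiv (i : Fin 2) (L : ℕ) (t : ℝ) :
    MeasurePreserving (shearEquiv i L t) volume volume :=
  measurePreserving_shearFlow i L t

/-- The time for which a process that starts at time `a` and lasts for `T` has run at time `t`. -/
def elapsed (T a t : ℝ) : ℝ := max 0 (min (t - a) T)

lemma elapsed_of_le {T a t : ℝ} (h : t ≤ a) : elapsed T a t = 0 :=
  max_eq_left ((min_le_left _ _).trans (by linarith))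

lemma elapsed_of_ge {T a t : ℝ} (hT : 0 ≤ T) (h : a + T ≤ t) : elapsed T a t = T := by
  rw [elapsed, min_eq_right (by linarith), max_eq_right hT]

lemma elapsed_of_mem {T a t : ℝ} (h : t ∈ Icc a (a + T)) : elapsed T a t = t - a := by
  rw [elapsed, min_eq_left (by linarith [h.2]), max_eq_right (by linarith [h.1])]

lemma lipschitzWith_elapsed (T a : ℝ) : LipschitzWith 1 (elapsed T a) :=
  ((IsometryEquiv.subRight a).isometry.lipschitz.min_const T).const_max 0

/-! ### Strong continuity of composition operators on `L¹` -/

section KoopmanContinuous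

variable {X ι : Type*} [MeasurableSpace X] {μ : Measure X} [TopologicalSpace ι]

/-- The composition operators `g ↦ g ∘ T s` of a family of maps depend on `s` continuously in the
strong topology of operators on `L¹`. -/
def KoopmanContinuous (μ : Measure X) (T : ι → X → X) : Prop :=
  ∀ g : X → ℝ, Integrable g μ → ∀ t,
    Tendsto (fun s => eLpNorm (fun x => g (T s x) - g (T t x)) 1 μ) (𝓝 t) (𝓝 0)

lemma koopmanContinuous_id : KoopmanContinuous μ fun (_ : ι) x => x := by
  intro g _ t
  simp

lemma KoopmanContinuous.comp {S T : ι → X → X} (hS : KoopmanContinuous μ S)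
    (hT : KoopmanContinuous μ T) (hmS : ∀ s, MeasurePreserving (S s) μ μ)
    (hmT : ∀ s, MeasurePreserving (T s) μ μ) : KoopmanContinuous μ fun s x => S s (T s x) := by
  intro g hg t
  have integrable_S (s) : Integrable (fun x => g (S s x)) μ :=
    (hmS s).integrable_comp_of_integrable hg
  have integrable_ST (r s) : Integrable (fun x => g (S r (T s x))) μ :=
    (hmT s).integrable_comp_of_integrable (integrable_S r)
  refine tendsto_of_tendsto_of_tendsto_of_le_of_le tendsto_const_nhds
    (by simpa using (hS g hg t).add (hT _ (integrable_S t) t)) (fun _ => zero_le) fun s => ?_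
  have aestronglyMeasurable_diff : AEStronglyMeasurable (fun x => g (S s x) - g (S t x)) μ :=
    ((integrable_S s).sub (integrable_S t)).aestronglyMeasurable
  calc eLpNorm (fun x => g (S s (T s x)) - g (S t (T t x))) 1 μ
      = eLpNorm ((fun x => g (S s x) - g (S t x)) ∘ T s +
          fun x => g (S t (T s x)) - g (S t (T t x))) 1 μ := by
        congr 1
        funext x
        simp
    _ ≤ eLpNorm ((fun x => g (S s x) - g (S t x)) ∘ T s) 1 μ +
          eLpNorm (fun x => g (S t (T s x)) - g (S t (T t x))) 1 μ :=
        eLpNorm_add_le (aestronglyMeasurable_diff.comp_measurePreserving (hmT s))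
          ((integrable_ST t s).sub (integrable_ST t t)).aestronglyMeasurable le_rfl
    _ = _ := by rw [eLpNorm_comp_measurePreserving aestronglyMeasurable_diff (hmT s)]

variable [TopologicalSpace X] [BorelSpace X] [IsFiniteMeasure μ] [FirstCountableTopology ι]

lemma tendsto_eLpNorm_boundedContinuous_comp_sub {T : ι → X → X} (hT : ∀ s, Measurable (T s))
    (hc : ∀ x, Continuous fun s => T s x) (ψ : BoundedContinuousFunction X ℝ) (t : ι) :
    Tendsto (fun s => eLpNorm (fun x => ψ (T s x) - ψ (T t x)) 1 μ) (𝓝 t) (𝓝 0) := by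
  simp_rw [eLpNorm_one_eq_lintegral_enorm]
  rw [← lintegral_zero (μ := μ)]
  refine tendsto_lintegral_filter_of_dominated_convergence (fun _ => ‖2 * ‖ψ‖‖ₑ)
    (Eventually.of_forall fun s => ?_) (Eventually.of_forall fun s => Eventually.of_forall fun x =>
      ?_) (by simp [ENNReal.mul_eq_top]) (Eventually.of_forall fun x => ?_)
  · exact ((ψ.continuous.measurable.comp (hT s)).sub (ψ.continuous.measurable.comp (hT t))).enorm
  · rw [enorm_le_iff_norm_le, Real.norm_of_nonneg (r := 2 * ‖ψ‖) (by positivity), ← dist_eq_norm]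
    exact ψ.dist_le_two_norm _ _
  · have continuous_diff : Continuous fun s => ψ (T s x) - ψ (T t x) :=
      (ψ.continuous.comp (hc x)).sub continuous_const
    simpa using (continuous_diff.tendsto t).enorm

/-- By density of the bounded continuous functions in `L¹`. -/
lemma koopmanContinuous_of_continuous [NormalSpace X] [μ.WeaklyRegular] {T : ι → X → X}
    (hT : ∀ s, MeasurePreserving (T s) μ μ) (hc : ∀ x, Continuous fun s => T s x) :
    KoopmanContinuous μ T := by
  intro g hg t
  rw [ENNReal.tendsto_nhds_zero]
  intro ε hε
  have hε3 : ε / 3 ≠ 0 := (ENNReal.div_pos hε.ne' (by simp)).ne'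
  obtain ⟨ψ, hψ, hψ_memLp⟩ :=
    (memLp_one_iff_integrable.2 hg).exists_boundedContinuous_eLpNorm_sub_le ENNReal.one_ne_top hε3
  have close_of_comp := ENNReal.tendsto_nhds_zero.1
    (tendsto_eLpNorm_boundedContinuous_comp_sub (μ := μ) (fun s => (hT s).measurable) hc ψ t)
  filter_upwards [close_of_comp (ε / 3) (pos_iff_ne_zero.2 hε3)] with s hs
  have aesm_error : AEStronglyMeasurable (g - ⇑ψ) μ :=
    hg.aestronglyMeasurable.sub hψ_memLp.aestronglyMeasurable
  have aesm_error_comp (s) := aesm_error.comp_measurePreserving (hT s)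
  have error_comp (s) : eLpNorm ((g - ⇑ψ) ∘ T s) 1 μ ≤ ε / 3 := by
    rwa [eLpNorm_comp_measurePreserving aesm_error (hT s)]
  have aesm_comp (s) : AEStronglyMeasurable (fun x => ψ (T s x)) μ :=
    hψ_memLp.aestronglyMeasurable.comp_measurePreserving (hT s)
  calc eLpNorm (fun x => g (T s x) - g (T t x)) 1 μ
      = eLpNorm (((g - ⇑ψ) ∘ T s - (g - ⇑ψ) ∘ T t) + fun x => ψ (T s x) - ψ (T t x)) 1 μ := by
        congr 1
        funext x
        simp only [Pi.add_apply, Pi.sub_apply, Function.comp_apply]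
        ring
    _ ≤ eLpNorm ((g - ⇑ψ) ∘ T s - (g - ⇑ψ) ∘ T t) 1 μ +
          eLpNorm (fun x => ψ (T s x) - ψ (T t x)) 1 μ :=
        eLpNorm_add_le ((aesm_error_comp s).sub (aesm_error_comp t))
          ((aesm_comp s).sub (aesm_comp t)) le_rfl
    _ ≤ (ε / 3 + ε / 3) + ε / 3 :=
        add_le_add ((eLpNorm_sub_le (aesm_error_comp s) (aesm_error_comp t) le_rfl).trans
          (add_le_add (error_comp s) (error_comp t))) hs
    _ = ε := ENNReal.add_thirds ε

end KoopmanContinuous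

lemma koopmanContinuous_shearEquiv_symm (i : Fin 2) (L : ℕ) {c : ℝ → ℝ} (hc : Continuous c) :
    KoopmanContinuous volume fun t => (shearEquiv i L (c t)).symm :=
  koopmanContinuous_of_continuous (fun t => measurePreserving_shearFlow i L (-c t))
    fun x => (continuous_shearFlow_time i L x).comp hc.neg

/-! ### The starting times -/

/-- The length `2^{-2k}` of the time slots of level `k`. -/
def slotLen (k : ℕ) : ℝ := ((2 : ℝ) ^ (2 * k))⁻¹

lemma slotLen_eq (k : ℕ) : slotLen k = (1 / 4) ^ k := by
  rw [slotLen, pow_mul, ← inv_pow]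
  norm_num

lemma slotLen_pos (k : ℕ) : 0 < slotLen k := by unfold slotLen; positivity

lemma slotLen_zero : slotLen 0 = 1 := by simp [slotLen]

lemma slotLen_succ (k : ℕ) : slotLen (k + 1) = slotLen k / 4 := by
  rw [slotLen_eq, slotLen_eq, pow_succ]
  ring

lemma two_pow_mul_slotLen (k : ℕ) : 2 ^ k * slotLen k = (1 / 2) ^ k := by
  rw [slotLen_eq, ← mul_pow]
  norm_num

/-- The position `m / 2 ^ k` of the index `(k, m)`, the primary key of the order `<_time`. -/
def dyadicPos (p : ℕ × ℕ) : ℝ := (p.2 : ℝ) / 2 ^ p.1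

lemma timeLT_iff {p q : ℕ × ℕ} :
    timeLT p q ↔ dyadicPos p < dyadicPos q ∨ (dyadicPos p = dyadicPos q ∧ p.1 < q.1) := Iff.rfl

lemma dyadicPos_nonneg (p : ℕ × ℕ) : 0 ≤ dyadicPos p := by unfold dyadicPos; positivity

lemma dyadicPos_lt_one {p : ℕ × ℕ} (hp : p ∈ dyadic) : dyadicPos p < 1 := by
  rw [dyadicPos, div_lt_one (by positivity)]
  exact_mod_cast hp.2

lemma exists_dyadicPos_eq_div {p : ℕ × ℕ} {k : ℕ} (hp : p.1 ≤ k) :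
    ∃ n : ℕ, dyadicPos p = n / 2 ^ k := by
  refine ⟨p.2 * 2 ^ (k - p.1), ?_⟩
  rw [dyadicPos, ← Nat.sub_add_cancel hp, pow_add, Nat.add_sub_cancel]
  push_cast
  field_simp

lemma div_two_pow_lt_iff {k : ℕ} {a b : ℝ} : a / 2 ^ k < b / 2 ^ k ↔ a < b :=
  div_lt_div_iff_of_pos_right (by positivity)

lemma div_two_pow_succ (a : ℝ) (k : ℕ) : a / 2 ^ k = 2 * a / 2 ^ (k + 1) := by
  rw [pow_succ']
  field_simp

lemma dyadicPos_succ_two_mul (k m : ℕ) : dyadicPos (k + 1, 2 * m) = dyadicPos (k, m) := by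
  simp only [dyadicPos, div_two_pow_succ (m : ℝ) k]
  push_cast
  ring

lemma dyadicPos_eq_iff {k m n : ℕ} : dyadicPos (k, m) = dyadicPos (k, n) ↔ m = n := by
  simp only [dyadicPos]
  rw [div_left_inj' (by positivity), Nat.cast_inj]

lemma dyadicPos_lt_add_one_iff {p : ℕ × ℕ} {k m : ℕ} (hp : p.1 ≤ k) :
    dyadicPos p < (m + 1) / 2 ^ k ↔ dyadicPos p ≤ m / 2 ^ k := by
  obtain ⟨n, hn⟩ := exists_dyadicPos_eq_div hp
  rw [hn, div_two_pow_lt_iff, div_le_div_iff_of_pos_right (by positivity)]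
  norm_cast
  exact Nat.lt_succ_iff

/-- The indices of level at least `k` whose position lies in `[m 2^{-k}, (m + 1) 2^{-k})`. -/
def cone (k m : ℕ) : Set (ℕ × ℕ) :=
  {p | k ≤ p.1 ∧ (m : ℝ) / 2 ^ k ≤ dyadicPos p ∧ dyadicPos p < (m + 1) / 2 ^ k}

lemma cone_eq_range (k m : ℕ) :
    cone k m = range fun e : Σ d, Fin (2 ^ d) => (k + e.1, m * 2 ^ e.1 + e.2) := by
  ext ⟨l, n⟩
  have hpos (d : ℕ) : ((k + d, n) ∈ cone k m) ↔ m * 2 ^ d ≤ n ∧ n < (m + 1) * 2 ^ d := by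
    simp only [cone, dyadicPos, mem_ofPred_eq, pow_add, ← div_div, div_right_comm _ (2 ^ k : ℝ)]
    rw [div_le_div_iff_of_pos_right (by positivity), div_lt_div_iff_of_pos_right (by positivity),
      le_div_iff₀ (by positivity), div_lt_iff₀ (by positivity)]
    norm_cast
    simp
  constructor
  · intro h
    obtain ⟨d, rfl⟩ := Nat.exists_eq_add_of_le h.1
    obtain ⟨hle, hlt⟩ := (hpos d).1 h
    exact ⟨⟨d, n - m * 2 ^ d, by rw [add_one_mul] at hlt; omega⟩, by simp only; congr; omega⟩
  · rintro ⟨⟨d, j⟩, he⟩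
    obtain ⟨rfl, rfl⟩ := Prod.mk.inj he
    exact (hpos d).2 ⟨Nat.le_add_right _ _, by rw [add_one_mul]; exact add_lt_add_right j.2 _⟩

lemma hasSum_cone (k m : ℕ) : HasSum (fun p : cone k m => slotLen p.1.1) (2 * slotLen k) := by
  have hinj : (fun e : Σ d, Fin (2 ^ d) => (k + e.1, m * 2 ^ e.1 + (e.2 : ℕ))).Injective := by
    rintro ⟨d, j⟩ ⟨d', j'⟩ he
    obtain ⟨hd, hj⟩ := Prod.mk.inj he
    obtain rfl : d = d' := by simpa using hd
    obtain rfl : j = j' := by ext; simpa using hj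
    rfl
  have hfiber (d : ℕ) :
      HasSum (fun _ : Fin (2 ^ d) => slotLen (k + d)) (slotLen k * (1 / 2) ^ d) := by
    convert hasSum_fintype fun _ : Fin (2 ^ d) => slotLen (k + d) using 1
    rw [Finset.sum_const, Finset.card_fin, nsmul_eq_mul, ← two_pow_mul_slotLen, slotLen_eq,
      slotLen_eq, slotLen_eq, pow_add]
    push_cast
    ring
  have hlevels : HasSum (fun d => slotLen k * (1 / 2 : ℝ) ^ d) (2 * slotLen k) :=
    mul_comm 2 (slotLen k) ▸ hasSum_geometric_two.mul_left (slotLen k)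
  have hsum : Summable fun e : Σ d, Fin (2 ^ d) => slotLen (k + e.1) := by
    refine (summable_sigma_of_nonneg fun e => (slotLen_pos _).le).2
      ⟨fun d => (hfiber d).summable, ?_⟩
    simpa only [(hfiber _).tsum_eq] using hlevels.summable
  rw [cone_eq_range]
  exact (hinj.hasSum_range_iff (f := fun p : ℕ × ℕ => slotLen p.1)).2
    (hlevels.sigma_of_hasSum hfiber hsum)

/-- The total length of the slots of `𝒟` with index in `S`. -/
def weight (S : Set (ℕ × ℕ)) : ℝ := ∑' p : ↥(dyadic ∩ S), slotLen p.1.1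

lemma startTime_eq_weight (q : ℕ × ℕ) : startTime q = weight {p | timeLT p q} := rfl

lemma summable_slotLen (S : Set (ℕ × ℕ)) : Summable fun p : ↥(dyadic ∩ S) => slotLen p.1.1 := by
  have hsub : dyadic ∩ S ⊆ cone 0 0 := fun p hp =>
    ⟨Nat.zero_le _, by simpa using dyadicPos_nonneg p, by simpa using dyadicPos_lt_one hp.1⟩
  exact (hasSum_cone 0 0).summable.comp_injective (i := inclusion hsub) (inclusion_injective hsub)

lemma weight_mono {S T : Set (ℕ × ℕ)} (h : dyadic ∩ S ⊆ T) : weight S ≤ weight T := by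
  have hsub : dyadic ∩ S ⊆ dyadic ∩ T := subset_inter inter_subset_left h
  exact (summable_slotLen S).tsum_le_tsum_of_inj (inclusion hsub) (inclusion_injective hsub)
    (fun p _ => (slotLen_pos _).le) (fun _ => le_rfl) (summable_slotLen T)

lemma weight_union {S T : Set (ℕ × ℕ)} (h : Disjoint S T) :
    weight (S ∪ T) = weight S + weight T := by
  rw [weight, inter_union_distrib_left]
  exact (summable_slotLen S).tsum_union_disjoint (f := fun p : ℕ × ℕ => slotLen p.1)
    (h.mono inter_subset_right inter_subset_right) (summable_slotLen T)

lemma weight_singleton {p : ℕ × ℕ} (hp : p ∈ dyadic) : weight {p} = slotLen p.1 := by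
  rw [weight, inter_eq_right.2 (singleton_subset_iff.2 hp)]
  exact tsum_singleton p fun p : ℕ × ℕ => slotLen p.1

lemma weight_insert {p : ℕ × ℕ} (hp : p ∈ dyadic) {S : Set (ℕ × ℕ)} (hpS : p ∉ S) :
    weight (insert p S) = weight S + slotLen p.1 := by
  rw [← union_singleton, weight_union (disjoint_singleton_right.2 hpS), weight_singleton hp]

lemma weight_cone {k m : ℕ} (hk : (k, m) ∈ dyadic) : weight (cone k m) = 2 * slotLen k := by
  have hsub : cone k m ⊆ dyadic := by
    rintro p ⟨hkp, -, hlt⟩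
    refine ⟨hk.1.trans hkp, ?_⟩
    have hle : ((m : ℝ) + 1) / 2 ^ k ≤ 1 := by
      rw [div_le_one (by positivity)]
      exact_mod_cast hk.2
    have hp := hlt.trans_le hle
    rw [dyadicPos, div_lt_one (by positivity)] at hp
    exact_mod_cast hp
  rw [weight, inter_eq_right.2 hsub, (hasSum_cone k m).tsum_eq]

lemma timeLT_irrefl (p : ℕ × ℕ) : ¬ timeLT p p := by simp [timeLT]

lemma timeLT_trans {p q r : ℕ × ℕ} (hpq : timeLT p q) (hqr : timeLT q r) : timeLT p r := by
  rw [timeLT_iff] at *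
  grind

lemma timeLT_trichotomy (p q : ℕ × ℕ) : timeLT p q ∨ p = q ∨ timeLT q p := by
  obtain ⟨k, m⟩ := p
  obtain ⟨l, n⟩ := q
  rcases lt_trichotomy (dyadicPos (k, m)) (dyadicPos (l, n)) with h | h | h
  · exact Or.inl (Or.inl h)
  · rcases lt_trichotomy k l with hkl | rfl | hkl
    · exact Or.inl (Or.inr ⟨h, hkl⟩)
    · exact Or.inr (Or.inl (by rw [dyadicPos_eq_iff.1 h]))
    · exact Or.inr (Or.inr (Or.inr ⟨h.symm, hkl⟩))
  · exact Or.inr (Or.inr (Or.inl h))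

lemma startTime_add_le_of_timeLT {p q : ℕ × ℕ} (hp : p ∈ dyadic) (hpq : timeLT p q) :
    startTime p + slotLen p.1 ≤ startTime q := by
  rw [startTime_eq_weight, startTime_eq_weight, ← weight_insert hp (timeLT_irrefl p)]
  refine weight_mono (inter_subset_right.trans (insert_subset hpq fun r hr => ?_))
  exact timeLT_trans hr hpq

lemma slots_disjoint {p q : ℕ × ℕ} (hp : p ∈ dyadic) (hq : q ∈ dyadic) (hpq : p ≠ q) :
    startTime p + slotLen p.1 ≤ startTime q ∨ startTime q + slotLen q.1 ≤ startTime p := by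
  rcases timeLT_trichotomy p q with h | h | h
  · exact Or.inl (startTime_add_le_of_timeLT hp h)
  · exact absurd h hpq
  · exact Or.inr (startTime_add_le_of_timeLT hq h)

lemma startTime_one_zero : startTime (1, 0) = 0 := by
  have hempty : dyadic ∩ {p | timeLT p (1, 0)} = ∅ := by
    refine eq_empty_of_forall_notMem ?_
    rintro p ⟨hp, h | ⟨-, h⟩⟩
    · rw [Nat.cast_zero, zero_div] at h
      exact absurd h (not_lt.2 (dyadicPos_nonneg p))
    · exact absurd hp.1 (not_le.2 h)
  rw [startTime_eq_weight, weight, hempty, tsum_empty]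

lemma startTime_left {k m : ℕ} (hq : (k, m) ∈ dyadic) :
    startTime (k + 1, 2 * m) = startTime (k, m) + slotLen k := by
  rw [startTime_eq_weight, startTime_eq_weight, ← weight_insert hq (timeLT_irrefl _)]
  congr 1
  ext ⟨l, n⟩
  simp only [mem_insert_iff, mem_ofPred_eq, timeLT_iff, dyadicPos_succ_two_mul, Nat.lt_succ_iff,
    le_iff_eq_or_lt (a := l)]
  have hlevel : (dyadicPos (l, n) = dyadicPos (k, m) ∧ l = k) ↔ (l, n) = (k, m) := by
    constructor
    · rintro ⟨h, rfl⟩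
      rw [dyadicPos_eq_iff.1 h]
    · rintro h
      exact ⟨by rw [h], congrArg Prod.fst h⟩
  rw [and_or_left, hlevel]
  tauto

lemma weight_dyadicPos_lt {k m : ℕ} (hk : (k, m) ∈ dyadic) :
    weight {p | dyadicPos p < (m + 1) / 2 ^ k} = startTime (k, m) + 2 * slotLen k := by
  have hdisj : Disjoint {p | timeLT p (k, m)} (cone k m) := by
    refine disjoint_left.2 fun p hp hpc => ?_
    rcases timeLT_iff.1 hp with h | ⟨-, h⟩
    · exact absurd h (not_lt.2 hpc.2.1)
    · exact absurd h (not_lt.2 hpc.1)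
  rw [startTime_eq_weight, ← weight_cone hk, ← weight_union hdisj]
  congr 1
  ext p
  have hlt : dyadicPos (k, m) < (m + 1) / 2 ^ k := div_two_pow_lt_iff.2 (lt_add_one (m : ℝ))
  rcases lt_or_ge p.1 k with hpk | hpk
  · simp only [mem_union, cone, mem_ofPred_eq, timeLT_iff, hpk, hpk.not_ge, and_true, false_and,
      or_false, ← le_iff_lt_or_eq]
    exact dyadicPos_lt_add_one_iff hpk.le
  · simp only [mem_union, cone, mem_ofPred_eq, timeLT_iff, hpk, hpk.not_gt, and_false, true_and,
      or_false]
    exact ⟨fun h => (lt_or_ge _ _).imp_right fun h' => ⟨h', h⟩,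
      fun h => h.elim (fun h => h.trans hlt) And.right⟩

/-- The start of the `m`-th block of level `k`, which consists of the slots of `(k + 1, 2m)`,
`(k + 1, 2m + 1)` and all their descendants, and has length `2^{-2k}`. -/
def blockStart (k m : ℕ) : ℝ := startTime (k + 1, 2 * m)

lemma mem_dyadic_left {k m : ℕ} (hm : m < 2 ^ k) : (k + 1, 2 * m) ∈ dyadic :=
  ⟨Nat.le_add_left _ _, by simp only [pow_succ]; omega⟩

lemma mem_dyadic_right {k m : ℕ} (hm : m < 2 ^ k) : (k + 1, 2 * m + 1) ∈ dyadic :=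
  ⟨Nat.le_add_left _ _, by simp only [pow_succ]; omega⟩

lemma blockStart_zero : blockStart 0 0 = 0 := startTime_one_zero

lemma startTime_right_eq {k m : ℕ} (hm : m < 2 ^ k) :
    startTime (k + 1, 2 * m + 1) = blockStart k m + 2 * slotLen (k + 1) := by
  rw [blockStart, ← weight_dyadicPos_lt (mem_dyadic_left hm), startTime_eq_weight]
  congr 1
  ext p
  simp only [mem_ofPred_eq, timeLT_iff]
  have hodd (hp : p.1 < k + 1) : dyadicPos p ≠ dyadicPos (k + 1, 2 * m + 1) := by
    obtain ⟨n, hn⟩ := exists_dyadicPos_eq_div (Nat.lt_succ_iff.1 hp)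
    rw [hn, show (n : ℝ) / 2 ^ k = dyadicPos (k, n) from rfl, ← dyadicPos_succ_two_mul, Ne,
      dyadicPos_eq_iff]
    omega
  have hpos : dyadicPos (k + 1, 2 * m + 1) = ((2 * m : ℕ) + 1) / 2 ^ (k + 1) := by
    simp [dyadicPos]
  rw [← hpos]
  tauto

lemma blockStart_left {k m : ℕ} (hm : m < 2 ^ k) :
    blockStart (k + 1) (2 * m) = blockStart k m + slotLen (k + 1) :=
  startTime_left (mem_dyadic_left hm)

lemma blockStart_right {k m : ℕ} (hm : m < 2 ^ k) :
    blockStart (k + 1) (2 * m + 1) = blockStart k m + 3 * slotLen (k + 1) := by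
  rw [blockStart, startTime_left (mem_dyadic_right hm), startTime_right_eq hm]
  ring

lemma weight_dyadicPos_lt_eq_blockStart_add {k m : ℕ} (hm : m < 2 ^ k) :
    weight {p | dyadicPos p < (m + 1) / 2 ^ k} = blockStart k m + slotLen k := by
  have hend : ((m : ℝ) + 1) / 2 ^ k = ((2 * m + 1 : ℕ) + 1) / 2 ^ (k + 1) := by
    rw [div_two_pow_succ]
    push_cast
    ring
  rw [hend, weight_dyadicPos_lt (mem_dyadic_right hm), startTime_right_eq hm, slotLen_succ]
  ring

lemma blockStart_add_le_one {k m : ℕ} (hm : m < 2 ^ k) : blockStart k m + slotLen k ≤ 1 := by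
  have htotal := weight_dyadicPos_lt_eq_blockStart_add (k := 0) (m := 0) (by simp)
  rw [blockStart_zero, slotLen_zero, zero_add] at htotal
  rw [← weight_dyadicPos_lt_eq_blockStart_add hm, ← htotal]
  exact weight_mono fun p hp => by simpa using dyadicPos_lt_one hp.1

lemma slot_block_disjoint {k m : ℕ} (hm : m < 2 ^ k) {p : ℕ × ℕ} (hp : p ∈ dyadic)
    (hpk : p.1 ≤ k) :
    startTime p + slotLen p.1 ≤ blockStart k m ∨ blockStart k m + slotLen k ≤ startTime p := by
  rcases le_or_gt (dyadicPos p) (m / 2 ^ k) with hle | hlt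
  · refine Or.inl (startTime_add_le_of_timeLT hp ?_)
    rw [timeLT_iff, dyadicPos_succ_two_mul]
    exact hle.lt_or_eq.imp_right fun h => ⟨h, Nat.lt_succ_iff.2 hpk⟩
  · have hge := not_lt.1 fun h => hlt.not_ge ((dyadicPos_lt_add_one_iff hpk).1 h)
    rw [← weight_dyadicPos_lt_eq_blockStart_add hm]
    exact Or.inr (weight_mono fun q hq => Or.inl (hq.2.trans_le hge))

/-! ### The fields at a given time -/

section Field

variable {i : ℕ → Fin 2} {L : ℕ → ℕ} {τ : ℕ → ℝ} {S : Set (ℕ × ℕ)} {p q : ℕ × ℕ} {t : ℝ}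

lemma eq_of_mem_slots (hfin : FinitenessCondition τ) (hp : p ∈ dyadic) (hq : q ∈ dyadic)
    (htp : t ∈ Ico (startTime p) (startTime p + slotLen p.1))
    (htq : t ∈ Icc (startTime q) (startTime q + τ q.1)) : q = p := by
  by_contra hne
  have hτ : τ q.1 < slotLen q.1 := hfin q.1 hq.1
  rcases slots_disjoint hq hp hne with h | h
  · linarith [htp.1, htq.2]
  · linarith [htp.2, htq.1]

lemma mem_Ico_slot (hfin : FinitenessCondition τ) (hp : p ∈ dyadic)
    (ht : t ∈ Icc (startTime p) (startTime p + τ p.1)) :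
    t ∈ Ico (startTime p) (startTime p + slotLen p.1) :=
  ⟨ht.1, ht.2.trans_lt (add_lt_add_right (hfin p.1 hp.1) _)⟩

lemma fractalField_of_mem (hfin : FinitenessCondition τ) (hS : S ⊆ dyadic) (hp : p ∈ S)
    (ht : t ∈ Icc (startTime p) (startTime p + τ p.1)) :
    fractalField i L τ S t = shearField (i p.1) (L p.1) := by
  have hex : ∃ p ∈ S, t ∈ Icc (startTime p) (startTime p + τ p.1) := ⟨p, hp, ht⟩
  have hchoose : hex.choose = p := eq_of_mem_slots hfin (hS hp) (hS hex.choose_spec.1)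
    (mem_Ico_slot hfin (hS hp) ht) hex.choose_spec.2
  funext x
  rw [fractalField, dif_pos hex, hchoose]

lemma fractalField_of_forall_notMem
    (h : ∀ p ∈ S, t ∉ Icc (startTime p) (startTime p + τ p.1)) :
    fractalField i L τ S t = 0 := by
  funext x
  rw [fractalField, dif_neg fun ⟨p, hp, ht⟩ => h p hp ht, Pi.zero_apply]

lemma fractalField_of_mem_gap (hfin : FinitenessCondition τ) (hS : S ⊆ dyadic)
    (hp : p ∈ dyadic) (hτ : startTime p + τ p.1 < t)
    (ht : t ∈ Ico (startTime p) (startTime p + slotLen p.1)) :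
    fractalField i L τ S t = 0 := by
  refine fractalField_of_forall_notMem fun q hq htq => ?_
  obtain rfl := eq_of_mem_slots hfin hp (hS hq) ht htq
  exact hτ.not_ge htq.2

lemma dyadicUpTo_subset (K : ℕ) : dyadicUpTo K ⊆ dyadic := fun _ h => h.1

lemma truncatedField_of_mem_block (hfin : FinitenessCondition τ) {K m : ℕ} (hm : m < 2 ^ K)
    (ht : t ∈ Ioo (blockStart K m) (blockStart K m + slotLen K)) :
    truncatedField i L τ K t = 0 := by
  refine fractalField_of_forall_notMem fun p hp htp => ?_
  have hτ : τ p.1 < slotLen p.1 := hfin p.1 hp.1.1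
  rcases slot_block_disjoint hm hp.1 hp.2 with h | h
  · linarith [ht.1, htp.2]
  · linarith [ht.2, htp.1]

lemma eventually_truncatedField_eq (hfin : FinitenessCondition τ) (t : ℝ) :
    ∀ᶠ K in atTop, truncatedField i L τ K t = limitField i L τ t := by
  by_cases h : ∃ p ∈ dyadic, t ∈ Icc (startTime p) (startTime p + τ p.1)
  · obtain ⟨p, hp, ht⟩ := h
    filter_upwards [eventually_ge_atTop p.1] with K hK
    rw [truncatedField, limitField, fractalField_of_mem hfin (dyadicUpTo_subset K) ⟨hp, hK⟩ ht,
      fractalField_of_mem hfin subset_rfl hp ht]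
  · push Not at h
    refine Eventually.of_forall fun K => ?_
    rw [truncatedField, limitField, fractalField_of_forall_notMem h,
      fractalField_of_forall_notMem fun p hp => h p hp.1]

lemma measurable_shearField (i : Fin 2) (L : ℕ) : Measurable (shearField i L) := by
  refine measurable_pi_lambda _ fun j => ?_
  have hsign : Measurable fun x : T2 => shearSign L (x (1 - i)) :=
    (measurable_shearSign L).comp (measurable_pi_apply (1 - i))
  unfold shearField
  rcases eq_or_ne j i with rfl | hj
  · simpa only [Pi.single_eq_same] using hsign
  · simp only [Pi.single_eq_of_ne hj, measurable_const]

lemma norm_shearField_le (i : Fin 2) (L : ℕ) (x : T2) : ‖shearField i L x‖ ≤ 1 := by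
  rw [shearField, Pi.norm_single]
  rcases shearSign_eq_one_or_neg_one L (x (1 - i)) with h | h <;> simp [h]

lemma norm_fractalField_le (S : Set (ℕ × ℕ)) (t : ℝ) (x : T2) :
    ‖fractalField i L τ S t x‖ ≤ 1 := by
  unfold fractalField
  split_ifs
  · exact norm_shearField_le _ _ _
  · simp

lemma measurable_of_eqOn_iUnion {α β ι : Type*} [MeasurableSpace α] [MeasurableSpace β]
    [Countable ι] {f : α → β} {A : ι → Set α} {g : ι → α → β} (hA : ∀ j, MeasurableSet (A j))
    (hg : ∀ j, Measurable (g j)) (hcover : ⋃ j, A j = univ) (hfg : ∀ j, EqOn f (g j) (A j)) :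
    Measurable f := by
  intro B hB
  have hpre : f ⁻¹' B = ⋃ j, A j ∩ g j ⁻¹' B := by
    rw [← inter_univ (f ⁻¹' B), ← hcover, inter_iUnion]
    refine iUnion_congr fun j => ?_
    rw [inter_comm, (hfg j).inter_preimage_eq]
  rw [hpre]
  exact MeasurableSet.iUnion fun j => (hA j).inter (hg j hB)

lemma measurable_fractalField (hfin : FinitenessCondition τ) (hS : S ⊆ dyadic) :
    Measurable fun p : ℝ × T2 => fractalField i L τ S p.1 p.2 := by
  set A : Option S → Set (ℝ × T2) := fun o => o.elim
    {p | ∀ q : S, p.1 ∉ Icc (startTime q.1) (startTime q.1 + τ q.1.1)}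
    fun q => {p | p.1 ∈ Icc (startTime q.1) (startTime q.1 + τ q.1.1)} with hA
  have hslot (q : S) : MeasurableSet (A (some q)) := measurable_fst measurableSet_Icc
  refine measurable_of_eqOn_iUnion (A := A)
    (g := fun o p => o.elim 0 fun q => shearField (i q.1.1) (L q.1.1) p.2) ?_ ?_ ?_ ?_
  · rintro (_ | q)
    · have hnone : A none = ⋂ q, (A (some q))ᶜ := by ext; simp [hA]
      exact hnone ▸ MeasurableSet.iInter fun q => (hslot q).compl
    · exact hslot q
  · rintro (_ | q)
    · exact measurable_const
    · exact (measurable_shearField _ _).comp measurable_snd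
  · refine eq_univ_of_forall fun p => mem_iUnion.2 ?_
    by_cases h : ∃ q : S, p.1 ∈ Icc (startTime q.1) (startTime q.1 + τ q.1.1)
    · exact ⟨some h.choose, h.choose_spec⟩
    · exact ⟨none, not_exists.1 h⟩
  · rintro (_ | q) p hp
    · exact congrFun (fractalField_of_forall_notMem fun q hq => hp ⟨q, hq⟩) p.2
    · exact congrFun (fractalField_of_mem hfin hS q.2 hp) p.2

end Field

/-! ### Flows on a time interval -/

lemma toT2_surjective : Function.Surjective toT2 := by
  intro x
  choose r hr using fun j => QuotientAddGroup.mk_surjective (x j)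
  exact ⟨r, funext hr⟩

lemma toT2_add (x y : Fin 2 → ℝ) : toT2 (x + y) = toT2 x + toT2 y := rfl

lemma toT2_single (j : Fin 2) (c : ℝ) : toT2 (Pi.single j c) = Pi.single j (c : UnitAddCircle) :=
  funext fun l => Pi.apply_single (fun _ (r : ℝ) => (r : UnitAddCircle)) (fun _ => rfl) j c l

lemma hasDerivAt_single {n : ℕ} {c : ℝ → ℝ} {c' t : ℝ} (j : Fin n) (hc : HasDerivAt c c' t) :
    HasDerivAt (fun s => (Pi.single j (c s) : Fin n → ℝ)) (Pi.single j c') t :=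
  (ContinuousLinearMap.single ℝ (fun _ : Fin n => ℝ) j).hasFDerivAt.comp_hasDerivAt t hc

/-- `γ` is the lift to `ℝ²` of a curve that is at rest before time `a` and after time `b`, and
follows the field `u` in between, except at countably many times. -/
structure IsCurveAlong (u : ℝ → T2 → (Fin 2 → ℝ)) (a b : ℝ) (γ : ℝ → (Fin 2 → ℝ)) : Prop where
  eq_left : ∀ t ≤ a, γ t = γ a
  eq_right : ∀ t, b ≤ t → γ t = γ b
  lipschitz : LipschitzWith 1 γ
  hasDerivAt : ∃ C : Set ℝ, C.Countable ∧ ∀ t ∈ Ioo a b \ C, HasDerivAt γ (u t (toT2 (γ t))) t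

/-- A family of bijections of the torus whose orbits are curves along `u` between the times `a`
and `b`, starting at the identity. -/
def FlowOn (u : ℝ → T2 → (Fin 2 → ℝ)) (a b : ℝ) (A : ℝ → T2 ≃ᵐ T2) : Prop :=
  ∀ x : Fin 2 → ℝ, ∃ γ, IsCurveAlong u a b γ ∧ γ a = x ∧ ∀ t, toT2 (γ t) = A t (toT2 x)

section FlowOn

variable {u : ℝ → T2 → (Fin 2 → ℝ)} {a b c : ℝ}

lemma abs_min_sub_min_add_abs_max_sub_max (s t b : ℝ) :
    |min s b - min t b| + |max s b - max t b| = |s - t| := by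
  rcases le_total s b with hs | hs <;> rcases le_total t b with ht | ht
  · simp [hs, ht]
  · rw [min_eq_left hs, min_eq_right ht, max_eq_right hs, max_eq_left ht,
      abs_of_nonpos (by linarith), abs_of_nonpos (by linarith), abs_of_nonpos (by linarith)]
    ring
  · rw [min_eq_right hs, min_eq_left ht, max_eq_left hs, max_eq_right ht,
      abs_of_nonneg (by linarith), abs_of_nonneg (by linarith), abs_of_nonneg (by linarith)]
    ring
  · simp [hs, ht]

namespace IsCurveAlong

variable {γ η : ℝ → (Fin 2 → ℝ)}

lemma concat_of_le (hη : IsCurveAlong u b c η) (h : γ b = η b) {t : ℝ} (ht : t ≤ b) :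
    γ t + η t - γ b = γ t := by
  rw [hη.eq_left t ht, h, add_sub_cancel_right]

lemma concat_of_ge (hγ : IsCurveAlong u a b γ) {t : ℝ} (ht : b ≤ t) :
    γ t + η t - γ b = η t := by
  rw [hγ.eq_right t ht, add_sub_cancel_left]

lemma norm_sub_le (hγ : IsCurveAlong u a b γ) (s t : ℝ) : ‖γ s - γ t‖ ≤ |s - t| := by
  simpa only [dist_eq_norm, Real.norm_eq_abs, NNReal.coe_one, one_mul]
    using hγ.lipschitz.dist_le_mul s t

/-- Two curves along `u` on consecutive intervals are concatenated by adding them up, since each of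
them is at rest while the other one moves. -/
lemma concat (hγ : IsCurveAlong u a b γ) (hη : IsCurveAlong u b c η) (h : γ b = η b)
    (hab : a ≤ b) (hbc : b ≤ c) : IsCurveAlong u a c fun t => γ t + η t - γ b := by
  obtain ⟨C, hC, hγ'⟩ := hγ.hasDerivAt
  obtain ⟨D, hD, hη'⟩ := hη.hasDerivAt
  refine ⟨fun t ht => ?_, fun t ht => ?_, LipschitzWith.of_dist_le_mul fun s t => ?_, C ∪ D ∪ {b},
    (hC.union hD).union (countable_singleton b), ?_⟩
  · rw [hη.concat_of_le h hab, hη.concat_of_le h (ht.trans hab), hγ.eq_left t ht]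
  · rw [hγ.concat_of_ge hbc, hγ.concat_of_ge (hbc.trans ht), hη.eq_right t ht]
  · have eq_min (s : ℝ) : γ s = γ (min s b) := by
      rcases le_total s b with hs | hs
      · rw [min_eq_left hs]
      · rw [min_eq_right hs, hγ.eq_right s hs]
    have eq_max (s : ℝ) : η s = η (max s b) := by
      rcases le_total s b with hs | hs
      · rw [max_eq_right hs, hη.eq_left s hs]
      · rw [max_eq_left hs]
    rw [NNReal.coe_one, one_mul, dist_sub_right, Real.dist_eq,
      ← abs_min_sub_min_add_abs_max_sub_max s t b, eq_min s, eq_min t, eq_max s, eq_max t]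
    refine (dist_add_add_le _ _ _ _).trans ?_
    rw [dist_eq_norm, dist_eq_norm]
    exact add_le_add (hγ.norm_sub_le _ _) (hη.norm_sub_le _ _)
  · rintro t ⟨ht, hnot⟩
    simp only [mem_union, mem_singleton_iff, not_or] at hnot
    rcases lt_or_gt_of_ne hnot.2 with htb | htb
    · rw [hη.concat_of_le h htb.le]
      refine (hγ' t ⟨⟨ht.1, htb⟩, hnot.1.1⟩).congr_of_eventuallyEq ?_
      filter_upwards [Iio_mem_nhds htb] with s hs using hη.concat_of_le h (le_of_lt hs)
    · rw [hγ.concat_of_ge htb.le]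
      refine (hη' t ⟨⟨htb, ht.2⟩, hnot.1.2⟩).congr_of_eventuallyEq ?_
      filter_upwards [Ioi_mem_nhds htb] with s hs using hγ.concat_of_ge (le_of_lt hs)

end IsCurveAlong

lemma FlowOn.apply_of_le {A : ℝ → T2 ≃ᵐ T2} (hA : FlowOn u a b A) {t : ℝ} (ht : t ≤ a) (x : T2) :
    A t x = x := by
  obtain ⟨z, rfl⟩ := toT2_surjective x
  obtain ⟨γ, hγ, hγa, hγA⟩ := hA z
  rw [← hγA, hγ.eq_left t ht, hγa]

lemma FlowOn.trans {A B : ℝ → T2 ≃ᵐ T2} (hA : FlowOn u a b A) (hB : FlowOn u b c B)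
    (hab : a ≤ b) (hbc : b ≤ c) : FlowOn u a c fun t => (A t).trans (B t) := by
  intro x
  obtain ⟨γ, hγ, hγa, hγA⟩ := hA x
  obtain ⟨η, hη, hηb, hηB⟩ := hB (γ b)
  refine ⟨_, hγ.concat hη hηb.symm hab hbc, ?_, fun t => ?_⟩
  · rw [hη.concat_of_le hηb.symm hab, hγa]
  · rw [MeasurableEquiv.trans_apply, ← hγA]
    rcases le_total t b with ht | ht
    · rw [hη.concat_of_le hηb.symm ht, hB.apply_of_le ht]
    · rw [hγ.concat_of_ge ht, hγ.eq_right t ht, hηB]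

lemma flowOn_refl (hu : ∀ t ∈ Ioo a b, u t = 0) :
    FlowOn u a b fun _ => MeasurableEquiv.refl T2 := by
  refine fun x => ⟨fun _ => x, ⟨fun _ _ => rfl, fun _ _ => rfl, LipschitzWith.const' x, ∅,
    countable_empty, fun t ht => ?_⟩, rfl, fun _ => rfl⟩
  rw [hu t ht.1]
  exact hasDerivAt_const t x

lemma shearField_shearFlow (i : Fin 2) (L : ℕ) (t : ℝ) (x : T2) :
    shearField i L (shearFlow i L t x) = shearField i L x := by
  rw [shearField, shearFlow_apply_one_sub, shearField]

lemma hasDerivAt_elapsed_of_mem {T t : ℝ} (ht : t ∈ Ioo a (a + T)) :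
    HasDerivAt (elapsed T a) 1 t := by
  refine ((hasDerivAt_id t).sub_const a).congr_of_eventuallyEq ?_
  filter_upwards [Ioo_mem_nhds ht.1 ht.2] with s hs using elapsed_of_mem ⟨hs.1.le, hs.2.le⟩

lemma hasDerivAt_elapsed_of_gt {T t : ℝ} (hT : 0 ≤ T) (ht : a + T < t) :
    HasDerivAt (elapsed T a) 0 t := by
  refine (hasDerivAt_const t T).congr_of_eventuallyEq ?_
  filter_upwards [Ioi_mem_nhds ht] with s hs using elapsed_of_ge hT (le_of_lt hs)

lemma flowOn_shearEquiv {T : ℝ} {i : Fin 2} {L : ℕ} (hT : 0 ≤ T) (hb : a + T ≤ b)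
    (hu : ∀ t ∈ Ioo a (a + T), u t = shearField i L) (hu0 : ∀ t ∈ Ioo (a + T) b, u t = 0) :
    FlowOn u a b fun t => shearEquiv i L (elapsed T a t) := by
  intro x
  set σ := shearSign L (toT2 x (1 - i)) with hσ
  have abs_σ : |σ| = 1 := by
    rcases shearSign_eq_one_or_neg_one L (toT2 x (1 - i)) with h | h <;> simp [hσ, h]
  have hflow (r : ℝ) : toT2 (x + Pi.single i (r * σ)) = shearFlow i L r (toT2 x) := by
    rw [toT2_add, toT2_single, shearFlow]
  have hderiv {t d : ℝ} (h : HasDerivAt (elapsed T a) d t) :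
      HasDerivAt (fun s => x + Pi.single i (elapsed T a s * σ)) (Pi.single i (d * σ)) t :=
    (hasDerivAt_single i (h.mul_const σ)).const_add x
  refine ⟨fun t => x + Pi.single i (elapsed T a t * σ), ⟨fun t ht => ?_, fun t ht => ?_,
    LipschitzWith.of_dist_le_mul fun s t => ?_, {a + T}, countable_singleton _, ?_⟩, ?_,
    fun t => hflow _⟩
  · simp only [elapsed_of_le ht, elapsed_of_le le_rfl]
  · simp only [elapsed_of_ge hT (hb.trans ht), elapsed_of_ge hT hb]
  · rw [dist_add_left, dist_eq_norm, ← Pi.single_sub, Pi.norm_single, ← sub_mul,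
      Real.norm_eq_abs, abs_mul, abs_σ, mul_one]
    exact (lipschitzWith_elapsed T a).dist_le_mul s t
  · rintro t ⟨ht, hne⟩
    rcases lt_or_gt_of_ne (show t ≠ a + T from hne) with h | h
    · rw [hu t ⟨ht.1, h⟩, hflow, shearField_shearFlow, shearField, ← hσ]
      simpa only [one_mul] using hderiv (hasDerivAt_elapsed_of_mem ⟨ht.1, h⟩)
    · rw [hu0 t ⟨h, ht.2⟩, Pi.zero_apply]
      simpa only [zero_mul, Pi.single_zero] using hderiv (hasDerivAt_elapsed_of_gt hT h)
  · simp only [elapsed_of_le le_rfl, zero_mul, Pi.single_zero, add_zero]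

end FlowOn

/-! ### The flow of the truncated field -/

/-- A family of measure preserving bijections of the torus with the joint measurability, and the
continuity in time, that are needed to transport functions. -/
structure IsRegularFlow (A : ℝ → T2 ≃ᵐ T2) : Prop where
  measurePreserving : ∀ t, MeasurePreserving (A t) volume volume
  measurable : Measurable fun p : ℝ × T2 => A p.1 p.2
  measurable_symm : Measurable fun p : ℝ × T2 => (A p.1).symm p.2
  koopmanContinuous_symm : KoopmanContinuous volume fun t => (A t).symm

lemma isRegularFlow_refl : IsRegularFlow fun _ => MeasurableEquiv.refl T2 :=
  ⟨fun _ => MeasurePreserving.id _, measurable_snd, measurable_snd, koopmanContinuous_id⟩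

lemma IsRegularFlow.trans {A B : ℝ → T2 ≃ᵐ T2} (hA : IsRegularFlow A) (hB : IsRegularFlow B) :
    IsRegularFlow fun t => (A t).trans (B t) where
  measurePreserving t := (hB.measurePreserving t).comp (hA.measurePreserving t)
  measurable := hB.measurable.comp (measurable_fst.prodMk hA.measurable)
  measurable_symm := hA.measurable_symm.comp (measurable_fst.prodMk hB.measurable_symm)
  koopmanContinuous_symm := hA.koopmanContinuous_symm.comp hB.koopmanContinuous_symm
    (fun t => (hA.measurePreserving t).symm) fun t => (hB.measurePreserving t).symm

lemma isRegularFlow_shearEquiv (i : Fin 2) (L : ℕ) {c : ℝ → ℝ} (hc : Continuous c) :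
    IsRegularFlow fun t => shearEquiv i L (c t) where
  measurePreserving t := measurePreserving_shearEquiv i L (c t)
  measurable := (measurable_shearFlow_uncurry i L).comp
    ((hc.measurable.comp measurable_fst).prodMk measurable_snd)
  measurable_symm := (measurable_shearFlow_uncurry i L).comp
    ((hc.measurable.comp measurable_fst).neg.prodMk measurable_snd)
  koopmanContinuous_symm := koopmanContinuous_shearEquiv_symm i L hc

/-- The flow, at time `t`, of the first `n` levels of slots in a block of level `k` that starts at
time `a`: the block consists of a slot of level `k + 1`, a block of level `k + 1`, a second slot of
level `k + 1` and a second block of level `k + 1`. -/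
def blockFlow (i : ℕ → Fin 2) (L : ℕ → ℕ) (τ : ℕ → ℝ) : ℕ → ℕ → ℝ → ℝ → T2 ≃ᵐ T2
  | 0, _, _, _ => MeasurableEquiv.refl T2
  | n + 1, k, a, t =>
    (((shearEquiv (i (k + 1)) (L (k + 1)) (elapsed (τ (k + 1)) a t)).trans
      (blockFlow i L τ n (k + 1) (a + slotLen (k + 1)) t)).trans
      (shearEquiv (i (k + 1)) (L (k + 1)) (elapsed (τ (k + 1)) (a + 2 * slotLen (k + 1)) t))).trans
      (blockFlow i L τ n (k + 1) (a + 3 * slotLen (k + 1)) t)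

/-- The flow of the truncated field `u_K`. -/
def truncatedFlow (i : ℕ → Fin 2) (L : ℕ → ℕ) (τ : ℕ → ℝ) (K : ℕ) (t : ℝ) : T2 ≃ᵐ T2 :=
  blockFlow i L τ K 0 0 t

section TruncatedFlow

variable {i : ℕ → Fin 2} {L : ℕ → ℕ} {τ : ℕ → ℝ}

lemma isRegularFlow_blockFlow (n k : ℕ) (a : ℝ) : IsRegularFlow (blockFlow i L τ n k a) := by
  induction n generalizing k a with
  | zero => exact isRegularFlow_refl
  | succ n ih =>
    have hslot (a : ℝ) := isRegularFlow_shearEquiv (i (k + 1)) (L (k + 1))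
      (lipschitzWith_elapsed (τ (k + 1)) a).continuous
    exact (((hslot _).trans (ih _ _)).trans (hslot _)).trans (ih _ _)

lemma isRegularFlow_truncatedFlow (K : ℕ) : IsRegularFlow (truncatedFlow i L τ K) :=
  isRegularFlow_blockFlow K 0 0

lemma flowOn_slot (hfin : FinitenessCondition τ) {K : ℕ} {p : ℕ × ℕ} (hp : p ∈ dyadicUpTo K)
    (hτ : 0 < τ p.1) :
    FlowOn (truncatedField i L τ K) (startTime p) (startTime p + slotLen p.1)
      fun t => shearEquiv (i p.1) (L p.1) (elapsed (τ p.1) (startTime p) t) := by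
  have hlt : τ p.1 < slotLen p.1 := hfin p.1 hp.1.1
  refine flowOn_shearEquiv hτ.le (by linarith) (fun t ht => ?_) (fun t ht => ?_)
  · exact fractalField_of_mem hfin (dyadicUpTo_subset K) hp ⟨ht.1.le, ht.2.le⟩
  · exact fractalField_of_mem_gap hfin (dyadicUpTo_subset K) hp.1 ht.1 ⟨by linarith [ht.1], ht.2⟩

lemma flowOn_blockFlow (hfin : FinitenessCondition τ) (hτ : ∀ k, 1 ≤ k → 0 < τ k) (n k m : ℕ)
    (hm : m < 2 ^ k) :
    FlowOn (truncatedField i L τ (n + k)) (blockStart k m) (blockStart k m + slotLen k)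
      (blockFlow i L τ n k (blockStart k m)) := by
  induction n generalizing k m with
  | zero =>
    rw [Nat.zero_add]
    exact flowOn_refl fun t ht => truncatedField_of_mem_block hfin hm ht
  | succ n ih =>
    have hτk := hτ (k + 1) (Nat.le_add_left _ _)
    have hpos := slotLen_pos (k + 1)
    have hlen : slotLen k = 4 * slotLen (k + 1) := by rw [slotLen_succ]; ring
    have hlevel : n + (k + 1) = n + 1 + k := by ring
    have slot_left := flowOn_slot (i := i) (L := L) hfin (K := n + 1 + k)
      ⟨mem_dyadic_left hm, by simp⟩ hτk
    have slot_right := flowOn_slot (i := i) (L := L) hfin (K := n + 1 + k)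
      ⟨mem_dyadic_right hm, by simp⟩ hτk
    have block_left := ih (k + 1) (2 * m) (by rw [pow_succ]; omega)
    have block_right := ih (k + 1) (2 * m + 1) (by rw [pow_succ]; omega)
    simp only [startTime_right_eq hm] at slot_right
    rw [hlevel, blockStart_left hm, show blockStart k m + slotLen (k + 1) + slotLen (k + 1)
      = blockStart k m + 2 * slotLen (k + 1) by ring] at block_left
    rw [show blockStart k m + 2 * slotLen (k + 1) + slotLen (k + 1)
      = blockStart k m + 3 * slotLen (k + 1) by ring] at slot_right
    rw [hlevel, blockStart_right hm, show blockStart k m + 3 * slotLen (k + 1) + slotLen (k + 1)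
      = blockStart k m + slotLen k by rw [hlen]; ring] at block_right
    change FlowOn _ (blockStart k m) (blockStart k m + slotLen (k + 1)) _ at slot_left
    exact ((slot_left.trans block_left (by linarith) (by linarith)).trans slot_right (by linarith)
      (by linarith)).trans block_right (by linarith) (by linarith)

lemma flowOn_truncatedFlow (hfin : FinitenessCondition τ) (hτ : ∀ k, 1 ≤ k → 0 < τ k) (K : ℕ) :
    FlowOn (truncatedField i L τ K) 0 1 (truncatedFlow i L τ K) := by
  have h := flowOn_blockFlow (i := i) (L := L) hfin hτ K 0 0 (by simp)
  rwa [blockStart_zero, slotLen_zero, zero_add] at h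

end TruncatedFlow

/-! ### Derivatives of test functions -/

/-- The representative in `[0,1)²` of a point of the torus. -/
def rep (x : T2) : Fin 2 → ℝ := fun j => AddCircle.equivIco (1 : ℝ) 0 (x j)

lemma toT2_rep (x : T2) : toT2 (rep x) = x :=
  funext fun j => (AddCircle.equivIco (1 : ℝ) 0).symm_apply_apply (x j)

lemma measurable_rep : Measurable rep :=
  measurable_pi_lambda _ fun j =>
    (measurable_subtype_coe.comp (AddCircle.measurableEquivIco (1 : ℝ) 0).measurable).comp
      (measurable_pi_apply j)

lemma rep_mem_Icc (x : T2) : rep x ∈ Icc (0 : Fin 2 → ℝ) 1 :=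
  ⟨fun j => (AddCircle.equivIco (1 : ℝ) 0 (x j)).2.1,
    fun j => by simpa [rep] using (AddCircle.equivIco (1 : ℝ) 0 (x j)).2.2.le⟩

/-- The lift of a function on space-time to the universal cover. -/
def periodicLift (φ : ℝ → T2 → ℝ) (p : ℝ × (Fin 2 → ℝ)) : ℝ := φ p.1 (toT2 p.2)

/-- The derivative `∂ₜφ + u · ∇φ` of `φ` along the field `u`. -/
def materialDeriv (u : ℝ → T2 → (Fin 2 → ℝ)) (φ : ℝ → T2 → ℝ) (t : ℝ) (x : T2) : ℝ :=
  timeDeriv φ t x + advect u φ t x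

namespace IsTestFunction

variable {φ : ℝ → T2 → ℝ}

lemma differentiable (hφ : IsTestFunction φ) : Differentiable ℝ (periodicLift φ) :=
  hφ.smooth.differentiable (by simp)

lemma continuous_fderiv (hφ : IsTestFunction φ) : Continuous (fderiv ℝ (periodicLift φ)) :=
  hφ.smooth.continuous_fderiv (by simp)

lemma timeDeriv_eq (hφ : IsTestFunction φ) (t : ℝ) (x : Fin 2 → ℝ) :
    timeDeriv φ t (toT2 x) = fderiv ℝ (periodicLift φ) (t, x) (1, 0) := by
  have hline : HasDerivAt (fun s : ℝ => (s, x)) (1, 0) t :=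
    (hasDerivAt_id t).prodMk (hasDerivAt_const t x)
  exact ((hφ.differentiable (t, x)).hasFDerivAt.comp_hasDerivAt t hline).deriv

lemma partialDeriv_eq (hφ : IsTestFunction φ) (j : Fin 2) (t : ℝ) (x : Fin 2 → ℝ) :
    partialDeriv j φ t (toT2 x) = fderiv ℝ (periodicLift φ) (t, x) (0, Pi.single j 1) := by
  have hline : HasDerivAt (fun h : ℝ => (t, x + Pi.single j h)) (0, Pi.single j 1) 0 :=
    (hasDerivAt_const 0 t).prodMk ((hasDerivAt_single j (hasDerivAt_id' 0)).const_add x)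
  have hφt : (fun h : ℝ => φ t (toT2 x + Pi.single j (h : UnitAddCircle))) =
      periodicLift φ ∘ fun h : ℝ => (t, x + Pi.single j h) := by
    funext h
    simp only [periodicLift, Function.comp_apply, toT2_add, toT2_single]
  rw [partialDeriv, hφt]
  refine (HasFDerivAt.comp_hasDerivAt (0 : ℝ) ?_ hline).deriv
  simpa only [Pi.single_zero, add_zero] using (hφ.differentiable (t, x)).hasFDerivAt

lemma materialDeriv_eq (hφ : IsTestFunction φ) (u : ℝ → T2 → (Fin 2 → ℝ)) (t : ℝ)
    (x : Fin 2 → ℝ) :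
    materialDeriv u φ t (toT2 x) = fderiv ℝ (periodicLift φ) (t, x) (1, u t (toT2 x)) := by
  have hsum : ((1 : ℝ), u t (toT2 x)) =
      (1, 0) + ∑ j, u t (toT2 x) j • ((0 : ℝ), (Pi.single j 1 : Fin 2 → ℝ)) := by
    ext j
    · simp
    · fin_cases j <;> simp [Fin.sum_univ_two]
  rw [hsum, map_add, map_sum, materialDeriv, advect, hφ.timeDeriv_eq]
  simp only [map_smul, smul_eq_mul, hφ.partialDeriv_eq]

lemma materialDeriv_eq_rep (hφ : IsTestFunction φ) (u : ℝ → T2 → (Fin 2 → ℝ)) (t : ℝ) (x : T2) :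
    materialDeriv u φ t x = fderiv ℝ (periodicLift φ) (t, rep x) (1, u t x) := by
  simpa only [toT2_rep] using hφ.materialDeriv_eq u t (rep x)

lemma measurable_materialDeriv (hφ : IsTestFunction φ) {u : ℝ → T2 → (Fin 2 → ℝ)}
    (hu : Measurable fun p : ℝ × T2 => u p.1 p.2) :
    Measurable fun p : ℝ × T2 => materialDeriv u φ p.1 p.2 := by
  have hcont : Continuous fun q : (ℝ × (Fin 2 → ℝ)) × (Fin 2 → ℝ) =>
      fderiv ℝ (periodicLift φ) q.1 (1, q.2) :=
    (hφ.continuous_fderiv.comp continuous_fst).clm_apply (continuous_const.prodMk continuous_snd)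
  simp only [hφ.materialDeriv_eq_rep]
  exact hcont.measurable.comp
    ((measurable_fst.prodMk (measurable_rep.comp measurable_snd)).prodMk hu)

lemma exists_bound (hφ : IsTestFunction φ) : ∃ C : ℝ, ∀ (u : ℝ → T2 → (Fin 2 → ℝ)) (t : ℝ) (x : T2),
    t ∈ Icc (0 : ℝ) 1 → ‖u t x‖ ≤ 1 → ‖materialDeriv u φ t x‖ ≤ C := by
  obtain ⟨C, hC⟩ := (isCompact_Icc (a := (0 : ℝ)) (b := 1)).prod
    (isCompact_Icc (a := (0 : Fin 2 → ℝ)) (b := 1)) |>.exists_bound_of_continuousOn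
    hφ.continuous_fderiv.continuousOn
  refine ⟨C, fun u t x ht hu => ?_⟩
  rw [hφ.materialDeriv_eq_rep]
  refine ((fderiv ℝ (periodicLift φ) (t, rep x)).le_of_opNorm_le_of_le
    (hC (t, rep x) ⟨ht, rep_mem_Icc x⟩) ?_).trans_eq (mul_one C)
  simpa [Prod.norm_def] using hu

lemma intervalIntegral_materialDeriv_curve (hφ : IsTestFunction φ) {u : ℝ → T2 → (Fin 2 → ℝ)}
    (hu : Measurable fun p : ℝ × T2 => u p.1 p.2) (hu1 : ∀ t x, ‖u t x‖ ≤ 1)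
    {γ : ℝ → (Fin 2 → ℝ)} (hγ : IsCurveAlong u 0 1 γ) :
    ∫ t in (0 : ℝ)..1, materialDeriv u φ t (toT2 (γ t)) = -φ 0 (toT2 (γ 0)) := by
  obtain ⟨C, hC⟩ := hφ.exists_bound
  obtain ⟨D, hD, hγ'⟩ := hγ.hasDerivAt
  have measurable_toT2 : Measurable toT2 :=
    measurable_pi_lambda _ fun j => AddCircle.measurable_mk'.comp (measurable_pi_apply j)
  have hcont : ContinuousOn (fun t => periodicLift φ (t, γ t)) (uIcc 0 1) :=
    (hφ.smooth.continuous.comp (continuous_id.prodMk hγ.lipschitz.continuous)).continuousOn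
  have hderiv (t : ℝ) (ht : t ∈ Ioo (min 0 1) (max 0 1) \ D) :
      HasDerivAt (fun t => periodicLift φ (t, γ t)) (materialDeriv u φ t (toT2 (γ t))) t := by
    rw [min_eq_left zero_le_one, max_eq_right zero_le_one] at ht
    rw [hφ.materialDeriv_eq]
    exact (hφ.differentiable (t, γ t)).hasFDerivAt.comp_hasDerivAt t
      ((hasDerivAt_id t).prodMk (hγ' t ht))
  have hint : IntervalIntegrable (fun t => materialDeriv u φ t (toT2 (γ t))) volume 0 1 := by
    rw [intervalIntegrable_iff_integrableOn_Icc_of_le zero_le_one]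
    refine Integrable.of_bound (C := C) ?_ ?_
    · exact ((hφ.measurable_materialDeriv hu).comp (measurable_id.prodMk
        (measurable_toT2.comp hγ.lipschitz.continuous.measurable))).aestronglyMeasurable
    · filter_upwards [ae_restrict_mem measurableSet_Icc] with t ht using hC u _ _ ht (hu1 _ _)
  obtain ⟨s, hs, hvanish⟩ := hφ.vanish
  rw [integral_eq_of_hasDerivAt_off_countable _ _ hD hcont hderiv hint, periodicLift, periodicLift,
    hvanish 1 hs.le, zero_sub]

end IsTestFunction

/-! ### Functions transported by a flow -/

lemma ae_spaceTime_of_ae_time {P : ℝ → Prop} (h : ∀ᵐ t ∂volume.restrict (Icc (0 : ℝ) 1), P t) :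
    ∀ᵐ p ∂spaceTime, P p.1 :=
  (Measure.quasiMeasurePreserving_fst (ν := (volume : Measure T2))).ae h

lemma ae_spaceTime_mem : ∀ᵐ p ∂spaceTime, p.1 ∈ Icc (0 : ℝ) 1 :=
  ae_spaceTime_of_ae_time (ae_restrict_mem measurableSet_Icc)

lemma integrable_spaceTime_of_bounded {F : ℝ × T2 → ℝ} (hF : AEStronglyMeasurable F spaceTime)
    (C : ℝ) (hC : ∀ p : ℝ × T2, p.1 ∈ Icc (0 : ℝ) 1 → ‖F p‖ ≤ C) : Integrable F spaceTime :=
  Integrable.of_bound hF C (ae_spaceTime_mem.mono hC)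

lemma IsTestFunction.integrable_materialDeriv {φ : ℝ → T2 → ℝ} (hφ : IsTestFunction φ)
    {u : ℝ → T2 → (Fin 2 → ℝ)} (hu : Measurable fun p : ℝ × T2 => u p.1 p.2)
    (hu1 : ∀ t x, ‖u t x‖ ≤ 1) :
    Integrable (fun p : ℝ × T2 => materialDeriv u φ p.1 p.2) spaceTime := by
  obtain ⟨C, hC⟩ := hφ.exists_bound
  exact integrable_spaceTime_of_bounded (hφ.measurable_materialDeriv hu).aestronglyMeasurable C
    fun p hp => hC _ _ _ hp (hu1 _ _)

lemma integrable_of_bounded {g : T2 → ℝ} (hg : Measurable g) {M : ℝ} (hM : ∀ x, |g x| ≤ M) :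
    Integrable g volume :=
  Integrable.of_bound hg.aestronglyMeasurable M (Eventually.of_forall hM)

/-- A regular flow along a measurable field that is bounded by `1`. -/
structure IsFlowAlong (u : ℝ → T2 → (Fin 2 → ℝ)) (A : ℝ → T2 ≃ᵐ T2) : Prop
    extends IsRegularFlow A where
  measurable_field : Measurable fun p : ℝ × T2 => u p.1 p.2
  norm_field_le : ∀ t x, ‖u t x‖ ≤ 1
  flowOn : FlowOn u 0 1 A

lemma isFlowAlong_refl : IsFlowAlong 0 fun _ => MeasurableEquiv.refl T2 where
  toIsRegularFlow := isRegularFlow_refl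
  measurable_field := measurable_const
  norm_field_le _ _ := by simp
  flowOn := flowOn_refl fun _ _ => rfl

/-- The function `g` transported by the flow `A`. -/
def transport (A : ℝ → T2 ≃ᵐ T2) (g : T2 → ℝ) (t : ℝ) (x : T2) : ℝ := g ((A t).symm x)

namespace IsRegularFlow

variable {A : ℝ → T2 ≃ᵐ T2} {g : T2 → ℝ} {M : ℝ}

lemma measurable_transport (hA : IsRegularFlow A) (hg : Measurable g) :
    Measurable fun p : ℝ × T2 => transport A g p.1 p.2 :=
  hg.comp hA.measurable_symm

lemma isC0L1_transport (hA : IsRegularFlow A) (hg : Integrable g volume) :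
    IsC0L1 (transport A g) :=
  ⟨fun t _ => memLp_one_iff_integrable.2
      ((hA.measurePreserving t).symm.integrable_comp_of_integrable hg),
    fun t _ => (hA.koopmanContinuous_symm g hg t).mono_left nhdsWithin_le_nhds⟩

lemma isLinftyLinfty_transport (hA : IsRegularFlow A) (hg : Measurable g) (hM : ∀ x, |g x| ≤ M) :
    IsLinftyLinfty (transport A g) :=
  memLp_top_of_bound (hA.measurable_transport hg).aestronglyMeasurable M
    (Eventually.of_forall fun _ => hM _)

lemma integral_spaceTime_comp_flow (hA : IsRegularFlow A) {F : ℝ × T2 → ℝ}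
    (hF : AEStronglyMeasurable F spaceTime) :
    ∫ p, F (p.1, A p.1 p.2) ∂spaceTime = ∫ p, F p ∂spaceTime := by
  have hΘ : MeasurePreserving (fun p : ℝ × T2 => (p.1, A p.1 p.2)) spaceTime spaceTime :=
    (MeasurePreserving.id _).skew_product (g := fun t x => A t x) hA.measurable
      (Eventually.of_forall fun t => (hA.measurePreserving t).map_eq)
  conv_rhs => rw [← hΘ.map_eq]
  rw [integral_map hΘ.measurable.aemeasurable (hΘ.map_eq.symm ▸ hF)]

end IsRegularFlow

namespace IsFlowAlong

variable {u : ℝ → T2 → (Fin 2 → ℝ)} {A : ℝ → T2 ≃ᵐ T2} {f₀ g : T2 → ℝ} {M : ℝ}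

lemma integral_transport_mul_materialDeriv (hA : IsFlowAlong u A) (hg : Measurable g)
    (hM : ∀ x, |g x| ≤ M) {φ : ℝ → T2 → ℝ} (hφ : IsTestFunction φ) :
    ∫ p, transport A g p.1 p.2 * materialDeriv u φ p.1 p.2 ∂spaceTime = -∫ x, g x * φ 0 x := by
  obtain ⟨C, hC⟩ := hφ.exists_bound
  have hmat := hφ.measurable_materialDeriv hA.measurable_field
  have along_orbit (x : T2) :
      ∫ t in Icc (0 : ℝ) 1, materialDeriv u φ t (A t x) = -φ 0 x := by
    obtain ⟨z, rfl⟩ := toT2_surjective x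
    obtain ⟨γ, hγ, hγ0, hγA⟩ := hA.flowOn z
    have h := hφ.intervalIntegral_materialDeriv_curve hA.measurable_field hA.norm_field_le hγ
    rwa [intervalIntegral.integral_of_le zero_le_one, ← integral_Icc_eq_integral_Ioc, hγ0,
      funext fun t => congrArg (materialDeriv u φ t) (hγA t)] at h
  have hint : Integrable (fun p : ℝ × T2 => g p.2 * materialDeriv u φ p.1 (A p.1 p.2))
      spaceTime := by
    refine integrable_spaceTime_of_bounded ((hg.comp measurable_snd).mul
      (hmat.comp (measurable_fst.prodMk hA.measurable))).aestronglyMeasurable (M * C) fun p hp => ?_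
    rw [norm_mul]
    exact mul_le_mul (hM _) (hC u _ _ hp (hA.norm_field_le _ _)) (norm_nonneg _)
      ((abs_nonneg _).trans (hM p.2))
  calc ∫ p, transport A g p.1 p.2 * materialDeriv u φ p.1 p.2 ∂spaceTime
      = ∫ p, g p.2 * materialDeriv u φ p.1 (A p.1 p.2) ∂spaceTime := by
        refine (hA.integral_spaceTime_comp_flow
          ((hA.measurable_transport hg).mul hmat).aestronglyMeasurable).symm.trans ?_
        simp only [transport, MeasurableEquiv.symm_apply_apply, Pi.mul_apply]
    _ = ∫ x, g x * ∫ t in Icc (0 : ℝ) 1, materialDeriv u φ t (A t x) := by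
        rw [spaceTime, integral_prod_symm _ hint]
        simp only [integral_const_mul]
    _ = -∫ x, g x * φ 0 x := by simp only [along_orbit, mul_neg, integral_neg]

end IsFlowAlong

/-- The weak formulation for constants under the zero field says that `∂ₜφ` has the same integral
as under `u`, so the difference, the integral of `u · ∇φ`, is zero. -/
lemma isDivFree_of_integral {u : ℝ → T2 → (Fin 2 → ℝ)}
    (hu : Measurable fun p : ℝ × T2 => u p.1 p.2) (hu1 : ∀ t x, ‖u t x‖ ≤ 1)
    (h : ∀ φ, IsTestFunction φ → ∫ p, materialDeriv u φ p.1 p.2 ∂spaceTime = -∫ x, φ 0 x) :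
    IsDivFree u := by
  refine ⟨Integrable.of_bound hu.aestronglyMeasurable 1 (Eventually.of_forall fun p => hu1 _ _),
    fun φ hφ _ => ?_⟩
  have h_zero : ∫ p, materialDeriv 0 φ p.1 p.2 ∂spaceTime = -∫ x, φ 0 x := by
    simpa only [transport, one_mul] using isFlowAlong_refl.integral_transport_mul_materialDeriv
      (g := fun _ => 1) measurable_const (M := 1) (by simp) hφ
  have hdiff (p : ℝ × T2) : advect u φ p.1 p.2 =
      materialDeriv u φ p.1 p.2 - materialDeriv 0 φ p.1 p.2 := by
    simp [materialDeriv, advect]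
  simp_rw [hdiff]
  rw [integral_sub (hφ.integrable_materialDeriv hu hu1)
    (hφ.integrable_materialDeriv isFlowAlong_refl.measurable_field isFlowAlong_refl.norm_field_le),
    h φ hφ, h_zero, sub_self]

lemma isWeakSolution_of_integral {u : ℝ → T2 → (Fin 2 → ℝ)}
    (hu : Measurable fun p : ℝ × T2 => u p.1 p.2) (hu1 : ∀ t x, ‖u t x‖ ≤ 1) (hdiv : IsDivFree u)
    {f₀ : T2 → ℝ} (hf₀ : Integrable f₀ volume) {f : ℝ → T2 → ℝ}
    (hf : AEStronglyMeasurable (fun p : ℝ × T2 => f p.1 p.2) spaceTime) {M : ℝ}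
    (hM : ∀ t x, |f t x| ≤ M)
    (h : ∀ φ, IsTestFunction φ →
      ∫ p, f p.1 p.2 * materialDeriv u φ p.1 p.2 ∂spaceTime = -∫ x, f₀ x * φ 0 x) :
    IsWeakSolution u f₀ f := by
  refine ⟨hdiv, hf₀, integrable_spaceTime_of_bounded hf M fun p _ => hM _ _, ?_, h⟩
  refine Integrable.of_bound (hf.smul hu.aestronglyMeasurable) M (Eventually.of_forall fun p => ?_)
  calc ‖f p.1 p.2 • u p.1 p.2‖ = |f p.1 p.2| * ‖u p.1 p.2‖ := norm_smul _ _
    _ ≤ M * 1 :=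
        mul_le_mul (hM _ _) (hu1 _ _) (norm_nonneg _) ((abs_nonneg _).trans (hM 0 p.2))
    _ = M := mul_one M

lemma IsWeakSolution.congr_data {u : ℝ → T2 → (Fin 2 → ℝ)} {f₀ g₀ : T2 → ℝ} {f : ℝ → T2 → ℝ}
    (h : IsWeakSolution u g₀ f) (he : f₀ =ᵐ[volume] g₀) : IsWeakSolution u f₀ f where
  velocity := h.velocity
  data := h.data.congr he.symm
  integrable := h.integrable
  flux := h.flux
  weak φ hφ := by
    rw [h.weak φ hφ, integral_congr_ae (he.mono fun x hx => congrArg (· * φ 0 x) hx)]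

namespace IsFlowAlong

variable {u : ℝ → T2 → (Fin 2 → ℝ)} {A : ℝ → T2 ≃ᵐ T2} {f₀ g : T2 → ℝ} {M : ℝ}

lemma isDivFree (hA : IsFlowAlong u A) : IsDivFree u :=
  isDivFree_of_integral hA.measurable_field hA.norm_field_le fun φ hφ => by
    simpa only [transport, one_mul] using hA.integral_transport_mul_materialDeriv
      (g := fun _ => 1) measurable_const (M := 1) (by simp) hφ

lemma isWeakSolution_transport (hA : IsFlowAlong u A) (hg : Measurable g) (hM : ∀ x, |g x| ≤ M) :
    IsWeakSolution u g (transport A g) :=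
  isWeakSolution_of_integral hA.measurable_field hA.norm_field_le hA.isDivFree
    (integrable_of_bounded hg hM) (hA.measurable_transport hg).aestronglyMeasurable
    (fun _ _ => hM _) fun _ hφ => hA.integral_transport_mul_materialDeriv hg hM hφ

lemma isRenormalised_transport (hA : IsFlowAlong u A) (he : f₀ =ᵐ[volume] g) (hg : Measurable g)
    (hM : ∀ x, |g x| ≤ M) : IsRenormalised u f₀ (transport A g) := by
  refine ⟨(hA.isWeakSolution_transport hg hM).congr_data he, ?_⟩
  rintro β hβ ⟨C, hC⟩
  exact (hA.isWeakSolution_transport (g := β ∘ g) (hβ.measurable.comp hg) fun x => hC _).congr_data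
    (he.fun_comp β)

lemma isLagrangianFlow (hA : IsFlowAlong u A) : IsLagrangianFlow u A := by
  refine ⟨hA.isDivFree, fun t _ => hA.measurePreserving t, Eventually.of_forall fun x => ?_⟩
  obtain ⟨z, rfl⟩ := toT2_surjective x
  obtain ⟨γ, hγ, -, hγA⟩ := hA.flowOn z
  obtain ⟨D, hD, hγ'⟩ := hγ.hasDerivAt
  refine ⟨γ, hγ.lipschitz.lipschitzOnWith.absolutelyContinuousOnInterval, fun t _ => hγA t, ?_⟩
  rw [← restrict_Ioo_eq_restrict_Icc, ae_restrict_iff' measurableSet_Ioo]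
  filter_upwards [hD.ae_notMem volume] with t htD ht
  exact hγA t ▸ hγ' t ⟨ht, htD⟩

lemma isLagrangianSolution_transport (hA : IsFlowAlong u A) (he : f₀ =ᵐ[volume] g)
    (hg : Measurable g) (hM : ∀ x, |g x| ≤ M) : IsLagrangianSolution u f₀ (transport A g) := by
  have symm_zero (x : T2) : (A 0).symm x = x := by
    rw [MeasurableEquiv.symm_apply_eq, hA.flowOn.apply_of_le le_rfl]
  refine ⟨(hA.isWeakSolution_transport hg hM).integrable, g, A, integrable_of_bounded hg hM,
    hA.isLagrangianFlow, ?_, fun t _ => EventuallyEq.rfl⟩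
  simpa only [symm_zero] using he

end IsFlowAlong

lemma isFlowAlong_truncatedFlow {i : ℕ → Fin 2} {L : ℕ → ℕ} {τ : ℕ → ℝ}
    (hfin : FinitenessCondition τ) (hτ : ∀ k, 1 ≤ k → 0 < τ k) (K : ℕ) :
    IsFlowAlong (truncatedField i L τ K) (truncatedFlow i L τ K) where
  toIsRegularFlow := isRegularFlow_truncatedFlow K
  measurable_field := measurable_fractalField hfin (dyadicUpTo_subset K)
  norm_field_le := norm_fractalField_le _
  flowOn := flowOn_truncatedFlow hfin hτ K

lemma exists_bounded_representative {f₀ : T2 → ℝ} (hf₀ : MemLp f₀ ⊤ volume) :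
    ∃ (g : T2 → ℝ) (M : ℝ), Measurable g ∧ (∀ x, |g x| ≤ M) ∧ f₀ =ᵐ[volume] g := by
  obtain ⟨h, hm, he⟩ := hf₀.aestronglyMeasurable
  set M := (eLpNorm f₀ ⊤ volume).toReal
  have hM : 0 ≤ M := ENNReal.toReal_nonneg
  refine ⟨fun x => max (-M) (min (h x) M), M, measurable_const.max (hm.measurable.min
    measurable_const), fun x => ?_, ?_⟩
  · exact abs_le.2 ⟨le_max_left _ _, max_le (by linarith) (min_le_right _ _)⟩
  · filter_upwards [he, ae_le_eLpNormEssSup (f := f₀) (μ := volume)] with x hx hbound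
    have abs_le_M : |f₀ x| ≤ M := by
      rw [← eLpNorm_exponent_top] at hbound
      simpa only [toReal_enorm, Real.norm_eq_abs] using ENNReal.toReal_mono hf₀.2.ne hbound
    rw [abs_le] at abs_le_M
    rw [← hx, min_eq_left abs_le_M.2, max_eq_right abs_le_M.1]

/-! ### Uniqueness of Fourier coefficients -/

section

variable {X 𝕜 : Type*} [TopologicalSpace X] [MeasurableSpace X] [BorelSpace X] {μ : Measure X}
  [RCLike 𝕜]

lemma ae_eq_zero_of_forall_integral_mul_continuous [HasOuterApproxClosed X] {w : X → 𝕜}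
    (hw : Integrable w μ) (h : ∀ ψ : C(X, 𝕜), ∫ x, w x * ψ x ∂μ = 0) : w =ᵐ[μ] 0 := by
  refine ae_eq_zero_of_forall_setIntegral_isClosed_eq_zero hw fun F hF => ?_
  let ψ (n : ℕ) : C(X, 𝕜) :=
    ⟨fun x => ((hF.apprSeq n x : ℝ) : 𝕜), RCLike.continuous_ofReal.comp
      (NNReal.continuous_coe.comp (hF.apprSeq n).continuous)⟩
  have norm_ψ_le (n : ℕ) (x : X) : ‖ψ n x‖ ≤ 1 := by
    simpa [ψ] using HasOuterApproxClosed.apprSeq_apply_le_one hF n x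
  have tendsto_ψ (x : X) :
      Tendsto (fun n => w x * ψ n x) atTop (𝓝 (F.indicator w x)) := by
    have happr := (tendsto_pi_nhds.1 (HasOuterApproxClosed.tendsto_apprSeq hF)) x
    have hlim : Tendsto (fun n => w x * ψ n x) atTop
        (𝓝 (w x * (((F.indicator (fun _ => 1) x : NNReal) : ℝ) : 𝕜))) :=
      (((RCLike.continuous_ofReal.comp NNReal.continuous_coe).tendsto _).comp happr).const_mul _
    convert hlim using 2
    by_cases hx : x ∈ F <;> simp [hx]
  have hlim : Tendsto (fun n => ∫ x, w x * ψ n x ∂μ) atTop (𝓝 (∫ x, F.indicator w x ∂μ)) := by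
    refine tendsto_integral_of_dominated_convergence (fun x => ‖w x‖)
      (fun n => hw.aestronglyMeasurable.mul (ψ n).continuous.measurable.aestronglyMeasurable)
      hw.norm (fun n => Eventually.of_forall fun x => ?_) (Eventually.of_forall tendsto_ψ)
    rw [norm_mul]
    exact mul_le_of_le_one_right (norm_nonneg _) (norm_ψ_le n x)
  simp only [h] at hlim
  rw [← integral_indicator hF.measurableSet]
  exact tendsto_nhds_unique hlim tendsto_const_nhds

lemma integral_mul_eq_zero_of_dense_span [CompactSpace X] {w : X → 𝕜} (hw : Integrable w μ)
    {S : Set C(X, 𝕜)} (hS : (Submodule.span 𝕜 S).topologicalClosure = ⊤)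
    (h : ∀ ψ ∈ S, ∫ x, w x * ψ x ∂μ = 0) (ψ : C(X, 𝕜)) : ∫ x, w x * ψ x ∂μ = 0 := by
  have hint (ψ : C(X, 𝕜)) : Integrable (fun x => w x * ψ x) μ :=
    hw.mul_bdd ψ.continuous.measurable.aestronglyMeasurable
      (Eventually.of_forall ψ.norm_coe_le_norm)
  let pairing : C(X, 𝕜) →L[𝕜] 𝕜 := LinearMap.mkContinuous
    { toFun := fun ψ => ∫ x, w x * ψ x ∂μ
      map_add' := fun ψ χ => by
        simpa only [ContinuousMap.add_apply, mul_add] using integral_add (hint ψ) (hint χ)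
      map_smul' := fun c ψ => by
        simpa only [ContinuousMap.smul_apply, smul_eq_mul, mul_left_comm _ c, RingHom.id_apply]
          using integral_const_mul c _ }
    (∫ x, ‖w x‖ ∂μ) fun ψ => by
      rw [← integral_mul_const]
      refine norm_integral_le_of_norm_le (hw.norm.mul_const _) (Eventually.of_forall fun x => ?_)
      rw [norm_mul]
      gcongr
      exact ψ.norm_coe_le_norm x
  have hpairing : pairing = 0 :=
    ContinuousLinearMap.ext_on (Submodule.dense_iff_topologicalClosure_eq_top.2 hS) h
  exact congrArg (· ψ) hpairing

end

lemma ae_eq_zero_of_forall_integral_mFourier {d : Type*} [Fintype d] {w : UnitAddTorus d → ℂ}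
    (hw : Integrable w volume)
    (h : ∀ n, ∫ x, w x * UnitAddTorus.mFourier n x = 0) : w =ᵐ[volume] 0 :=
  ae_eq_zero_of_forall_integral_mul_continuous hw <|
    integral_mul_eq_zero_of_dense_span hw UnitAddTorus.span_mFourier_closure_eq_top <| by
      rintro _ ⟨n, rfl⟩
      exact h n

/-! ### Uniqueness while a single shear acts -/

/-- The function `sin (2πLz)` on the circle; its sign is the square wave `shearSign L`. -/
def wave (L : ℕ) (z : UnitAddCircle) : ℝ := (fourier (L : ℤ) z).im

lemma wave_coe (L : ℕ) (r : ℝ) : wave L (r : UnitAddCircle) = Real.sin (2 * L * r * Real.pi) := by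
  have exponent : 2 * (Real.pi : ℂ) * Complex.I * ((L : ℤ) : ℂ) * (r : ℂ) / ((1 : ℝ) : ℂ) =
      ((2 * L * r * Real.pi : ℝ) : ℂ) * Complex.I := by
    push_cast
    ring
  rw [wave, fourier_coe_apply, exponent, Complex.exp_ofReal_mul_I_im]

lemma shearSign_mul_wave_nonneg (L : ℕ) (z : UnitAddCircle) : 0 ≤ shearSign L z * wave L z := by
  obtain ⟨r, rfl⟩ := QuotientAddGroup.mk_surjective z
  have sin_fract_nonneg : 0 ≤ Real.sin (Int.fract (2 * (L : ℝ) * r) * Real.pi) :=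
    Real.sin_nonneg_of_nonneg_of_le_pi (mul_nonneg (Int.fract_nonneg _) Real.pi_pos.le)
      (mul_le_of_le_one_left Real.pi_pos.le (Int.fract_lt_one _).le)
  change 0 ≤ shearSign L (r : UnitAddCircle) * wave L (r : UnitAddCircle)
  rw [shearSign_coe, wave_coe, ← Int.fract_add_floor (2 * (L : ℝ) * r), add_mul,
    Real.sin_add_int_mul_pi, Int.fract_add_floor]
  split_ifs with parity
  · simpa [parity.neg_one_zpow] using sin_fract_nonneg
  · simpa [(Int.not_even_iff_odd.1 parity).neg_one_zpow] using sin_fract_nonneg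

lemma shearSign_eq_of_wave_pos {L : ℕ} {σ : ℝ} (hσ : σ = 1 ∨ σ = -1) {z : UnitAddCircle}
    (h : 0 < σ * wave L z) : shearSign L z = σ := by
  have hnonneg := shearSign_mul_wave_nonneg L z
  rcases hσ with rfl | rfl <;> rcases shearSign_eq_one_or_neg_one L z with hs | hs <;>
    rw [hs] at hnonneg ⊢ <;> linarith

lemma continuous_wave (L : ℕ) : Continuous (wave L) :=
  Complex.continuous_im.comp (fourier (L : ℤ)).continuous

lemma ae_wave_ne_zero {L : ℕ} (hL : 1 ≤ L) (j : Fin 2) : ∀ᵐ x : T2, wave L (x j) ≠ 0 := by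
  have hL0 : (0 : ℝ) < L := by exact_mod_cast hL
  have zeros : {r : ℝ | wave L (r : UnitAddCircle) = 0} ⊆ range fun n : ℤ => (n / (2 * L) : ℝ) := by
    intro r hr
    rw [mem_ofPred_eq, wave_coe, Real.sin_eq_zero_iff] at hr
    obtain ⟨n, hn⟩ := hr
    have hn' : (n : ℝ) = 2 * L * r := mul_right_cancel₀ Real.pi_ne_zero hn
    exact ⟨n, (div_eq_iff (mul_pos two_pos hL0).ne').2 (by rw [hn', mul_comm])⟩
  have hcircle : ∀ᵐ z : UnitAddCircle, wave L z ≠ 0 := by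
    have hmp := UnitAddCircle.measurePreserving_mk 0
    rw [← hmp.map_eq, ae_map_iff (p := fun z => wave L z ≠ 0) hmp.measurable.aemeasurable
      ((continuous_wave L).measurable (measurableSet_singleton 0)).compl]
    exact ae_restrict_of_ae (((countable_range _).mono zeros).ae_notMem volume)
  exact (Measure.quasiMeasurePreserving_eval (fun _ : Fin 2 => (volume : Measure UnitAddCircle))
    j).ae hcircle

/-- A smooth approximation, as `N → ∞`, of the indicator function of the stripes on which the
square wave `shearSign L` has sign `σ`. -/
def stripeCutoff (L : ℕ) (σ : ℝ) (N : ℕ) (z : UnitAddCircle) : ℝ :=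
  Real.smoothTransition (N * (σ * wave L z))

section

variable {L : ℕ} {σ : ℝ}

lemma norm_stripeCutoff_le_one (N : ℕ) (z : UnitAddCircle) : ‖stripeCutoff L σ N z‖ ≤ 1 := by
  rw [stripeCutoff, Real.norm_of_nonneg (Real.smoothTransition.nonneg _)]
  exact Real.smoothTransition.le_one _

lemma continuous_stripeCutoff (N : ℕ) : Continuous (stripeCutoff L σ N) :=
  Real.smoothTransition.continuous.comp
    (continuous_const.mul (continuous_const.mul (continuous_wave L)))

lemma shearSign_of_stripeCutoff_ne_zero (hσ : σ = 1 ∨ σ = -1) {N : ℕ} {z : UnitAddCircle}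
    (h : stripeCutoff L σ N z ≠ 0) : shearSign L z = σ := by
  refine shearSign_eq_of_wave_pos hσ ?_
  by_contra! hle
  exact h (Real.smoothTransition.zero_of_nonpos
    (mul_nonpos_of_nonneg_of_nonpos (Nat.cast_nonneg N) hle))

lemma tendsto_stripeCutoff_add {z : UnitAddCircle} (hz : wave L z ≠ 0) :
    Tendsto (fun N => stripeCutoff L 1 N z + stripeCutoff L (-1) N z) atTop (𝓝 1) := by
  refine tendsto_const_nhds.congr' ?_
  obtain ⟨N₀, hN₀⟩ := exists_nat_ge (1 / |wave L z|)
  filter_upwards [eventually_ge_atTop N₀] with N hN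
  have hlarge : 1 ≤ N * |wave L z| := by
    rw [div_le_iff₀ (abs_pos.2 hz)] at hN₀
    exact hN₀.trans (by gcongr)
  rw [stripeCutoff, stripeCutoff]
  rcases lt_or_gt_of_ne hz with hneg | hpos
  · rw [abs_of_neg hneg] at hlarge
    rw [Real.smoothTransition.zero_of_nonpos (by linarith),
      Real.smoothTransition.one_of_one_le (by linarith), zero_add]
  · rw [abs_of_pos hpos] at hlarge
    rw [Real.smoothTransition.one_of_one_le (by linarith),
      Real.smoothTransition.zero_of_nonpos (by linarith), add_zero]

end

lemma tendsto_integral_mul_stripeCutoff_add {L : ℕ} (hL : 1 ≤ L) (j : Fin 2) {G : ℝ × T2 → ℝ}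
    (hG : Integrable G spaceTime) :
    Tendsto (fun N => ∫ p, G p * (stripeCutoff L 1 N (p.2 j) + stripeCutoff L (-1) N (p.2 j))
      ∂spaceTime) atTop (𝓝 (∫ p, G p ∂spaceTime)) := by
  have hwave : ∀ᵐ p ∂spaceTime, wave L (p.2 j) ≠ 0 :=
    Measure.quasiMeasurePreserving_snd.ae (ae_wave_ne_zero hL j)
  refine tendsto_integral_of_dominated_convergence (fun p => ‖G p‖ * (1 + 1)) (fun N => ?_)
    (hG.norm.mul_const _) (fun N => Eventually.of_forall fun p => ?_) ?_
  · exact hG.aestronglyMeasurable.mul (((continuous_stripeCutoff N).add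
      (continuous_stripeCutoff N)).measurable.comp
        ((measurable_pi_apply j).comp measurable_snd)).aestronglyMeasurable
  · rw [norm_mul]
    gcongr
    exact norm_add_le_of_le (norm_stripeCutoff_le_one N _) (norm_stripeCutoff_le_one N _)
  · filter_upwards [hwave] with p hp
    simpa using (tendsto_stripeCutoff_add hp).const_mul (G p)

/-- The test functions of the uniqueness proof: `E` transported by the shear of velocity `c`,
multiplied by `θ` in time and cut off to the stripes of sign `σ`, on which the shear is the
translation with velocity `σ c`. -/
def stripeTest (i : Fin 2) (L : ℕ) (c σ : ℝ) (θ : ℝ → ℝ) (E : T2 → ℝ) (N : ℕ) (t : ℝ)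
    (x : T2) : ℝ :=
  θ t * stripeCutoff L σ N (x (1 - i)) * E (x + Pi.single i ((-(σ * c * t) : ℝ) : UnitAddCircle))

lemma IsTestFunction.materialDeriv_eq_deriv {φ : ℝ → T2 → ℝ} (hφ : IsTestFunction φ)
    (u : ℝ → T2 → (Fin 2 → ℝ)) (t : ℝ) (y : Fin 2 → ℝ) :
    materialDeriv u φ t (toT2 y) =
      deriv (fun s : ℝ => φ (t + s) (toT2 (y + s • u t (toT2 y)))) 0 := by
  have hline : HasDerivAt (fun s : ℝ => (t + s, y + s • u t (toT2 y))) (1, u t (toT2 y)) 0 := by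
    refine ((hasDerivAt_id' (0 : ℝ)).const_add t).prodMk (HasDerivAt.const_add y ?_)
    simpa using (hasDerivAt_id' (0 : ℝ)).smul_const (u t (toT2 y))
  have hlift : HasFDerivAt (periodicLift φ) (fderiv ℝ (periodicLift φ) (t, y))
      (t + 0, y + (0 : ℝ) • u t (toT2 y)) := by
    simpa using (hφ.differentiable (t, y)).hasFDerivAt
  rw [hφ.materialDeriv_eq]
  exact (hlift.comp_hasDerivAt (0 : ℝ) hline).deriv.symm

lemma IsTestFunction.materialDeriv_eq_zero {φ : ℝ → T2 → ℝ} (hφ : IsTestFunction φ) {b : ℝ}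
    (hb : ∀ t, b ≤ t → ∀ x, φ t x = 0) (u : ℝ → T2 → (Fin 2 → ℝ)) {t : ℝ} (ht : b < t) (x : T2) :
    materialDeriv u φ t x = 0 := by
  obtain ⟨y, rfl⟩ := toT2_surjective x
  have hzero : periodicLift φ =ᶠ[𝓝 (t, y)] fun _ => 0 := by
    filter_upwards [prod_mem_nhds (Ioi_mem_nhds ht) univ_mem] with p hp
    exact hb p.1 (le_of_lt hp.1) _
  rw [hφ.materialDeriv_eq, hzero.fderiv_eq]
  simp

section

variable {i : Fin 2} {L : ℕ} {c σ : ℝ} {θ : ℝ → ℝ} {E : T2 → ℝ} {b : ℝ}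

lemma stripeTest_toT2 (N : ℕ) (t : ℝ) (y : Fin 2 → ℝ) :
    stripeTest i L c σ θ E N t (toT2 y) = θ t * Real.smoothTransition
      (N * (σ * Real.sin (2 * L * y (1 - i) * Real.pi))) *
        E (toT2 (y + Pi.single i (-(σ * c * t)))) := by
  rw [← wave_coe, toT2_add, toT2_single]
  rfl

lemma isTestFunction_stripeTest (hθ : ContDiff ℝ ∞ θ) (hb : b < 1) (hθb : ∀ t, b ≤ t → θ t = 0)
    (hE : ContDiff ℝ ∞ fun y => E (toT2 y)) (N : ℕ) :
    IsTestFunction (stripeTest i L c σ θ E N) := by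
  have hcoord : ContDiff ℝ ∞ fun p : ℝ × (Fin 2 → ℝ) => p.2 (1 - i) :=
    (contDiff_apply ℝ ℝ (1 - i)).comp contDiff_snd
  have hshift : ContDiff ℝ ∞ fun p : ℝ × (Fin 2 → ℝ) =>
      (Pi.single i (-(σ * c * p.1)) : Fin 2 → ℝ) :=
    (ContinuousLinearMap.single ℝ (fun _ : Fin 2 => ℝ) i).contDiff.comp
      (contDiff_const.mul contDiff_fst).neg
  refine ⟨?_, b, hb, fun t ht x => by simp [stripeTest, hθb t ht]⟩
  simp_rw [stripeTest_toT2]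
  exact ((hθ.comp contDiff_fst).mul (Real.smoothTransition.contDiff.comp
    (contDiff_const.mul (contDiff_const.mul (Real.contDiff_sin.comp
      ((contDiff_const.mul hcoord).mul contDiff_const)))))).mul
    (hE.comp (contDiff_snd.add hshift))

lemma materialDeriv_stripeTest (hσ : σ = 1 ∨ σ = -1) (hθ : ContDiff ℝ ∞ θ) (hb : b < 1)
    (hθb : ∀ t, b ≤ t → θ t = 0) (hE : ContDiff ℝ ∞ fun y => E (toT2 y)) (N : ℕ)
    {u : ℝ → T2 → (Fin 2 → ℝ)} {t : ℝ} (hu : ∀ x, u t x = c • shearField i L x) (x : T2) :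
    materialDeriv u (stripeTest i L c σ θ E N) t x =
      deriv θ t * (stripeCutoff L σ N (x (1 - i)) * E (shearFlow i L (-(c * t)) x)) := by
  obtain ⟨y, rfl⟩ := toT2_surjective x
  rw [(isTestFunction_stripeTest hθ hb hθb hE N).materialDeriv_eq_deriv, hu]
  set x := toT2 y
  have along_line : (fun s : ℝ => stripeTest i L c σ θ E N (t + s)
      (toT2 (y + s • c • shearField i L x))) = fun s => θ (t + s) *
        (stripeCutoff L σ N (x (1 - i)) * E (shearFlow i L (-(c * t)) x)) := by
    funext s
    have hline : toT2 (y + s • c • shearField i L x) =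
        x + Pi.single i ((s * c * shearSign L (x (1 - i)) : ℝ) : UnitAddCircle) := by
      rw [shearField, ← Pi.single_smul, ← Pi.single_smul, toT2_add, toT2_single, smul_smul,
        smul_eq_mul]
    have hother : toT2 (y + s • c • shearField i L x) (1 - i) = x (1 - i) := by
      simp [hline, Pi.single_eq_of_ne (one_sub_ne i)]
    rw [stripeTest, hother, mul_assoc]
    by_cases hcut : stripeCutoff L σ N (x (1 - i)) = 0
    · simp [hcut]
    · rw [hline, shearFlow, shearSign_of_stripeCutoff_ne_zero hσ hcut, add_assoc, ← Pi.single_add,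
        ← AddCircle.coe_add]
      ring_nf
  have hderiv : HasDerivAt (fun s => θ (t + s)) (deriv θ t) 0 := by
    refine HasDerivAt.comp_const_add t 0 ?_
    simpa using (hθ.differentiable (by simp) t).hasDerivAt
  rw [along_line]
  exact (hderiv.mul_const _).deriv

end

lemma exists_lt_forall_ge_eq_zero {F : Type*} [Zero F] {ρ : ℝ → F} (hρ : HasCompactSupport ρ)
    {b : ℝ} (hb : tsupport ρ ⊆ Iio b) : ∃ b' < b, ∀ t, b' ≤ t → ρ t = 0 := by
  obtain ⟨m, hm, hmax⟩ := (hρ.isCompact.insert (b - 1)).exists_isGreatest (insert_nonempty _ _)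
  have hmb : m < b := hm.elim (fun h => by linarith) fun h => hb h
  refine ⟨(m + b) / 2, by linarith, fun t ht => image_eq_zero_of_notMem_tsupport fun hmem => ?_⟩
  linarith [hmax (mem_insert_of_mem _ hmem)]

lemma exists_contDiff_primitive {F : Type*} [NormedAddCommGroup F] [NormedSpace ℝ F]
    [CompleteSpace F] {ρ : ℝ → F} (hρ : ContDiff ℝ ∞ ρ) {b' : ℝ} (hb' : ∀ t, b' ≤ t → ρ t = 0) :
    ∃ θ : ℝ → F, ContDiff ℝ ∞ θ ∧ (∀ t, b' ≤ t → θ t = 0) ∧ deriv θ = ρ := by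
  have hasDerivAt_primitive (t : ℝ) : HasDerivAt (fun t => ∫ r in b'..t, ρ r) (ρ t) t :=
    intervalIntegral.integral_hasDerivAt_right (hρ.continuous.intervalIntegrable _ _)
      hρ.continuous.aestronglyMeasurable.stronglyMeasurableAtFilter hρ.continuous.continuousAt
  have hderiv : deriv (fun t => ∫ r in b'..t, ρ r) = ρ :=
    funext fun t => (hasDerivAt_primitive t).deriv
  refine ⟨fun t => ∫ r in b'..t, ρ r, ?_, fun t ht => ?_, hderiv⟩
  · rw [contDiff_infty_iff_deriv, hderiv]
    exact ⟨fun t => (hasDerivAt_primitive t).differentiableAt, hρ⟩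
  · refine intervalIntegral.integral_zero_ae (Eventually.of_forall fun r hr => hb' r ?_)
    rw [uIoc_of_le ht] at hr
    exact hr.1.le

/-- The function `h` of time and space is a weak solution along `u` with zero initial data. -/
structure IsNullSolution (u : ℝ → T2 → (Fin 2 → ℝ)) (h : ℝ × T2 → ℝ) : Prop where
  integrable : Integrable h spaceTime
  weak : ∀ φ, IsTestFunction φ → ∫ p, h p * materialDeriv u φ p.1 p.2 ∂spaceTime = 0

/-- The function `h` of time and space vanishes almost everywhere before time `a`. -/
def VanishesBefore (h : ℝ × T2 → ℝ) (a : ℝ) : Prop := ∀ᵐ p ∂spaceTime, p.1 < a → h p = 0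

lemma vanishesBefore_of_ae_time {h : ℝ × T2 → ℝ} (hh : AEStronglyMeasurable h spaceTime) {a : ℝ}
    (hslice : ∀ᵐ t ∂volume.restrict (Icc (0 : ℝ) 1), t < a → ∀ᵐ x : T2, h (t, x) = 0) :
    VanishesBefore h a := by
  have hmeas : MeasurableSet {p : ℝ × T2 | p.1 < a → hh.mk h p = 0} :=
    (measurableSet_lt measurable_fst measurable_const).imp
      (hh.stronglyMeasurable_mk.measurable (measurableSet_singleton 0))
  have hmk : ∀ᵐ p ∂spaceTime, p.1 < a → hh.mk h p = 0 := by
    refine (Measure.ae_prod_iff_ae_ae hmeas).2 ?_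
    filter_upwards [hslice, Measure.ae_ae_of_ae_prod hh.ae_eq_mk] with t ht hmk
    by_cases hta : t < a
    · filter_upwards [ht hta, hmk] with x hx hxmk _
      rw [← hxmk, hx]
    · exact Eventually.of_forall fun x hx => absurd hx hta
  filter_upwards [hmk, hh.ae_eq_mk] with p hp hpmk hlt
  rw [hpmk, hp hlt]

lemma ae_time_ne (a : ℝ) : ∀ᵐ t ∂volume.restrict (Icc (0 : ℝ) 1), t ≠ a :=
  ae_restrict_of_ae (Measure.ae_ne volume a)

lemma ae_eq_zero_of_forall_integral_mul_mFourier_comp {d : Type*} [Fintype d]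
    {w : UnitAddTorus d → ℝ} (hw : Integrable w volume) {e : UnitAddTorus d ≃ᵐ UnitAddTorus d}
    (he : MeasurePreserving e volume volume)
    (hre : ∀ n, ∫ x, w x * (UnitAddTorus.mFourier n (e x)).re = 0)
    (him : ∀ n, ∫ x, w x * (UnitAddTorus.mFourier n (e x)).im = 0) : w =ᵐ[volume] 0 := by
  have hint (n : d → ℤ) : Integrable (fun x => (w x : ℂ) * UnitAddTorus.mFourier n (e x)) volume :=
    hw.ofReal.mul_bdd ((UnitAddTorus.mFourier n).continuous.measurable.comp
      e.measurable).aestronglyMeasurable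
      (Eventually.of_forall fun x => (UnitAddTorus.mFourier n).norm_coe_le_norm _)
  have hcoeff (n : d → ℤ) : ∫ x, (w x : ℂ) * UnitAddTorus.mFourier n (e x) = 0 := by
    apply Complex.ext
    · rw [← RCLike.re_eq_complex_re, ← integral_re (hint n)]
      simpa using hre n
    · rw [← RCLike.im_eq_complex_im, ← integral_im (hint n)]
      simpa using him n
  have hcomp : (fun x => (w (e.symm x) : ℂ)) =ᵐ[volume] 0 := by
    refine ae_eq_zero_of_forall_integral_mFourier
      (he.symm.integrable_comp_of_integrable hw.ofReal) fun n => ?_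
    rw [← hcoeff n, ← he.symm.integral_comp'
      (g := fun x => (w x : ℂ) * UnitAddTorus.mFourier n (e x))]
    simp
  filter_upwards [he.quasiMeasurePreserving.ae hcomp] with x hx
  simpa using hx

lemma contDiff_mFourier_toT2 (n : Fin 2 → ℤ) :
    ContDiff ℝ ∞ fun y => UnitAddTorus.mFourier n (toT2 y) := by
  have hexp : (fun y => UnitAddTorus.mFourier n (toT2 y)) =
      fun y : Fin 2 → ℝ => ∏ j, Complex.exp (2 * Real.pi * Complex.I * n j * (y j : ℂ)) := by
    funext y
    change ∏ j, fourier (n j) ((y j : ℝ) : UnitAddCircle) = _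
    simp
  rw [hexp]
  exact contDiff_prod fun j _ => (contDiff_const.mul
    (Complex.ofRealCLM.contDiff.comp (contDiff_apply ℝ ℝ j))).cexp

section

variable {i : Fin 2} {L : ℕ} {c σ : ℝ} {θ : ℝ → ℝ} {E : C(T2, ℝ)} {h : ℝ × T2 → ℝ}
  {u : ℝ → T2 → (Fin 2 → ℝ)} {a b b' : ℝ}

lemma IsNullSolution.integral_stripe_eq_zero (hh : IsNullSolution u h) (hσ : σ = 1 ∨ σ = -1)
    (hb1 : b ≤ 1) (hu : ∀ t ∈ Ioo a b, ∀ x, u t x = c • shearField i L x)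
    (ha : VanishesBefore h a) (hθ : ContDiff ℝ ∞ θ) (hb' : b' < b) (hθb : ∀ t, b' ≤ t → θ t = 0)
    (hE : ContDiff ℝ ∞ fun y => E (toT2 y)) (N : ℕ) :
    ∫ p, h p * (deriv θ p.1 * E (shearFlow i L (-(c * p.1)) p.2)) *
      stripeCutoff L σ N (p.2 (1 - i)) ∂spaceTime = 0 := by
  have hφ := isTestFunction_stripeTest (i := i) (L := L) (c := c) (σ := σ) hθ
    (hb'.trans_le hb1) hθb hE N
  rw [← hh.weak _ hφ]
  refine integral_congr_ae ?_
  filter_upwards [ha, ae_spaceTime_of_ae_time (ae_time_ne a), ae_spaceTime_of_ae_time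
    (ae_time_ne b')] with p hp hpa hpb
  rcases lt_or_gt_of_ne hpa with before | after
  · simp [hp before]
  rw [mul_assoc]
  congr 1
  rcases lt_or_gt_of_ne hpb with active | expired
  · rw [materialDeriv_stripeTest hσ hθ (hb'.trans_le hb1) hθb hE N
      (hu p.1 ⟨after, active.trans hb'⟩)]
    ring
  · have hθ0 : θ =ᶠ[𝓝 p.1] fun _ => 0 := by
      filter_upwards [Ioi_mem_nhds expired] with s hs using hθb s (le_of_lt hs)
    rw [hφ.materialDeriv_eq_zero (fun t ht x => by simp [stripeTest, hθb t ht]) u expired,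
      hθ0.deriv_eq]
    simp

lemma integrable_mul_comp_shearFlow (hh : Integrable h spaceTime) :
    Integrable (fun p => h p * E (shearFlow i L (-(c * p.1)) p.2)) spaceTime :=
  hh.mul_bdd (E.continuous.measurable.comp ((measurable_shearFlow_uncurry i L).comp
    ((measurable_const.mul measurable_fst).neg.prodMk measurable_snd))).aestronglyMeasurable
    (Eventually.of_forall fun _ => E.norm_coe_le_norm _)

lemma integrable_time_mul_comp_shearFlow (hh : Integrable h spaceTime) {ρ : ℝ → ℝ}
    (hρ : Continuous ρ) :
    Integrable (fun p => h p * (ρ p.1 * E (shearFlow i L (-(c * p.1)) p.2))) spaceTime := by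
  obtain ⟨C, hC⟩ := (isCompact_Icc (a := (0 : ℝ)) (b := 1)).exists_bound_of_continuousOn
    hρ.continuousOn
  simp only [mul_left_comm (h _)]
  exact (integrable_mul_comp_shearFlow hh).bdd_mul (c := C)
    (hρ.measurable.comp measurable_fst).aestronglyMeasurable
    (ae_spaceTime_mem.mono fun p hp => hC p.1 hp)

lemma IsNullSolution.integral_deriv_mul_shear_eq_zero (hh : IsNullSolution u h) (hL : 1 ≤ L)
    (hb1 : b ≤ 1) (hu : ∀ t ∈ Ioo a b, ∀ x, u t x = c • shearField i L x)
    (ha : VanishesBefore h a) (hθ : ContDiff ℝ ∞ θ) (hb' : b' < b) (hθb : ∀ t, b' ≤ t → θ t = 0)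
    (hE : ContDiff ℝ ∞ fun y => E (toT2 y)) :
    ∫ p, h p * (deriv θ p.1 * E (shearFlow i L (-(c * p.1)) p.2)) ∂spaceTime = 0 := by
  have hG := integrable_time_mul_comp_shearFlow (i := i) (L := L) (c := c) (E := E) hh.integrable
    (hθ.continuous_deriv (by simp))
  have hcut (σ : ℝ) (N : ℕ) : Integrable (fun p =>
      h p * (deriv θ p.1 * E (shearFlow i L (-(c * p.1)) p.2)) *
        stripeCutoff L σ N (p.2 (1 - i))) spaceTime :=
    hG.mul_bdd (((continuous_stripeCutoff N).measurable.comp ((measurable_pi_apply (1 - i)).comp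
      measurable_snd)).aestronglyMeasurable)
      (Eventually.of_forall fun p => norm_stripeCutoff_le_one N _)
  refine tendsto_nhds_unique (tendsto_integral_mul_stripeCutoff_add hL (1 - i) hG)
    (tendsto_const_nhds.congr fun N => ?_)
  simp only [mul_add _ (stripeCutoff L 1 N _)]
  rw [integral_add (hcut 1 N) (hcut (-1) N),
    hh.integral_stripe_eq_zero (Or.inl rfl) hb1 hu ha hθ hb' hθb hE N,
    hh.integral_stripe_eq_zero (Or.inr rfl) hb1 hu ha hθ hb' hθb hE N, add_zero]

lemma IsNullSolution.ae_integral_mul_shear_eq_zero (hh : IsNullSolution u h) (hL : 1 ≤ L)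
    (hb1 : b ≤ 1) (hu : ∀ t ∈ Ioo a b, ∀ x, u t x = c • shearField i L x)
    (ha : VanishesBefore h a) (hE : ContDiff ℝ ∞ fun y => E (toT2 y)) :
    ∀ᵐ t ∂volume.restrict (Icc (0 : ℝ) 1), t ∈ Ioo a b →
      ∫ x, h (t, x) * E (shearFlow i L (-(c * t)) x) = 0 := by
  have hpairing := (integrable_mul_comp_shearFlow (i := i) (L := L) (c := c) (E := E)
    hh.integrable).integral_prod_left
  refine isOpen_Ioo.ae_eq_zero_of_integral_contDiff_smul_eq_zero
    (hpairing.locallyIntegrable.locallyIntegrableOn _) fun ρ hρ hρc hρs => ?_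
  obtain ⟨b', hb', hρb⟩ := exists_lt_forall_ge_eq_zero hρc (hρs.trans Ioo_subset_Iio_self)
  obtain ⟨θ, hθ, hθb, rfl⟩ := exists_contDiff_primitive hρ hρb
  have hzero := hh.integral_deriv_mul_shear_eq_zero hL hb1 hu ha hθ hb' hθb hE
  rw [spaceTime, integral_prod _
    (integrable_time_mul_comp_shearFlow hh.integrable hρ.continuous)] at hzero
  simpa only [smul_eq_mul, ← integral_const_mul, mul_left_comm (h _)] using hzero

lemma VanishesBefore.of_shear (ha : VanishesBefore h a) (hh : IsNullSolution u h) (hL : 1 ≤ L)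
    (hb1 : b ≤ 1) (hu : ∀ t ∈ Ioo a b, ∀ x, u t x = c • shearField i L x) :
    VanishesBefore h b := by
  have hre := ae_all_iff.2 fun n => hh.ae_integral_mul_shear_eq_zero hL hb1 hu ha
    (E := ⟨fun x => (UnitAddTorus.mFourier n x).re,
      Complex.continuous_re.comp (UnitAddTorus.mFourier n).continuous⟩)
    (Complex.reCLM.contDiff.comp (contDiff_mFourier_toT2 n))
  have him := ae_all_iff.2 fun n => hh.ae_integral_mul_shear_eq_zero hL hb1 hu ha
    (E := ⟨fun x => (UnitAddTorus.mFourier n x).im,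
      Complex.continuous_im.comp (UnitAddTorus.mFourier n).continuous⟩)
    (Complex.imCLM.contDiff.comp (contDiff_mFourier_toT2 n))
  refine vanishesBefore_of_ae_time hh.integrable.aestronglyMeasurable ?_
  filter_upwards [hre, him, Measure.ae_ae_of_ae_prod ha, ae_time_ne a, hh.integrable.prod_right_ae]
    with t ht_re ht_im ht_before hta hint htb
  rcases lt_or_gt_of_ne hta with before | after
  · exact ht_before.mono fun x hx => hx before
  · exact ae_eq_zero_of_forall_integral_mul_mFourier_comp hint
      (measurePreserving_shearEquiv i L (-(c * t))) (fun n => ht_re n ⟨after, htb⟩)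
      fun n => ht_im n ⟨after, htb⟩

end

/-! ### Uniqueness of weak solutions along the truncated field -/

lemma VanishesBefore.of_field_eq_zero {u : ℝ → T2 → (Fin 2 → ℝ)} {h : ℝ × T2 → ℝ} {a b : ℝ}
    (ha : VanishesBefore h a) (hh : IsNullSolution u h) (hb1 : b ≤ 1)
    (hu : ∀ t ∈ Ioo a b, u t = 0) : VanishesBefore h b :=
  ha.of_shear (i := 0) (L := 1) (c := 0) hh le_rfl hb1 fun t ht x => by
    rw [hu t ht, zero_smul, Pi.zero_apply]

lemma IsWeakSolution.isNullSolution_sub {u : ℝ → T2 → (Fin 2 → ℝ)}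
    (hu : Measurable fun p : ℝ × T2 => u p.1 p.2) (hu1 : ∀ t x, ‖u t x‖ ≤ 1)
    {f₀ : T2 → ℝ} {f g : ℝ → T2 → ℝ} (hf : IsWeakSolution u f₀ f) (hg : IsWeakSolution u f₀ g) :
    IsNullSolution u fun p => f p.1 p.2 - g p.1 p.2 := by
  refine ⟨hf.integrable.sub hg.integrable, fun φ hφ => ?_⟩
  obtain ⟨C, hC⟩ := hφ.exists_bound
  have hbound : ∀ᵐ p ∂spaceTime, ‖materialDeriv u φ p.1 p.2‖ ≤ C :=
    ae_spaceTime_mem.mono fun p hp => hC _ _ _ hp (hu1 _ _)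
  have hmeas := (hφ.measurable_materialDeriv hu).aestronglyMeasurable (μ := spaceTime)
  simp only [sub_mul]
  rw [integral_sub (hf.integrable.mul_bdd hmeas hbound) (hg.integrable.mul_bdd hmeas hbound)]
  exact sub_eq_zero.2 ((hf.weak φ hφ).trans (hg.weak φ hφ).symm)

section

variable {i : ℕ → Fin 2} {L : ℕ → ℕ} {τ : ℕ → ℝ} {K : ℕ} {h : ℝ × T2 → ℝ}

lemma VanishesBefore.of_slot {p : ℕ × ℕ} (ha : VanishesBefore h (startTime p))
    (hh : IsNullSolution (truncatedField i L τ K) h) (hfin : FinitenessCondition τ)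
    (hp : p ∈ dyadicUpTo K) (hL : 1 ≤ L p.1) (hτ : 0 < τ p.1)
    (hp1 : startTime p + slotLen p.1 ≤ 1) :
    VanishesBefore h (startTime p + slotLen p.1) := by
  have hlt : τ p.1 < slotLen p.1 := hfin p.1 hp.1.1
  have hshear : VanishesBefore h (startTime p + τ p.1) :=
    ha.of_shear (c := 1) hh hL (by linarith) fun t ht x => by
      rw [one_smul]
      exact congrFun (fractalField_of_mem hfin (dyadicUpTo_subset K) hp ⟨ht.1.le, ht.2.le⟩) x
  exact hshear.of_field_eq_zero hh hp1 fun t ht =>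
    fractalField_of_mem_gap hfin (dyadicUpTo_subset K) hp.1 ht.1 ⟨by linarith [ht.1], ht.2⟩

lemma VanishesBefore.of_block (hh : IsNullSolution (truncatedField i L τ K) h)
    (hfin : FinitenessCondition τ) (hL : ∀ k, 1 ≤ k → 1 ≤ L k) (hτ : ∀ k, 1 ≤ k → 0 < τ k)
    (n k m : ℕ) (hK : n + k = K) (hm : m < 2 ^ k) (ha : VanishesBefore h (blockStart k m)) :
    VanishesBefore h (blockStart k m + slotLen k) := by
  induction n generalizing k m with
  | zero =>
    obtain rfl : k = K := by omega
    exact ha.of_field_eq_zero hh (blockStart_add_le_one hm)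
      fun t ht => truncatedField_of_mem_block hfin hm ht
  | succ n ih =>
    have hend := blockStart_add_le_one hm
    have hpos := slotLen_pos (k + 1)
    have hquarter : slotLen k = 4 * slotLen (k + 1) := by rw [slotLen_succ]; ring
    have firstSlot : VanishesBefore h (blockStart (k + 1) (2 * m)) := by
      rw [blockStart_left hm]
      exact VanishesBefore.of_slot ha hh hfin ⟨mem_dyadic_left hm, by simp only; omega⟩
        (hL _ k.succ_pos) (hτ _ k.succ_pos)
        (show blockStart k m + slotLen (k + 1) ≤ 1 by linarith)
    have firstBlock : VanishesBefore h (startTime (k + 1, 2 * m + 1)) := by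
      convert ih (k + 1) (2 * m) (by omega) (by rw [pow_succ]; omega) firstSlot using 1
      rw [blockStart_left hm, startTime_right_eq hm]
      ring
    have secondSlot : VanishesBefore h (blockStart (k + 1) (2 * m + 1)) := by
      convert firstBlock.of_slot hh hfin ⟨mem_dyadic_right hm, by simp only; omega⟩
        (hL _ k.succ_pos) (hτ _ k.succ_pos) (by rw [startTime_right_eq hm]; simp only; linarith)
        using 1
      rw [blockStart_right hm, startTime_right_eq hm]
      ring
    convert ih (k + 1) (2 * m + 1) (by omega) (by rw [pow_succ]; omega) secondSlot using 1
    rw [blockStart_right hm, hquarter]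
    ring

theorem IsWeakSolution.ae_eq_of_truncatedField (hfin : FinitenessCondition τ)
    (hL : ∀ k, 1 ≤ k → 1 ≤ L k) (hτ : ∀ k, 1 ≤ k → 0 < τ k) {f₀ : T2 → ℝ} {f g : ℝ → T2 → ℝ}
    (hf : IsWeakSolution (truncatedField i L τ K) f₀ f)
    (hg : IsWeakSolution (truncatedField i L τ K) f₀ g) :
    Function.uncurry f =ᵐ[spaceTime] Function.uncurry g := by
  have hnull := hf.isNullSolution_sub (measurable_fractalField hfin (dyadicUpTo_subset K))
    (norm_fractalField_le _) hg
  have hstart : VanishesBefore (fun p => f p.1 p.2 - g p.1 p.2) (blockStart 0 0) := by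
    filter_upwards [ae_spaceTime_mem] with p hp hlt
    rw [blockStart_zero] at hlt
    exact absurd hp.1 hlt.not_ge
  have hend := hstart.of_block hnull hfin hL hτ K 0 0 (by simp) (by simp)
  rw [blockStart_zero, slotLen_zero, zero_add] at hend
  filter_upwards [hend, ae_spaceTime_mem, ae_spaceTime_of_ae_time (ae_time_ne 1)] with p hp hp1 hne
  exact sub_eq_zero.1 (hp (lt_of_le_of_ne hp1.2 hne))

end

/-! ### Cancellation -/

lemma shearSign_add_mul_of_odd {L : ℕ} {c σ : ℝ} {n : ℤ} (hn : Odd n) (hc : 2 * (L : ℝ) * c = n)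
    (hσ : σ = 1 ∨ σ = -1) (z : UnitAddCircle) :
    shearSign L (z + ((c * σ : ℝ) : UnitAddCircle)) = -shearSign L z := by
  rcases hσ with rfl | rfl
  · exact shearSign_add_of_odd hn (by rw [mul_one, hc]) z
  · exact shearSign_add_of_odd hn.neg (by rw [mul_neg_one, mul_neg, hc, Int.cast_neg]) z

lemma shearFlow_perp_involutive {i : Fin 2} {L₁ L₂ : ℕ} {s t : ℝ} {m n : ℤ} (hm : Odd m)
    (hn : Odd n) (hs : 2 * (L₂ : ℝ) * s = m) (ht : 2 * (L₁ : ℝ) * t = n) :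
    Function.Involutive fun x => shearFlow (1 - i) L₂ t (shearFlow i L₁ s x) := by
  intro x
  set A := shearFlow i L₁ s
  set B := shearFlow (1 - i) L₂ t
  have A_self (y) : A y i = y i + ((s * shearSign L₁ (y (1 - i)) : ℝ) : UnitAddCircle) :=
    shearFlow_apply_self i L₁ s y
  have A_perp (y) : A y (1 - i) = y (1 - i) := shearFlow_apply_one_sub i L₁ s y
  have B_perp (y) : B y i = y i := by
    simpa only [sub_sub_cancel] using shearFlow_apply_one_sub (1 - i) L₂ t y
  have B_self (y) : B y (1 - i) = y (1 - i) + ((t * shearSign L₂ (y i) : ℝ) : UnitAddCircle) := by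
    simpa only [sub_sub_cancel] using shearFlow_apply_self (1 - i) L₂ t y
  have sign_A (y) : shearSign L₂ (A y i) = -shearSign L₂ (y i) :=
    A_self y ▸ shearSign_add_mul_of_odd hm hs (shearSign_eq_one_or_neg_one _ _) _
  have sign_B (y) : shearSign L₁ (B y (1 - i)) = -shearSign L₁ (y (1 - i)) :=
    B_self y ▸ shearSign_add_mul_of_odd hn ht (shearSign_eq_one_or_neg_one _ _) _
  funext j
  rcases eq_or_eq_one_sub i j with rfl | rfl
  · simp only [B_perp, A_self, sign_B, A_perp]
    rw [add_assoc, ← AddCircle.coe_add, mul_neg, add_neg_cancel, AddCircle.coe_zero, add_zero]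
  · simp only [B_self, A_perp, sign_A, B_perp]
    rw [add_assoc, ← AddCircle.coe_add, mul_neg, mul_neg, mul_neg, neg_neg,
      neg_add_cancel, AddCircle.coe_zero, add_zero]

/-! ### Unresolved times -/

/-- The times in the interior of a block of level `n`: at these times, the levels after `n` of the
fractal are still under way. -/
def unresolved (n : ℕ) : Set ℝ :=
  {t | ∃ m < 2 ^ n, t ∈ Ioo (blockStart n m) (blockStart n m + slotLen n)}

lemma unresolved_eq_iUnion (n : ℕ) : unresolved n =
    ⋃ m ∈ Finset.range (2 ^ n), Ioo (blockStart n m) (blockStart n m + slotLen n) := by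
  ext t
  simp only [unresolved, mem_ofPred_eq, mem_iUnion, Finset.mem_range, exists_prop]

lemma measurableSet_unresolved (n : ℕ) : MeasurableSet (unresolved n) := by
  rw [unresolved_eq_iUnion]
  exact Finset.measurableSet_biUnion _ fun _ _ => measurableSet_Ioo

lemma antitone_unresolved : Antitone unresolved := by
  refine antitone_nat_of_succ_le fun n => ?_
  rintro t ⟨m, hm, htm⟩
  have hlen := slotLen_succ n
  have hpos := slotLen_pos (n + 1)
  have hm' : m / 2 < 2 ^ n := by rw [pow_succ] at hm; omega
  refine ⟨m / 2, hm', ?_⟩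
  rcases m.even_or_odd' with ⟨l, rfl | rfl⟩
  · rw [Nat.mul_div_cancel_left l two_pos] at hm' ⊢
    rw [blockStart_left hm'] at htm
    exact ⟨by linarith [htm.1], by linarith [htm.2]⟩
  · rw [show (2 * l + 1) / 2 = l by omega] at hm' ⊢
    rw [blockStart_right hm'] at htm
    exact ⟨by linarith [htm.1], by linarith [htm.2]⟩

lemma volume_unresolved_le (n : ℕ) : volume (unresolved n) ≤ ENNReal.ofReal ((1 / 2) ^ n) := by
  rw [unresolved_eq_iUnion]
  refine (measure_biUnion_finset_le _ _).trans_eq ?_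
  simp only [Real.volume_Ioo, add_sub_cancel_left, Finset.sum_const, Finset.card_range]
  rw [← ENNReal.ofReal_nsmul, nsmul_eq_mul, Nat.cast_pow, Nat.cast_ofNat, two_pow_mul_slotLen]

lemma tendsto_volume_unresolved : Tendsto (fun n => volume (unresolved n)) atTop (𝓝 0) := by
  have hpow := ENNReal.tendsto_ofReal (tendsto_pow_atTop_nhds_zero_of_lt_one
    (by norm_num : (0 : ℝ) ≤ 1 / 2) (by norm_num))
  rw [ENNReal.ofReal_zero] at hpow
  exact tendsto_of_tendsto_of_tendsto_of_le_of_le tendsto_const_nhds hpow (fun _ => zero_le)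
    volume_unresolved_le

lemma notMem_unresolved_of_mem_slot {n : ℕ} {q : ℕ × ℕ} (hq : q ∈ dyadic) (hqn : q.1 ≤ n) {t : ℝ}
    (ht : t ∈ Icc (startTime q) (startTime q + slotLen q.1)) : t ∉ unresolved n := by
  rintro ⟨m, hm, htm⟩
  rcases slot_block_disjoint hm hq hqn with h | h
  · linarith [ht.2, htm.1]
  · linarith [ht.1, htm.2]

lemma one_notMem_unresolved (n : ℕ) : (1 : ℝ) ∉ unresolved n := by
  rintro ⟨m, hm, hone⟩
  linarith [blockStart_add_le_one hm, hone.2]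

lemma exists_blockStart_eq_one_sub (n : ℕ) : ∃ m < 2 ^ n, blockStart n m = 1 - slotLen n := by
  induction n with
  | zero => exact ⟨0, by simp, by rw [blockStart_zero, slotLen_zero, sub_self]⟩
  | succ n ih =>
    obtain ⟨m, hm, hstart⟩ := ih
    refine ⟨2 * m + 1, by rw [pow_succ]; omega, ?_⟩
    rw [blockStart_right hm, hstart, slotLen_succ]
    ring

lemma one_sub_slotLen_notMem_unresolved (n : ℕ) : 1 - slotLen n ∉ unresolved n := by
  obtain ⟨m, hm, hstart⟩ := exists_blockStart_eq_one_sub n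
  rw [← hstart]
  rcases n with _ | n
  · obtain rfl : m = 0 := by simpa using hm
    rintro ⟨l, hl, htl⟩
    obtain rfl : l = 0 := by simpa using hl
    exact lt_irrefl _ htl.1
  · have hmem : (n + 1, m) ∈ dyadic := ⟨Nat.le_add_left _ _, hm⟩
    refine notMem_unresolved_of_mem_slot hmem le_rfl ?_
    rw [blockStart, startTime_left hmem]
    exact ⟨by linarith [slotLen_pos (n + 1)], le_rfl⟩

/-! ### Stabilisation of the truncated flows -/

section Stabilisation

variable {i : ℕ → Fin 2} {L : ℕ → ℕ} {τ : ℕ → ℝ}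

lemma blockFlow_of_le (n k : ℕ) {a t : ℝ} (h : t ≤ a) :
    blockFlow i L τ n k a t = MeasurableEquiv.refl T2 := by
  induction n generalizing k a with
  | zero => rfl
  | succ n ih =>
    have hpos := slotLen_pos (k + 1)
    rw [blockFlow, elapsed_of_le h, elapsed_of_le (by linarith), ih _ (by linarith),
      ih _ (by linarith), shearEquiv_zero]
    rfl

lemma blockFlow_succ_apply (n k : ℕ) (a t : ℝ) (x : T2) : blockFlow i L τ (n + 1) k a t x =
    blockFlow i L τ n (k + 1) (a + 3 * slotLen (k + 1)) t
      (shearFlow (i (k + 1)) (L (k + 1)) (elapsed (τ (k + 1)) (a + 2 * slotLen (k + 1)) t)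
        (blockFlow i L τ n (k + 1) (a + slotLen (k + 1)) t
          (shearFlow (i (k + 1)) (L (k + 1)) (elapsed (τ (k + 1)) a t) x))) := rfl

lemma elapsed_slot_of_ge (hτ : ∀ k, 1 ≤ k → 0 < τ k) (hfin : FinitenessCondition τ) (k : ℕ)
    {a t : ℝ} (h : a + slotLen (k + 1) ≤ t) : elapsed (τ (k + 1)) a t = τ (k + 1) := by
  have hlt : τ (k + 1) < slotLen (k + 1) := hfin (k + 1) (Nat.le_add_left _ _)
  exact elapsed_of_ge (hτ _ (Nat.le_add_left _ _)).le (by linarith)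

lemma blockFlow_one_apply_of_ge (hτ : ∀ k, 1 ≤ k → 0 < τ k) (hfin : FinitenessCondition τ) (k : ℕ)
    {a t : ℝ} (ht : a + slotLen k ≤ t) (x : T2) :
    blockFlow i L τ 1 k a t x = shearFlow (i (k + 1)) (L (k + 1)) (2 * τ (k + 1)) x := by
  have hlen := slotLen_succ k
  have hpos := slotLen_pos (k + 1)
  rw [blockFlow_succ_apply, elapsed_slot_of_ge hτ hfin k (by linarith),
    elapsed_slot_of_ge hτ hfin k (by linarith), two_mul, ← shearFlow_shearFlow]
  rfl

lemma blockFlow_two_apply_of_ge (hτ : ∀ k, 1 ≤ k → 0 < τ k) (hfin : FinitenessCondition τ)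
    (hcan : CancellationConditions i L τ) (k : ℕ) {a t : ℝ} (ht : a + slotLen k ≤ t) (x : T2) :
    blockFlow i L τ 2 k a t x = x := by
  have hlen := slotLen_succ k
  have hpos := slotLen_pos (k + 1)
  obtain ⟨hi, hdouble, n, hn, hodd⟩ := hcan (k + 1) (Nat.le_add_left _ _)
  have hshift : 2 * (L (k + 1) : ℝ) * (2 * τ (k + 1 + 1)) = (1 : ℤ) := by
    have hne : (L (k + 1) : ℝ) ≠ 0 := fun h => by
      rw [h, mul_zero, div_zero] at hdouble
      linarith [hτ (k + 1 + 1) (Nat.le_add_left _ _)]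
    rw [hdouble, Int.cast_one]
    field_simp
  rw [blockFlow_succ_apply, elapsed_slot_of_ge hτ hfin k (by linarith),
    elapsed_slot_of_ge hτ hfin k (by linarith),
    blockFlow_one_apply_of_ge hτ hfin _ (by linarith),
    blockFlow_one_apply_of_ge hτ hfin _ (by linarith), eq_one_sub_of_ne hi]
  exact shearFlow_perp_involutive hn odd_one hodd hshift x

lemma blockFlow_add_two (hτ : ∀ k, 1 ≤ k → 0 < τ k) (hfin : FinitenessCondition τ)
    (hcan : CancellationConditions i L τ) (n k m : ℕ) (hm : m < 2 ^ k) {t : ℝ}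
    (ht : t ∉ unresolved (n + k)) :
    blockFlow i L τ (n + 2) k (blockStart k m) t = blockFlow i L τ n k (blockStart k m) t := by
  induction n generalizing k m with
  | zero =>
    rw [Nat.zero_add] at ht
    rcases le_or_gt t (blockStart k m) with hle | hlt
    · rw [blockFlow_of_le _ _ hle, blockFlow_of_le _ _ hle]
    · have hge := not_lt.1 fun h => ht ⟨m, hm, hlt, h⟩
      ext x : 2
      exact blockFlow_two_apply_of_ge hτ hfin hcan k hge x
  | succ n ih =>
    rw [show n + 1 + k = n + (k + 1) by ring] at ht
    rw [blockFlow, ← blockStart_left hm, ← blockStart_right hm,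
      ih (k + 1) (2 * m) (by rw [pow_succ]; omega) ht,
      ih (k + 1) (2 * m + 1) (by rw [pow_succ]; omega) ht]
    rw [blockFlow, blockStart_left hm, blockStart_right hm]

lemma truncatedFlow_add_two_mul (hτ : ∀ k, 1 ≤ k → 0 < τ k) (hfin : FinitenessCondition τ)
    (hcan : CancellationConditions i L τ) {K : ℕ} {t : ℝ} (ht : t ∉ unresolved K) (j : ℕ) :
    truncatedFlow i L τ (K + 2 * j) t = truncatedFlow i L τ K t := by
  induction j with
  | zero => rfl
  | succ j ih =>
    have hres : t ∉ unresolved (K + 2 * j + 0) :=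
      fun h => ht (antitone_unresolved (Nat.le_add_right K (2 * j)) h)
    have hstep := blockFlow_add_two (i := i) (L := L) hτ hfin hcan (K + 2 * j) 0 0 (by simp) hres
    rw [blockStart_zero] at hstep
    exact hstep.trans ih

/-! ### The last block -/

lemma blockFlow_of_ge (hτ : ∀ k, 1 ≤ k → 0 < τ k) (hfin : FinitenessCondition τ) (n k : ℕ)
    {a s t : ℝ} (hs : a + slotLen k ≤ s) (ht : a + slotLen k ≤ t) :
    blockFlow i L τ n k a s = blockFlow i L τ n k a t := by
  induction n generalizing k a with
  | zero => rfl
  | succ n ih =>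
    have hlen := slotLen_succ k
    have hpos := slotLen_pos (k + 1)
    simp only [blockFlow]
    rw [elapsed_slot_of_ge hτ hfin k (by linarith), elapsed_slot_of_ge hτ hfin k (by linarith),
      elapsed_slot_of_ge hτ hfin k (by linarith), elapsed_slot_of_ge hτ hfin k (by linarith),
      ih (k + 1) (a := a + slotLen (k + 1)) (by linarith) (by linarith),
      ih (k + 1) (a := a + 3 * slotLen (k + 1)) (by linarith) (by linarith)]

lemma blockFlow_succ_apply_of_ge (hτ : ∀ k, 1 ≤ k → 0 < τ k) (hfin : FinitenessCondition τ)
    (n k : ℕ) {a t : ℝ} (ht : a + 3 * slotLen (k + 1) ≤ t) (x : T2) :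
    blockFlow i L τ (n + 1) k a t x =
      blockFlow i L τ n (k + 1) (a + 3 * slotLen (k + 1)) t
        (blockFlow i L τ (n + 1) k a (a + 3 * slotLen (k + 1)) x) := by
  have hpos := slotLen_pos (k + 1)
  rw [blockFlow_succ_apply, blockFlow_succ_apply n k a (a + _),
    blockFlow_of_le n (k + 1) (le_refl (a + 3 * slotLen (k + 1)))]
  simp only [MeasurableEquiv.refl_apply]
  rw [elapsed_slot_of_ge hτ hfin k (by linarith), elapsed_slot_of_ge hτ hfin k (by linarith),
    elapsed_slot_of_ge hτ hfin k (by linarith), elapsed_slot_of_ge hτ hfin k (by linarith),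
    blockFlow_of_ge hτ hfin n (k + 1) (a := a + slotLen (k + 1))
      (t := a + 3 * slotLen (k + 1)) (by linarith) (by linarith)]

lemma blockFlow_add_apply_of_ge (hτ : ∀ k, 1 ≤ k → 0 < τ k) (hfin : FinitenessCondition τ)
    (n j k : ℕ) {a s t : ℝ} (hs : s = a + slotLen k - slotLen (k + n)) (hst : s ≤ t) (x : T2) :
    blockFlow i L τ (n + j) k a t x =
      blockFlow i L τ j (k + n) s t (blockFlow i L τ (n + j) k a s x) := by
  induction n generalizing k a x with
  | zero =>
    obtain rfl : s = a := by simpa using hs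
    simp only [Nat.zero_add, Nat.add_zero, blockFlow_of_le j k le_rfl, MeasurableEquiv.refl_apply]
  | succ n ih =>
    have hlevel : k + (n + 1) = k + 1 + n := by ring
    have hlen := slotLen_succ k
    have hle : slotLen (k + 1 + n) ≤ slotLen (k + 1) := by
      rw [slotLen_eq, slotLen_eq]
      exact pow_le_pow_of_le_one (by norm_num) (by norm_num) (Nat.le_add_right _ _)
    rw [hlevel] at hs ⊢
    rw [Nat.add_right_comm, blockFlow_succ_apply_of_ge hτ hfin (n + j) k (t := t) (by linarith),
      blockFlow_succ_apply_of_ge hτ hfin (n + j) k (t := s) (by linarith)]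
    exact ih (k + 1) (by linarith) _

lemma truncatedFlow_one_apply (hτ : ∀ k, 1 ≤ k → 0 < τ k) (hfin : FinitenessCondition τ) (K : ℕ)
    (x : T2) : truncatedFlow i L τ K 1 x = truncatedFlow i L τ K (1 - slotLen K) x :=
  blockFlow_add_apply_of_ge hτ hfin K 0 0 (by rw [slotLen_zero, Nat.zero_add, zero_add])
    (by linarith [slotLen_pos K]) x

lemma truncatedFlow_succ_one_apply (hτ : ∀ k, 1 ≤ k → 0 < τ k) (hfin : FinitenessCondition τ)
    (K : ℕ) (x : T2) :
    truncatedFlow i L τ (K + 1) 1 x = shearFlow (i (K + 1)) (L (K + 1)) (2 * τ (K + 1))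
      (truncatedFlow i L τ (K + 1) (1 - slotLen K) x) := by
  rw [truncatedFlow, blockFlow_add_apply_of_ge hτ hfin K 1 0 (s := 1 - slotLen K)
    (by rw [slotLen_zero, Nat.zero_add, zero_add]) (by linarith [slotLen_pos K]), Nat.zero_add,
    blockFlow_one_apply_of_ge hτ hfin K (by linarith)]
  rfl

end Stabilisation

/-! ### Limits of stabilising flows -/

/-- The density is the conditional expectation of `g` given `Y`, as a function of the value
of `Y`. -/
lemma exists_bounded_density {X Z : Type*} [MeasurableSpace X] [mZ : MeasurableSpace Z]
    {μ : Measure X} [IsFiniteMeasure μ] {ν : Measure Z} {Y : X → Z}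
    (hY : MeasurePreserving Y μ ν) {g : X → ℝ} (hg : Measurable g) {M : NNReal}
    (hM : ∀ x, |g x| ≤ M) :
    ∃ h : Z → ℝ, Measurable h ∧ (∀ z, |h z| ≤ M) ∧
      ∀ ψ : Z → ℝ, Measurable ψ → Integrable ψ ν → ∫ z, h z * ψ z ∂ν = ∫ x, g x * ψ (Y x) ∂μ := by
  obtain ⟨h, hmeas, hcond⟩ := (stronglyMeasurable_condExp
    (m := mZ.comap Y) (μ := μ) (f := g)).measurable.exists_eq_measurable_comp
  have hbound : ∀ᵐ x ∂μ, |h (Y x)| ≤ M := by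
    filter_upwards [ae_bdd_abs_condExp_of_ae_bdd_abs (m := mZ.comap Y)
      (Eventually.of_forall hM)] with x hx
    rwa [hcond] at hx
  refine ⟨fun z => max (-M : ℝ) (min (h z) M), measurable_const.max (hmeas.min measurable_const),
    fun z => abs_le.2 ⟨le_max_left _ _, max_le (neg_le_self M.2) (min_le_right _ _)⟩,
    fun ψ hψ hψi => ?_⟩
  have hψY : Integrable (fun x => ψ (Y x)) μ := hY.integrable_comp_of_integrable hψi
  calc ∫ z, max (-M : ℝ) (min (h z) M) * ψ z ∂ν
      = ∫ x, max (-M : ℝ) (min (h (Y x)) M) * ψ (Y x) ∂μ := by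
        rw [← hY.map_eq, integral_map hY.measurable.aemeasurable]
        exact ((measurable_const.max (hmeas.min measurable_const)).mul hψ).aestronglyMeasurable
    _ = ∫ x, (μ[g|mZ.comap Y] x) * ψ (Y x) ∂μ := by
        refine integral_congr_ae (hbound.mono fun x hx => ?_)
        rw [abs_le] at hx
        simp only [hcond, Function.comp_apply, min_eq_left hx.2, max_eq_right hx.1]
    _ = ∫ x, (μ[fun x => g x * ψ (Y x)|mZ.comap Y] x) ∂μ := by
        refine integral_congr_ae (condExp_mul_of_stronglyMeasurable_right ?_ ?_ ?_).symm
        · exact (hψ.comp (comap_measurable Y)).stronglyMeasurable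
        · exact hψY.bdd_mul hg.aestronglyMeasurable (Eventually.of_forall hM)
        · exact Integrable.of_bound hg.aestronglyMeasurable M (Eventually.of_forall hM)
    _ = ∫ x, g x * ψ (Y x) ∂μ := integral_condExp hY.measurable.comap_le

lemma dist_toT2_le (x y : Fin 2 → ℝ) : dist (toT2 x) (toT2 y) ≤ ‖x - y‖ := by
  refine (dist_pi_le_iff (norm_nonneg _)).2 fun j => ?_
  rw [dist_eq_norm]
  exact QuotientAddGroup.norm_mk_le_norm.trans (norm_le_pi_norm (x - y) j)

lemma IsFlowAlong.dist_le {u : ℝ → T2 → (Fin 2 → ℝ)} {A : ℝ → T2 ≃ᵐ T2} (hA : IsFlowAlong u A)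
    (s t : ℝ) (x : T2) : dist (A s x) (A t x) ≤ |s - t| := by
  obtain ⟨z, rfl⟩ := toT2_surjective x
  obtain ⟨γ, hγ, -, hγA⟩ := hA.flowOn z
  rw [← hγA, ← hγA]
  exact (dist_toT2_le _ _).trans (hγ.norm_sub_le s t)

lemma exists_notMem_abs_sub_le {S : Set ℝ} {ε : ℝ} (hS : volume S < ENNReal.ofReal ε)
    (t : ℝ) : ∃ s ∉ S, |t - s| ≤ ε := by
  by_contra! h
  have hsub : Icc t (t + ε) ⊆ S := fun s hs => by
    by_contra hsS
    have hlt := h s hsS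
    rw [abs_sub_comm, abs_of_nonneg (by linarith [hs.1])] at hlt
    linarith [hs.2]
  refine (measure_mono (μ := volume) hsub).not_gt ?_
  rwa [Real.volume_Icc, add_sub_cancel_left]

/-- A sequence of flows `A j` along fields `u j`, such that, at any time outside the set `U j`, the
flow `A j` agrees with all later ones. -/
structure IsStabilising (u : ℕ → ℝ → T2 → (Fin 2 → ℝ)) (A : ℕ → ℝ → T2 ≃ᵐ T2)
    (U : ℕ → Set ℝ) : Prop where
  isFlowAlong : ∀ j, IsFlowAlong (u j) (A j)
  measurableSet : ∀ j, MeasurableSet (U j)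
  antitone : Antitone U
  tendsto_volume : Tendsto (fun j => volume (U j)) atTop (𝓝 0)
  eq_of_notMem : ∀ ⦃j l⦄, j ≤ l → ∀ ⦃t⦄, t ∉ U j → A l t = A j t

/-- The pointwise limit of a sequence of flows. -/
def limitFlow (A : ℕ → ℝ → T2 ≃ᵐ T2) (t : ℝ) (x : T2) : T2 :=
  limUnder atTop fun j => A j t x

namespace IsStabilising

variable {u : ℕ → ℝ → T2 → (Fin 2 → ℝ)} {A : ℕ → ℝ → T2 ≃ᵐ T2} {U : ℕ → Set ℝ}

lemma cauchySeq (h : IsStabilising u A U) (t : ℝ) (x : T2) : CauchySeq fun j => A j t x := by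
  refine Metric.cauchySeq_iff'.2 fun ε hε => ?_
  obtain ⟨N, hN⟩ := (h.tendsto_volume.eventually_lt_const
    (ENNReal.ofReal_pos.2 (by linarith : 0 < ε / 3))).exists
  obtain ⟨s, hs, hst⟩ := exists_notMem_abs_sub_le hN t
  refine ⟨N, fun n hn => ?_⟩
  have hn_dist := (h.isFlowAlong n).dist_le t s x
  have hN_dist := (h.isFlowAlong N).dist_le s t x
  rw [h.eq_of_notMem hn hs] at hn_dist
  rw [abs_sub_comm] at hN_dist
  linarith [dist_triangle (A n t x) (A N s x) (A N t x)]

lemma tendsto_limitFlow (h : IsStabilising u A U) (t : ℝ) (x : T2) :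
    Tendsto (fun j => A j t x) atTop (𝓝 (limitFlow A t x)) :=
  (h.cauchySeq t x).tendsto_limUnder

lemma continuous_limitFlow_time (h : IsStabilising u A U) (x : T2) :
    Continuous fun t => limitFlow A t x := by
  refine (LipschitzWith.of_dist_le_mul (K := 1) fun s t => ?_).continuous
  rw [NNReal.coe_one, one_mul, Real.dist_eq]
  exact le_of_tendsto ((h.tendsto_limitFlow s x).dist (h.tendsto_limitFlow t x))
    (Eventually.of_forall fun j => (h.isFlowAlong j).dist_le s t x)

lemma measurePreserving_limitFlow (h : IsStabilising u A U) (t : ℝ) :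
    MeasurePreserving (limitFlow A t) volume volume := by
  have hmeas : Measurable (limitFlow A t) :=
    measurable_of_tendsto_metrizable (fun j => (A j t).measurable)
      (tendsto_pi_nhds.2 (h.tendsto_limitFlow t))
  have := Measure.isProbabilityMeasure_map (μ := volume) hmeas.aemeasurable
  refine ⟨hmeas, ext_of_forall_integral_eq_of_IsFiniteMeasure fun ψ => ?_⟩
  rw [integral_map hmeas.aemeasurable ψ.continuous.measurable.aestronglyMeasurable]
  have hlim : Tendsto (fun j => ∫ x, ψ (A j t x)) atTop (𝓝 (∫ x, ψ (limitFlow A t x))) :=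
    tendsto_integral_of_dominated_convergence (fun _ => ‖ψ‖)
      (fun j => (ψ.continuous.measurable.comp (A j t).measurable).aestronglyMeasurable)
      (integrable_const _) (fun j => Eventually.of_forall fun x => ψ.norm_coe_le_norm _)
      (Eventually.of_forall fun x => (ψ.continuous.tendsto _).comp (h.tendsto_limitFlow t x))
  have hconst (j : ℕ) : ∫ x, ψ (A j t x) = ∫ x, ψ x :=
    ((h.isFlowAlong j).measurePreserving t).integral_comp' ψ
  simp only [hconst] at hlim
  exact tendsto_nhds_unique hlim tendsto_const_nhds

lemma limitFlow_eq_of_notMem (h : IsStabilising u A U) {j : ℕ} {t : ℝ} (ht : t ∉ U j) (x : T2) :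
    limitFlow A t x = A j t x := by
  refine tendsto_nhds_unique (h.tendsto_limitFlow t x) (tendsto_const_nhds.congr' ?_)
  filter_upwards [eventually_ge_atTop j] with l hl
  rw [h.eq_of_notMem hl ht]

lemma ae_exists_notMem (h : IsStabilising u A U) : ∀ᵐ t : ℝ, ∃ j, t ∉ U j := by
  rw [ae_iff]
  push Not
  exact le_antisymm (ge_of_tendsto h.tendsto_volume
    (Eventually.of_forall fun j => measure_mono fun t ht => ht j)) zero_le

end IsStabilising

/-- `f t` is `g` transported by the flow `A j` at the times `t` at which the flows have stabilised,
and the density of the image of `g` under the limit flow at all times. -/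
structure IsLimitTransport (A : ℕ → ℝ → T2 ≃ᵐ T2) (U : ℕ → Set ℝ) (g : T2 → ℝ) (M : ℝ)
    (f : ℝ → T2 → ℝ) : Prop where
  bound : ∀ t x, |f t x| ≤ M
  measurable : ∀ t, Measurable (f t)
  eq_of_notMem : ∀ ⦃j t⦄, t ∉ U j → f t = transport (A j) g t
  integral : ∀ t (ψ : C(T2, ℝ)), ∫ x, f t x * ψ x = ∫ x, g x * ψ (limitFlow A t x)

section

variable {u : ℕ → ℝ → T2 → (Fin 2 → ℝ)} {A : ℕ → ℝ → T2 ≃ᵐ T2} {U : ℕ → Set ℝ}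
  {g : T2 → ℝ} {M : ℝ} {f : ℝ → T2 → ℝ}

lemma IsStabilising.integral_transport_mul (h : IsStabilising u A U) {j : ℕ} {t : ℝ}
    (ht : t ∉ U j) (ψ : T2 → ℝ) :
    ∫ x, transport (A j) g t x * ψ x = ∫ x, g x * ψ (limitFlow A t x) := by
  rw [← ((h.isFlowAlong j).measurePreserving t).integral_comp'
    (fun x => transport (A j) g t x * ψ x)]
  simp only [transport, MeasurableEquiv.symm_apply_apply, h.limitFlow_eq_of_notMem ht]

lemma IsStabilising.exists_isLimitTransport (h : IsStabilising u A U) (hg : Measurable g)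
    (hM : ∀ x, |g x| ≤ M) : ∃ f, IsLimitTransport A U g M f := by
  have exists_slice (t : ℝ) : ∃ F : T2 → ℝ, (∀ x, |F x| ≤ M) ∧ Measurable F ∧
      (∀ j, t ∉ U j → F = transport (A j) g t) ∧
      ∀ ψ : C(T2, ℝ), ∫ x, F x * ψ x = ∫ x, g x * ψ (limitFlow A t x) := by
    by_cases ht : ∃ j, t ∉ U j
    · obtain ⟨j, hj⟩ := ht
      refine ⟨transport (A j) g t, fun x => hM _, hg.comp (A j t).symm.measurable, fun l hl => ?_,
        fun ψ => h.integral_transport_mul hj ψ⟩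
      have hAeq : A j t = A l t := by
        ext x : 2
        rw [← h.limitFlow_eq_of_notMem hj x, h.limitFlow_eq_of_notMem hl x]
      funext x
      rw [transport, transport, hAeq]
    · lift M to NNReal using (abs_nonneg _).trans (hM 0)
      obtain ⟨F, hF, hFM, hint⟩ := exists_bounded_density (h.measurePreserving_limitFlow t) hg hM
      exact ⟨F, hFM, hF, fun j hj => absurd ⟨j, hj⟩ ht, fun ψ =>
        hint ψ ψ.continuous.measurable (ψ.continuous.integrable_of_hasCompactSupport
          (HasCompactSupport.of_compactSpace _))⟩
  choose f bound measurable eq_of_notMem integral using exists_slice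
  exact ⟨f, bound, measurable, fun j t => eq_of_notMem t j, integral⟩

namespace IsLimitTransport

lemma ae_eventually_eq (hf : IsLimitTransport A U g M f) (h : IsStabilising u A U) :
    ∀ᵐ p ∂spaceTime, ∀ᶠ j in atTop, transport (A j) g p.1 = f p.1 := by
  refine ae_spaceTime_of_ae_time (P := fun t => ∀ᶠ j in atTop, transport (A j) g t = f t)
    (ae_restrict_of_ae (h.ae_exists_notMem.mono ?_))
  rintro t ⟨j, hj⟩
  filter_upwards [eventually_ge_atTop j] with l hl
  exact (hf.eq_of_notMem fun hmem => hj (h.antitone hl hmem)).symm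

lemma tendsto_ae (hf : IsLimitTransport A U g M f) (h : IsStabilising u A U) :
    ∀ᵐ p ∂spaceTime, Tendsto (fun j => transport (A j) g p.1 p.2) atTop (𝓝 (f p.1 p.2)) := by
  filter_upwards [hf.ae_eventually_eq h] with p hp
  exact tendsto_const_nhds.congr' (hp.mono fun j hj => by simp only [hj])

lemma aestronglyMeasurable (hf : IsLimitTransport A U g M f) (h : IsStabilising u A U)
    (hg : Measurable g) : AEStronglyMeasurable (fun p : ℝ × T2 => f p.1 p.2) spaceTime :=
  aestronglyMeasurable_of_tendsto_ae atTop
    (fun j => ((h.isFlowAlong j).measurable_transport hg).aestronglyMeasurable) (hf.tendsto_ae h)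

lemma isLinftyLinfty (hf : IsLimitTransport A U g M f) (h : IsStabilising u A U)
    (hg : Measurable g) : IsLinftyLinfty f :=
  memLp_top_of_bound (hf.aestronglyMeasurable h hg) M (Eventually.of_forall fun _ => hf.bound _ _)

lemma continuous_integral_mul (hf : IsLimitTransport A U g M f)
    (h : IsStabilising u A U) (hg : Measurable g) (hM : ∀ x, |g x| ≤ M) (ψ : C(T2, ℝ)) :
    Continuous fun t => ∫ x, f t x * ψ x := by
  simp only [hf.integral]
  refine continuous_of_dominated (bound := fun _ => M * ‖ψ‖) (fun t => ?_)
    (fun t => Eventually.of_forall fun x => ?_) (integrable_const _)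
    (Eventually.of_forall fun x =>
      continuous_const.mul (ψ.continuous.comp (h.continuous_limitFlow_time x)))
  · exact (hg.mul (ψ.continuous.measurable.comp
      (h.measurePreserving_limitFlow t).measurable)).aestronglyMeasurable
  · rw [norm_mul]
    exact mul_le_mul (hM x) (ψ.norm_coe_le_norm _) (norm_nonneg _) ((abs_nonneg _).trans (hM x))

lemma isC0WeakStarLinfty (hf : IsLimitTransport A U g M f) (h : IsStabilising u A U)
    (hg : Measurable g) (hM : ∀ x, |g x| ≤ M) : IsC0WeakStarLinfty f := by
  have hM0 : 0 ≤ M := (abs_nonneg _).trans (hM 0)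
  have hfm (t : ℝ) := (hf.measurable t).aestronglyMeasurable (μ := volume)
  have hfb (t : ℝ) : ∀ᵐ x : T2, ‖f t x‖ ≤ M := Eventually.of_forall (hf.bound t)
  refine ⟨fun t _ => memLp_top_of_bound (hfm t) M (hfb t), fun G hG =>
    (continuous_of_uniform_approx_of_continuous fun V hV => ?_).continuousOn⟩
  obtain ⟨ε, hε, hεV⟩ := Metric.mem_uniformity_dist.1 hV
  obtain ⟨ψ, hψ, hψi⟩ := hG.exists_boundedContinuous_integral_sub_le
    (ε := ε / (2 * (M + 1))) (by positivity)
  refine ⟨fun t => ∫ x, f t x * ψ x,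
    hf.continuous_integral_mul h hg hM ψ.toContinuousMap, fun t => hεV ?_⟩
  calc dist (∫ x, f t x * G x) (∫ x, f t x * ψ x) = ‖∫ x, (f t x * G x - f t x * ψ x)‖ := by
        rw [dist_eq_norm, integral_sub (hG.bdd_mul (hfm t) (hfb t)) (hψi.bdd_mul (hfm t) (hfb t))]
    _ ≤ ∫ x, M * ‖G x - ψ x‖ := by
        refine norm_integral_le_of_norm_le ((hG.sub hψi).norm.const_mul M)
          (Eventually.of_forall fun x => ?_)
        rw [← mul_sub, norm_mul]
        exact mul_le_mul_of_nonneg_right (hf.bound t x) (norm_nonneg _)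
    _ ≤ M * (ε / (2 * (M + 1))) := by
        rw [integral_const_mul]
        gcongr
    _ < ε := by
        rw [mul_div_assoc', div_lt_iff₀ (by positivity)]
        nlinarith

lemma tendstoWeakStar (hf : IsLimitTransport A U g M f) (h : IsStabilising u A U)
    (hg : Measurable g) (hM : ∀ x, |g x| ≤ M) :
    TendstoWeakStar (fun j => transport (A j) g) f := by
  intro G hG
  refine tendsto_integral_of_dominated_convergence (fun p => M * ‖G p‖) (fun j => ?_)
    (hG.norm.const_mul M) (fun j => Eventually.of_forall fun p => ?_)
    ((hf.tendsto_ae h).mono fun p hp => hp.mul_const _)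
  · exact ((h.isFlowAlong j).measurable_transport hg).aestronglyMeasurable.mul
      hG.aestronglyMeasurable
  · rw [norm_mul]
    exact mul_le_mul_of_nonneg_right (hM _) (norm_nonneg _)

lemma normLpLinfty_sub_le (hf : IsLimitTransport A U g M f) (h : IsStabilising u A U)
    (hM : ∀ x, |g x| ≤ M) {p : ℝ} (hp : 0 < p) (j : ℕ) :
    normLpLinfty p (fun t x => transport (A j) g t x - f t x) ≤
      (ENNReal.ofReal (2 * M) ^ p * volume (U j)) ^ (1 / p) := by
  refine ENNReal.rpow_le_rpow ?_ (by positivity)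
  calc ∫⁻ t in Icc (0 : ℝ) 1, eLpNorm (fun x => transport (A j) g t x - f t x) ⊤ volume ^ p
      ≤ ∫⁻ t in Icc (0 : ℝ) 1, (U j).indicator (fun _ => ENNReal.ofReal (2 * M) ^ p) t := by
        refine lintegral_mono fun t => ?_
        by_cases ht : t ∈ U j
        · rw [indicator_of_mem ht, eLpNorm_exponent_top, two_mul]
          exact ENNReal.rpow_le_rpow (eLpNormEssSup_le_of_ae_bound (Eventually.of_forall fun x =>
            (norm_sub_le _ _).trans (add_le_add (hM _) (hf.bound t x)))) hp.le
        · simp only [hf.eq_of_notMem ht, sub_self, eLpNorm_zero', ENNReal.zero_rpow_of_pos hp,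
            zero_le]
    _ ≤ ∫⁻ t, (U j).indicator (fun _ => ENNReal.ofReal (2 * M) ^ p) t :=
        setLIntegral_le_lintegral _ _
    _ = ENNReal.ofReal (2 * M) ^ p * volume (U j) :=
        lintegral_indicator_const (h.measurableSet j) _

lemma tendsto_normLpLinfty_sub (hf : IsLimitTransport A U g M f) (h : IsStabilising u A U)
    (hM : ∀ x, |g x| ≤ M) {p : ℝ} (hp : 0 < p) :
    Tendsto (fun j => normLpLinfty p fun t x => transport (A j) g t x - f t x) atTop (𝓝 0) := by
  have hlim := (ENNReal.Tendsto.const_mul h.tendsto_volume (Or.inr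
    (ENNReal.rpow_ne_top_of_nonneg hp.le ENNReal.ofReal_ne_top))).ennrpow_const (1 / p)
    (a := ENNReal.ofReal (2 * M) ^ p * 0)
  rw [mul_zero, ENNReal.zero_rpow_of_pos (by positivity)] at hlim
  exact tendsto_of_tendsto_of_tendsto_of_le_of_le tendsto_const_nhds hlim (fun _ => zero_le)
    (hf.normLpLinfty_sub_le h hM hp)

lemma fractalConvergence (hf : IsLimitTransport A U g M f) (h : IsStabilising u A U)
    (hg : Measurable g) (hM : ∀ x, |g x| ≤ M)
    (hslot : ∀ q ∈ dyadic, ∀ᶠ j in atTop,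
      ∀ t ∈ Icc (startTime q) (startTime q + slotLen q.1), t ∉ U j)
    (hone : ∀ᶠ j in atTop, 1 ∉ U j) : FractalConvergence (fun j => transport (A j) g) f where
  weakStar := hf.tendstoWeakStar h hg hM
  strong _ hp := hf.tendsto_normLpLinfty_sub h hM (by linarith)
  eventuallyConst q hq := (hslot q hq).mono fun j hj t ht => by rw [hf.eq_of_notMem (hj t ht)]
  eventuallyConst_one := hone.mono fun j hj => by rw [hf.eq_of_notMem hj]

variable {v : ℝ → T2 → (Fin 2 → ℝ)}

lemma integral_mul_materialDeriv (hf : IsLimitTransport A U g M f) (h : IsStabilising u A U)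
    (hv : ∀ t, ∀ᶠ j in atTop, u j t = v t) (hg : Measurable g) {β : ℝ → ℝ} (hβ : Continuous β)
    {B : ℝ} (hB : ∀ x, |β (g x)| ≤ B) {φ : ℝ → T2 → ℝ} (hφ : IsTestFunction φ) :
    ∫ p, β (f p.1 p.2) * materialDeriv v φ p.1 p.2 ∂spaceTime = -∫ x, β (g x) * φ 0 x := by
  obtain ⟨C, hC⟩ := hφ.exists_bound
  have hlim : Tendsto (fun j => ∫ p, β (transport (A j) g p.1 p.2) *
      materialDeriv (u j) φ p.1 p.2 ∂spaceTime) atTop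
      (𝓝 (∫ p, β (f p.1 p.2) * materialDeriv v φ p.1 p.2 ∂spaceTime)) := by
    refine tendsto_integral_of_dominated_convergence (fun _ => B * C) (fun j => ?_)
      (integrable_const _) (fun j => ?_) ?_
    · exact ((hβ.measurable.comp ((h.isFlowAlong j).measurable_transport hg)).mul
        (hφ.measurable_materialDeriv (h.isFlowAlong j).measurable_field)).aestronglyMeasurable
    · filter_upwards [ae_spaceTime_mem] with p hp
      rw [norm_mul]
      exact mul_le_mul (hB _) (hC _ _ _ hp ((h.isFlowAlong j).norm_field_le _ _)) (norm_nonneg _)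
        ((abs_nonneg _).trans (hB 0))
    · filter_upwards [hf.ae_eventually_eq h] with p hp
      refine tendsto_const_nhds.congr' ?_
      filter_upwards [hp, hv p.1] with j hf_eq hu_eq
      simp only [materialDeriv, advect, hf_eq, hu_eq]
  have hconst (j : ℕ) : ∫ p, β (transport (A j) g p.1 p.2) * materialDeriv (u j) φ p.1 p.2
      ∂spaceTime = -∫ x, β (g x) * φ 0 x :=
    (h.isFlowAlong j).integral_transport_mul_materialDeriv (hβ.measurable.comp hg) hB hφ
  simp only [hconst] at hlim
  exact (tendsto_nhds_unique tendsto_const_nhds hlim).symm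

lemma isRenormalised (hf : IsLimitTransport A U g M f) (h : IsStabilising u A U)
    (hv : ∀ t, ∀ᶠ j in atTop, u j t = v t) (hvm : Measurable fun p : ℝ × T2 => v p.1 p.2)
    (hv1 : ∀ t x, ‖v t x‖ ≤ 1) (hg : Measurable g) (hM : ∀ x, |g x| ≤ M) {f₀ : T2 → ℝ}
    (he : f₀ =ᵐ[volume] g) : IsRenormalised v f₀ f := by
  have hdiv : IsDivFree v := isDivFree_of_integral hvm hv1 fun φ hφ => by
    simpa only [one_mul] using
      hf.integral_mul_materialDeriv h hv hg (β := fun _ => 1) continuous_const (B := 1) (by simp) hφ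
  have weak (β : ℝ → ℝ) (hβ : Continuous β) :
      IsWeakSolution v (fun x => β (f₀ x)) (fun t x => β (f t x)) := by
    obtain ⟨B, hB⟩ := (isCompact_Icc (a := -M) (b := M)).exists_bound_of_continuousOn
      hβ.continuousOn
    have hgB (x : T2) : |β (g x)| ≤ B := hB _ (abs_le.1 (hM x))
    refine IsWeakSolution.congr_data (g₀ := fun x => β (g x)) ?_ (he.fun_comp β)
    exact isWeakSolution_of_integral hvm hv1 hdiv
      (integrable_of_bounded (hβ.measurable.comp hg) hgB)
      (hβ.comp_aestronglyMeasurable (hf.aestronglyMeasurable h hg))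
      (fun t x => hB _ (abs_le.1 (hf.bound t x)))
      fun φ hφ => hf.integral_mul_materialDeriv h hv hg hβ hgB hφ
  exact ⟨weak id continuous_id, fun β hβ _ => weak β hβ⟩

end IsLimitTransport

end

lemma tendsto_two_mul_add_atTop (e : ℕ) : Tendsto (fun j => 2 * j + e) atTop atTop :=
  tendsto_atTop_mono (fun j => (by omega : j ≤ 2 * j + e)) tendsto_id

lemma isStabilising_truncatedFlow {i : ℕ → Fin 2} {L : ℕ → ℕ} {τ : ℕ → ℝ}
    (hτ : ∀ k, 1 ≤ k → 0 < τ k) (hfin : FinitenessCondition τ)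
    (hcan : CancellationConditions i L τ) (e : ℕ) :
    IsStabilising (fun j => truncatedField i L τ (2 * j + e))
      (fun j => truncatedFlow i L τ (2 * j + e)) (fun j => unresolved (2 * j + e)) where
  isFlowAlong _ := isFlowAlong_truncatedFlow hfin hτ _
  measurableSet _ := measurableSet_unresolved _
  antitone _ _ hjl := antitone_unresolved (by omega)
  tendsto_volume := tendsto_volume_unresolved.comp (tendsto_two_mul_add_atTop e)
  eq_of_notMem j l hjl t ht := by
    obtain ⟨d, rfl⟩ := Nat.exists_eq_add_of_le hjl
    rw [show 2 * (j + d) + e = 2 * j + e + 2 * d by ring]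
    exact truncatedFlow_add_two_mul hτ hfin hcan ht d

/-! ### Translation invariant functions on the torus -/

section InvariantTranslations

variable {G β : Type*} [AddGroup G] [MeasurableSpace G] {μ : Measure G} {g : G → β}

/-- The group of translations that leave `g` invariant almost everywhere. -/
def invariantTranslations [MeasurableAdd G] (μ : Measure G) [μ.IsAddLeftInvariant] (g : G → β) :
    AddSubgroup G where
  carrier := {v | (fun x => g (v + x)) =ᵐ[μ] g}
  zero_mem' := by simp
  add_mem' {v w} hv hw := by
    change _ =ᵐ[μ] _
    filter_upwards [(measurePreserving_add_left μ w).quasiMeasurePreserving.ae hv, hw]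
      with x hv_add hw_x
    rw [add_assoc, hv_add, hw_x]
  neg_mem' {v} hv := by
    change _ =ᵐ[μ] _
    filter_upwards [(measurePreserving_add_left μ (-v)).quasiMeasurePreserving.ae hv]
      with x hv_neg
    rw [← hv_neg, add_neg_cancel_left]

lemma exists_ae_eq_const_of_dense_invariantTranslations [TopologicalSpace G] [BorelSpace G]
    [IsTopologicalAddGroup G] [R1Space G] [MeasurableAdd₂ G] [IsFiniteMeasure μ] [μ.InnerRegular]
    [μ.IsAddLeftInvariant] [MeasurableSpace β] [MeasurableSpace.CountablySeparated β] [Nonempty β]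
    (hg : Measurable g) (h : Dense (invariantTranslations μ g : Set G)) :
    ∃ c : β, g =ᵐ[μ] fun _ => c := by
  refine exists_eventuallyEq_const_of_forall_separating MeasurableSet fun V hV =>
    eventuallyConst_pred.1 (aeconst_of_dense_setOfPred_preimage_vadd_ae (M := G)
      (hg hV).nullMeasurableSet (h.mono fun v hv => ?_))
  have hv_eq : (fun x => g (v + x)) =ᵐ[μ] g := hv
  exact hv_eq.fun_comp (· ∈ V)

end InvariantTranslations

lemma dense_of_forall_exists_single_mem {d : Type*} [Finite d] [DecidableEq d]
    {H : AddSubgroup (UnitAddTorus d)}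
    (h : ∀ j, ∀ ε > 0, ∃ s ∈ Ioo (0 : ℝ) ε, Pi.single j (s : UnitAddCircle) ∈ H) :
    Dense (H : Set (UnitAddTorus d)) := by
  have := Fintype.ofFinite d
  let axis (j : d) : AddSubgroup UnitAddCircle :=
    H.comap (AddMonoidHom.single (fun _ : d => UnitAddCircle) j)
  have dense_axis (j : d) : Dense (axis j : Set UnitAddCircle) := by
    have dense_lift : Dense ((axis j).comap (QuotientAddGroup.mk' _) : Set ℝ) :=
      AddSubgroup.dense_of_not_isolated_zero _ fun ε hε =>
        (h j ε hε).imp fun s hs => ⟨hs.2, hs.1⟩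
    exact (QuotientAddGroup.mk_surjective.denseRange.dense_image
      (AddCircle.continuous_mk' 1) dense_lift).mono (image_subset_iff.2 subset_rfl)
  refine (dense_pi univ fun j _ => dense_axis j).mono fun x hx => ?_
  rw [SetLike.mem_coe, ← Finset.univ_sum_single x]
  exact sum_mem fun j _ => hx j (mem_univ j)

lemma single_mem_invariantTranslations_of_shearFlow {β : Type*} {g : T2 → β} {i : Fin 2} {L : ℕ}
    {t : ℝ} (h : (fun x => g (shearFlow i L t x)) =ᵐ[volume] g) :
    Pi.single i (t : UnitAddCircle) ∈ invariantTranslations volume g := by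
  have h_translate := (measurePreserving_add_left volume
    (Pi.single i (t : UnitAddCircle) : T2)).quasiMeasurePreserving.ae h
  filter_upwards [h, h_translate] with x hx hx_translate
  rcases shearSign_eq_one_or_neg_one L (x (1 - i)) with hsign | hsign
  · rw [← hx, shearFlow, hsign, mul_one, add_comm]
  · rw [← hx_translate, shearFlow, Pi.add_apply, Pi.single_eq_of_ne (one_sub_ne i), zero_add,
      hsign, add_right_comm, ← Pi.single_add]
    simp

/-! ### The two limits are different -/

lemma ae_eq_of_isC0WeakStarLinfty {f g : ℝ → T2 → ℝ} (hf : IsC0WeakStarLinfty f)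
    (hg : IsC0WeakStarLinfty g) (h : Function.uncurry f =ᵐ[spaceTime] Function.uncurry g)
    {t : ℝ} (ht : t ∈ Icc (0 : ℝ) 1) : f t =ᵐ[volume] g t := by
  have h_slice : ∀ᵐ s ∂(volume : Measure ℝ).restrict (Icc 0 1), f s =ᵐ[volume] g s :=
    Measure.ae_ae_of_ae_prod h
  have hfi := (hf.1 t ht).integrable le_top
  have hgi := (hg.1 t ht).integrable le_top
  refine (sub_ae_eq_zero _ _).1
    (ae_eq_zero_of_forall_integral_mul_continuous (hfi.sub hgi) fun ψ => ?_)
  have hψm : AEStronglyMeasurable ψ (volume : Measure T2) :=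
    ψ.continuous.measurable.aestronglyMeasurable
  have hψb : ∀ᵐ x : T2, ‖ψ x‖ ≤ ‖ψ‖ := Eventually.of_forall ψ.norm_coe_le_norm
  have hψi : Integrable ψ (volume : Measure T2) := Integrable.of_bound hψm ‖ψ‖ hψb
  have integral_eq : ∫ x, f t x * ψ x = ∫ x, g t x * ψ x :=
    Measure.eqOn_Icc_of_ae_eq (volume : Measure ℝ) zero_ne_one
      (h_slice.mono fun s hs => integral_congr_ae (hs.mul .rfl)) (hf.2 ψ hψi) (hg.2 ψ hψi) ht
  simp only [Pi.sub_apply, sub_mul]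
  rw [integral_sub (hfi.mul_bdd hψm hψb) (hgi.mul_bdd hψm hψb), integral_eq, sub_self]

/-- The limit of the solutions `f^{2j+e}` with initial data `g`. -/
abbrev IsParityLimit (i : ℕ → Fin 2) (L : ℕ → ℕ) (τ : ℕ → ℝ) (e : ℕ) (g : T2 → ℝ) (M : ℝ)
    (f : ℝ → T2 → ℝ) : Prop :=
  IsLimitTransport (fun j => truncatedFlow i L τ (2 * j + e)) (fun j => unresolved (2 * j + e))
    g M f

section ParityLimit

variable {i : ℕ → Fin 2} {L : ℕ → ℕ} {τ : ℕ → ℝ} {e : ℕ} {g : T2 → ℝ} {M : ℝ} {f : ℝ → T2 → ℝ}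

lemma exists_isParityLimit (hτ : ∀ k, 1 ≤ k → 0 < τ k) (hfin : FinitenessCondition τ)
    (hcan : CancellationConditions i L τ) (hg : Measurable g) (hM : ∀ x, |g x| ≤ M) (e : ℕ) :
    ∃ f, IsParityLimit i L τ e g M f :=
  (isStabilising_truncatedFlow hτ hfin hcan e).exists_isLimitTransport hg hM

lemma IsParityLimit.fractalConvergence (hf : IsParityLimit i L τ e g M f)
    (hτ : ∀ k, 1 ≤ k → 0 < τ k) (hfin : FinitenessCondition τ)
    (hcan : CancellationConditions i L τ) (hg : Measurable g) (hM : ∀ x, |g x| ≤ M) :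
    FractalConvergence (fun j => transport (truncatedFlow i L τ (2 * j + e)) g) f :=
  IsLimitTransport.fractalConvergence hf (isStabilising_truncatedFlow hτ hfin hcan e) hg hM
    (fun q hq => ((tendsto_two_mul_add_atTop e).eventually_ge_atTop q.1).mono fun _ hj _ ht =>
      notMem_unresolved_of_mem_slot hq hj ht)
    (Eventually.of_forall fun _ => one_notMem_unresolved _)

lemma IsParityLimit.isRenormalised (hf : IsParityLimit i L τ e g M f)
    (hτ : ∀ k, 1 ≤ k → 0 < τ k) (hfin : FinitenessCondition τ)
    (hcan : CancellationConditions i L τ) (hg : Measurable g) (hM : ∀ x, |g x| ≤ M)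
    {f₀ : T2 → ℝ} (he : f₀ =ᵐ[volume] g) : IsRenormalised (limitField i L τ) f₀ f :=
  IsLimitTransport.isRenormalised hf (isStabilising_truncatedFlow hτ hfin hcan e)
    (fun t => (tendsto_two_mul_add_atTop e).eventually (eventually_truncatedField_eq hfin t))
    (measurable_fractalField hfin subset_rfl) (norm_fractalField_le _) hg hM he

lemma IsParityLimit.even_one (hf : IsParityLimit i L τ 0 g M f) : f 1 = g :=
  hf.eq_of_notMem (j := 0) (one_notMem_unresolved _)

lemma transport_one_shearFlow (hτ : ∀ k, 1 ≤ k → 0 < τ k) (hfin : FinitenessCondition τ)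
    (g : T2 → ℝ) (K : ℕ) (x : T2) :
    transport (truncatedFlow i L τ (K + 1)) g 1
      (shearFlow (i (K + 1)) (L (K + 1)) (2 * τ (K + 1)) x) =
      transport (truncatedFlow i L τ (K + 1)) g (1 - slotLen K) x := by
  obtain ⟨y, rfl⟩ := (truncatedFlow i L τ (K + 1) (1 - slotLen K)).surjective x
  rw [← truncatedFlow_succ_one_apply hτ hfin, transport, transport,
    MeasurableEquiv.symm_apply_apply, MeasurableEquiv.symm_apply_apply]

lemma transport_one (hτ : ∀ k, 1 ≤ k → 0 < τ k) (hfin : FinitenessCondition τ) (g : T2 → ℝ)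
    (K : ℕ) : transport (truncatedFlow i L τ K) g 1 =
      transport (truncatedFlow i L τ K) g (1 - slotLen K) := by
  have hA := MeasurableEquiv.ext (funext (truncatedFlow_one_apply (i := i) (L := L) hτ hfin K))
  exact funext fun x => by simp only [transport, hA]

lemma IsParityLimit.odd_one (hf : IsParityLimit i L τ 1 g M f) (hτ : ∀ k, 1 ≤ k → 0 < τ k)
    (hfin : FinitenessCondition τ) (x : T2) :
    f 1 x = g (shearFlow (i 1) (L 1) (-2 * τ 1) x) := by
  set y := shearFlow (i 1) (L 1) (-2 * τ 1) x with hy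
  have hx : x = shearFlow (i 1) (L 1) (2 * τ 1) y := by
    rw [hy, shearFlow_shearFlow]
    simp
  have hstart : truncatedFlow i L τ 1 (1 - slotLen 0) = MeasurableEquiv.refl T2 :=
    blockFlow_of_le 1 0 (by rw [slotLen_zero, sub_self])
  calc f 1 x
    _ = transport (truncatedFlow i L τ 1) g 1 (shearFlow (i 1) (L 1) (2 * τ 1) y) := by
      rw [hf.eq_of_notMem (j := 0) (one_notMem_unresolved _), hx]
    _ = transport (truncatedFlow i L τ 1) g (1 - slotLen 0) y :=
      transport_one_shearFlow hτ hfin g 0 y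
    _ = g y := by rw [transport, hstart]; rfl

lemma ae_eq_of_notMem_unresolved {fEven fOdd : ℝ → T2 → ℝ} (hE : IsParityLimit i L τ 0 g M fEven)
    (hO : IsParityLimit i L τ 1 g M fOdd) {K : ℕ} {t : ℝ} (h : fEven t =ᵐ[volume] fOdd t)
    (ht : t ∉ unresolved K) : transport (truncatedFlow i L τ K) g t =ᵐ[volume] fEven t := by
  obtain ⟨j, rfl | rfl⟩ := K.even_or_odd'
  · rw [hE.eq_of_notMem (j := j) ht, Nat.add_zero]
  · rw [← hO.eq_of_notMem ht]
    exact h.symm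

lemma ae_eq_shearFlow_of_limits_ae_eq {fEven fOdd : ℝ → T2 → ℝ}
    (hE : IsParityLimit i L τ 0 g M fEven) (hO : IsParityLimit i L τ 1 g M fOdd)
    (hτ : ∀ k, 1 ≤ k → 0 < τ k) (hfin : FinitenessCondition τ)
    (h : ∀ t ∈ Icc (0 : ℝ) 1, fEven t =ᵐ[volume] fOdd t) (K : ℕ) :
    (fun x => g (shearFlow (i (K + 1)) (L (K + 1)) (2 * τ (K + 1)) x)) =ᵐ[volume] g := by
  have hmem : 1 - slotLen K ∈ Icc (0 : ℝ) 1 := by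
    have hle : slotLen K ≤ 1 := by
      rw [slotLen_eq]
      exact pow_le_one₀ (by norm_num) (by norm_num)
    exact ⟨by linarith, by linarith [slotLen_pos K]⟩
  have hres := one_sub_slotLen_notMem_unresolved K
  have hres_succ : 1 - slotLen K ∉ unresolved (K + 1) :=
    fun hmem_succ => hres (antitone_unresolved K.le_succ hmem_succ)
  have transport_one_ae_eq (n : ℕ) : transport (truncatedFlow i L τ n) g 1 =ᵐ[volume] g := by
    simpa only [hE.even_one] using
      ae_eq_of_notMem_unresolved hE hO (h 1 ⟨zero_le_one, le_rfl⟩) (one_notMem_unresolved n)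
  have transport_slot_ae_eq :
      transport (truncatedFlow i L τ (K + 1)) g (1 - slotLen K) =ᵐ[volume] g :=
    calc transport (truncatedFlow i L τ (K + 1)) g (1 - slotLen K)
      _ =ᵐ[volume] fEven (1 - slotLen K) := ae_eq_of_notMem_unresolved hE hO (h _ hmem) hres_succ
      _ =ᵐ[volume] transport (truncatedFlow i L τ K) g (1 - slotLen K) :=
        (ae_eq_of_notMem_unresolved hE hO (h _ hmem) hres).symm
      _ = transport (truncatedFlow i L τ K) g 1 := (transport_one hτ hfin g K).symm
      _ =ᵐ[volume] g := transport_one_ae_eq K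
  filter_upwards [transport_slot_ae_eq, (measurePreserving_shearFlow (i (K + 1)) (L (K + 1))
    (2 * τ (K + 1))).quasiMeasurePreserving.ae (transport_one_ae_eq (K + 1))] with x hx hshear
  rw [← hshear, transport_one_shearFlow hτ hfin, hx]

lemma tendsto_two_mul_duration (hτ : ∀ k, 1 ≤ k → 0 < τ k) (hfin : FinitenessCondition τ) :
    Tendsto (fun k => 2 * τ (k + 1)) atTop (𝓝 0) := by
  have hlim : Tendsto (fun k => 2 * slotLen (k + 1)) atTop (𝓝 0) := by
    have hpow := tendsto_pow_atTop_nhds_zero_of_lt_one (r := (1 / 4 : ℝ)) (by norm_num)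
      (by norm_num)
    simpa only [slotLen_eq, mul_zero, Function.comp_apply] using
      (hpow.comp (tendsto_add_atTop_nat 1)).const_mul 2
  exact squeeze_zero (fun k => by linarith [hτ (k + 1) k.succ_pos])
    (fun k => mul_le_mul_of_nonneg_left (hfin (k + 1) k.succ_pos).le zero_le_two) hlim

lemma exists_ae_eq_const_of_limits_ae_eq {fEven fOdd : ℝ → T2 → ℝ}
    (hE : IsParityLimit i L τ 0 g M fEven) (hO : IsParityLimit i L τ 1 g M fOdd)
    (hτ : ∀ k, 1 ≤ k → 0 < τ k) (hfin : FinitenessCondition τ)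
    (hi : ∀ k, 1 ≤ k → i (k + 1) ≠ i k) (hg : Measurable g)
    (h : ∀ t ∈ Icc (0 : ℝ) 1, fEven t =ᵐ[volume] fOdd t) : ∃ c : ℝ, g =ᵐ[volume] fun _ => c := by
  refine exists_ae_eq_const_of_dense_invariantTranslations hg
    (dense_of_forall_exists_single_mem fun j ε hε => ?_)
  have exists_direction (N : ℕ) : ∃ k ≥ N, i (k + 1) = j := by
    rcases eq_or_eq_one_sub (i (N + 1)) j with hj | hj
    · exact ⟨N, le_rfl, hj.symm⟩
    · exact ⟨N + 1, N.le_succ, by rw [hj, ← eq_one_sub_of_ne (hi (N + 1) N.succ_pos)]⟩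
  obtain ⟨N, hN⟩ := eventually_atTop.1 ((tendsto_two_mul_duration hτ hfin).eventually_lt_const hε)
  obtain ⟨k, hk, rfl⟩ := exists_direction N
  exact ⟨2 * τ (k + 1), ⟨by linarith [hτ (k + 1) k.succ_pos], hN k hk⟩,
    single_mem_invariantTranslations_of_shearFlow
      (ae_eq_shearFlow_of_limits_ae_eq hE hO hτ hfin h k)⟩

end ParityLimit

end FractalShear

end

theorem proposition4p5 (i : ℕ → Fin 2) (L : ℕ → ℕ) (τ : ℕ → ℝ)
    (hL : ∀ k, 1 ≤ k → 1 ≤ L k) (hτ : ∀ k, 1 ≤ k → 0 < τ k)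
    (hfin : FractalShear.FinitenessCondition τ)
    (f₀ : FractalShear.T2 → ℝ) (hf₀ : MemLp f₀ ⊤ volume) :
    ∃ f : ℕ → ℝ → FractalShear.T2 → ℝ,
      (∀ K, 1 ≤ K →
        FractalShear.IsWeakSolution (FractalShear.truncatedField i L τ K) f₀ (f K) ∧
        (∀ g : ℝ → FractalShear.T2 → ℝ,
          FractalShear.IsWeakSolution (FractalShear.truncatedField i L τ K) f₀ g →
          Function.uncurry g =ᵐ[FractalShear.spaceTime] Function.uncurry (f K)) ∧
        FractalShear.IsC0L1 (f K) ∧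
        FractalShear.IsLinftyLinfty (f K) ∧
        FractalShear.IsLagrangianSolution (FractalShear.truncatedField i L τ K) f₀ (f K) ∧
        FractalShear.IsRenormalised (FractalShear.truncatedField i L τ K) f₀ (f K)) ∧
      (FractalShear.CancellationConditions i L τ →
        ∃ fEven fOdd : ℝ → FractalShear.T2 → ℝ,
          FractalShear.IsLinftyLinfty fEven ∧ FractalShear.IsLinftyLinfty fOdd ∧
          FractalShear.IsC0WeakStarLinfty fEven ∧ FractalShear.IsC0WeakStarLinfty fOdd ∧
          FractalShear.FractalConvergence (fun K => f (2 * K)) fEven ∧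
          FractalShear.FractalConvergence (fun K => f (2 * K + 1)) fOdd ∧
          FractalShear.IsRenormalised (FractalShear.limitField i L τ) f₀ fEven ∧
          FractalShear.IsRenormalised (FractalShear.limitField i L τ) f₀ fOdd ∧
          fEven 1 =ᵐ[volume] f₀ ∧
          fOdd 1 =ᵐ[volume] (fun x => f₀ (FractalShear.shearFlow (i 1) (L 1) (-2 * τ 1) x)) ∧
          ((¬ ∃ c : ℝ, f₀ =ᵐ[volume] fun _ => c) →
            ¬ Function.uncurry fEven =ᵐ[FractalShear.spaceTime] Function.uncurry fOdd)) := by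
  obtain ⟨g, M, hg, hM, he⟩ := FractalShear.exists_bounded_representative hf₀
  have hgi := FractalShear.integrable_of_bounded hg hM
  refine ⟨fun K => FractalShear.transport (FractalShear.truncatedFlow i L τ K) g, fun K _ => ?_,
    fun hcan => ?_⟩
  · have hA := FractalShear.isFlowAlong_truncatedFlow (i := i) (L := L) hfin hτ K
    have hw := (hA.isWeakSolution_transport hg hM).congr_data he
    exact ⟨hw, fun f hf => hf.ae_eq_of_truncatedField hfin hL hτ hw, hA.isC0L1_transport hgi,
      hA.isLinftyLinfty_transport hg hM, hA.isLagrangianSolution_transport he hg hM,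
      hA.isRenormalised_transport he hg hM⟩
  have hstab := FractalShear.isStabilising_truncatedFlow (i := i) (L := L) hτ hfin hcan
  obtain ⟨fEven, hE⟩ := FractalShear.exists_isParityLimit hτ hfin hcan hg hM 0
  obtain ⟨fOdd, hO⟩ := FractalShear.exists_isParityLimit hτ hfin hcan hg hM 1
  have hEc := hE.isC0WeakStarLinfty (hstab 0) hg hM
  have hOc := hO.isC0WeakStarLinfty (hstab 1) hg hM
  refine ⟨fEven, fOdd, hE.isLinftyLinfty (hstab 0) hg, hO.isLinftyLinfty (hstab 1) hg, hEc, hOc,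
    hE.fractalConvergence hτ hfin hcan hg hM, hO.fractalConvergence hτ hfin hcan hg hM,
    hE.isRenormalised hτ hfin hcan hg hM he, hO.isRenormalised hτ hfin hcan hg hM he,
    hE.even_one ▸ he.symm, ?_, fun hne heq => hne ?_⟩
  · filter_upwards [(FractalShear.measurePreserving_shearFlow (i 1) (L 1)
      (-2 * τ 1)).quasiMeasurePreserving.ae he] with x hx
    rw [hO.odd_one hτ hfin, hx]
  · obtain ⟨c, hc⟩ := FractalShear.exists_ae_eq_const_of_limits_ae_eq hE hO hτ hfin
      (fun k hk => (hcan k hk).1) hg fun t ht =>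
        FractalShear.ae_eq_of_isC0WeakStarLinfty hEc hOc heq ht
    exact ⟨c, he.trans hc⟩
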